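/- Let $\mathbb D=\{|z|<1\}$, and write $\partial_z=\frac12(\partial_x-i\partial_y)$, $\partial_{\bar z}=\frac12(\partial_x+i\partial_y)$. **Harmonic mapping and lift.** Let $f=h+\overline g$ be a complex-valued harmonic function on $\mathbb D$, with $h,g$ analytic in $\mathbb D$ and $g(a)=0$ for a fixed $a\in\mathbb D$. Assume that $|h'|+|g'|\neq0$ everywhere in $\mathbb D$, that $h'\not\equiv0$, and that the dilatation $\omega=g'/h'$ equals $q^2$ for a meromorphic function $q$ in $\mathbb D$. Let $$\widetilde f(z)=\Bigl(\operatorname{Re}f(z),\ \operatorname{Im}f(z),\ 2\operatorname{Im}\int_a^z h'(\zeta)q(\zeta)\,d\zeta\Bigr)\in\mathbb R^3$$ be its Weierstrass–Enneper lift, $\sigma=\log(|h'|+|g'|)$, $\mathcal Sf=2(\sigma_{zz}-\sigma_z^2)$ and $K=-e^{-2\sigma}\Delta\sigma$. **Metric.** Let $\rho:\mathbb D\to\mathbb R$ be smooth, and suppose that the metric $\mathbf g=e^{2\rho}|dz|^2$ has non-positive curvature, i.e. $\rho_{z\bar z}\ge0$. Let $0<\delta\le\infty$, and suppose that any two points of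 $\mathbb D$ can be joined by a $\mathbf g$-geodesic in $\mathbb D$ of length less than $\delta$, and that in $\mathbb D$ $$\bigl|\mathcal Sf-2(\rho_{zz}-\rho_z^2)\bigr|+e^{2\sigma}|K|\le\frac{2\pi^2e^{2\rho}}{\delta^2}+2\rho_{z\bar z}$$ (the term with $\delta^2$ being $0$ if $\delta=\infty$). **Boundary behaviour of geodesics.** $\mathbf g$ has property (ULP) if for every $z_0\in\mathbb D$: (a) every maximally extended unit-speed geodesic $\gamma:[0,T)\to\mathbb D$, $0<T\le\infty$, with $\gamma(0)=z_0$ has a limit $\lim_{t\to T}\gamma(t)\in\partial\mathbb D$ in the Euclidean sense; (b) this limit point is a continuous function of the initial direction of $\gamma$ at $z_0$; (c) every point of $\partial\mathbb D$ is the limit point of such a geodesic from $z_0$. It has property (ULP*) if it has (ULP) and, for every $z_0\in\mathbb D$, the length $T\in(0,\infty]$ of the maximally extended geodesic from $z_0$ is a continuous function of its initial direction. Suppose that $\mathbf g$ satisfies (ULP) if it is complete and (ULP*) if it is not complete. **Conclusion.** Then $\widetilde f$ has a spherically continuous extension to $\overline{\mathbb D}$: there is a map $F:\overline{\mathbb D}\to\mathbb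 R^3\cup\{\infty\}$, continuous for the spherical metric on $\mathbb R^3\cup\{\infty\}$, with $F=\widetilde f$ on $\mathbb D$. -/

import Mathlib

open Complex Metric Set Filter Topology
open scoped ENNReal ContDiff InnerProductSpace

noncomputable section

/-! ### Wirtinger derivatives, curvature and Schwarzian of a conformal metric -/

/-- The Wirtinger derivative `F_z = (F_x - i F_y) / 2`. -/
def dz (F : ℂ → ℂ) (z : ℂ) : ℂ := (fderiv ℝ F z 1 - I * fderiv ℝ F z I) / 2

/-- The Wirtinger derivative `F_{z̄} = (F_x + i F_y) / 2`. -/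
def dzbar (F : ℂ → ℂ) (z : ℂ) : ℂ := (fderiv ℝ F z 1 + I * fderiv ℝ F z I) / 2

/-- `ρ_{z z̄}` for a real-valued function `ρ`; it is a real number. -/
def dzdzbar (ρ : ℂ → ℝ) (z : ℂ) : ℝ := (dzbar (dz fun w => (ρ w : ℂ)) z).re

/-- The Gauss curvature `-e^{-2ρ} Δρ` of the metric `e^{2ρ} |dz|²`. -/
def gaussCurvature (ρ : ℂ → ℝ) (z : ℂ) : ℝ :=
  -(Real.exp (-2 * ρ z) * Laplacian.laplacian ρ z)

/-- The conformal Schwarzian `2 (ρ_{zz} - ρ_z²)` of `ρ` relative to the Euclidean metric. -/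
def conformalSchwarzian (ρ : ℂ → ℝ) (z : ℂ) : ℂ :=
  2 * (dz (dz fun w => (ρ w : ℂ)) z - dz (fun w => (ρ w : ℂ)) z ^ 2)

/-! ### Harmonic mappings of the unit disk and their lifts -/

/-- `f = h + conj g` is the canonical decomposition of the harmonic mapping `f` of the unit disk,
with `h`, `g` analytic and `g` normalized to vanish at the base point `a` of the disk. -/
structure IsCanonicalDecomposition (f h g : ℂ → ℂ) (a : ℂ) : Prop where
  harmonic : InnerProductSpace.HarmonicOnNhd f (ball 0 1)
  base_mem : a ∈ ball (0 : ℂ) 1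
  analytic_h : DifferentiableOn ℂ h (ball 0 1)
  analytic_g : DifferentiableOn ℂ g (ball 0 1)
  base_zero : g a = 0
  decomp : ∀ z ∈ ball (0 : ℂ) 1, f z = h z + (starRingEnd ℂ) (g z)

/-- The dilatation `g' / h'` is a well-defined meromorphic function (`h'` is not identically zero)
and it is the square of the meromorphic function `q` in the unit disk. -/
structure DilatationIsSquare (h g q : ℂ → ℂ) : Prop where
  nontrivial : ∃ z ∈ ball (0 : ℂ) 1, deriv h z ≠ 0
  meromorphic : MeromorphicOn q (ball 0 1)
  eq_sq : ∀ z ∈ ball (0 : ℂ) 1, deriv h z ≠ 0 → deriv g z / deriv h z = q z ^ 2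

/-- `σ = log (|h'| + |g'|)`: the first fundamental form of the lift is `e^{2σ} |dz|²`. -/
def liftExponent (h g : ℂ → ℂ) (z : ℂ) : ℝ := Real.log (‖deriv h z‖ + ‖deriv g z‖)

/-- The height `2 Im ∫_a^z h'(ζ) q(ζ) dζ`, integrated along the segment from `a` to `z`. The form
`h' q dζ` is holomorphic in the disk (its square is `h' g'`), up to removable singularities at the
poles of `q`; a segment meets only finitely many of those, so they do not affect the integral. -/
def liftHeight (h q : ℂ → ℂ) (a z : ℂ) : ℝ :=
  2 * (∫ t in (0 : ℝ)..1,
    deriv h (a + t * (z - a)) * q (a + t * (z - a)) * (z - a)).im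

/-- The Weierstrass--Enneper lift `(Re f, Im f, 2 Im ∫_a^z h' q dζ)`. -/
def harmonicLift (f h q : ℂ → ℂ) (a z : ℂ) : EuclideanSpace ℝ (Fin 3) :=
  !₂[(f z).re, (f z).im, liftHeight h q a z]

/-! ### Geodesics of the metric `e^{2ρ} |dz|²` in the unit disk -/

/-- `γ`, with velocity `v`, is an arc-length parametrized geodesic of `e^{2ρ} |dz|²` in the unit
disk, with the interval `s` as domain: it lies in the disk, has speed `e^ρ |v| = 1`, and solves the
geodesic equation, which for a conformal metric is `γ'' = -2 ρ_z(γ) (γ')²`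
(the only nonzero Christoffel symbols are `Γ^z_{zz} = 2 ρ_z` and its conjugate). -/
structure IsGeodesicOn (ρ : ℂ → ℝ) (s : Set ℝ) (γ v : ℝ → ℂ) : Prop where
  mem_disk : ∀ t ∈ s, γ t ∈ ball (0 : ℂ) 1
  velocity : ∀ t ∈ s, HasDerivWithinAt γ (v t) s t
  unit_speed : ∀ t ∈ s, Real.exp (ρ (γ t)) * ‖v t‖ = 1
  equation : ∀ t ∈ s,
    HasDerivWithinAt v (-2 * dz (fun w => (ρ w : ℂ)) (γ t) * v t ^ 2) s t

/-- Any two points of the disk can be joined by a geodesic of length less than `δ`. -/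
def JoinedByGeodesicsShorterThan (ρ : ℂ → ℝ) (δ : ℝ≥0∞) : Prop :=
  ∀ z₁ ∈ ball (0 : ℂ) 1, ∀ z₂ ∈ ball (0 : ℂ) 1,
    ∃ (L : ℝ) (γ v : ℝ → ℂ), 0 ≤ L ∧ ENNReal.ofReal L < δ ∧
      IsGeodesicOn ρ (Icc 0 L) γ v ∧ γ 0 = z₁ ∧ γ L = z₂

/-- The interval `[0, T)`, where `T ≤ ∞`. -/
def rayDomain (T : ℝ≥0∞) : Set ℝ := {t | 0 ≤ t ∧ ENNReal.ofReal t < T}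

/-- `γ` is the maximally extended arc-length parametrized geodesic `[0, T) → 𝔻` with `γ 0 = z₀`
and initial direction `u` (a Euclidean unit vector). Its length is `T`. -/
structure IsMaximalRay (ρ : ℂ → ℝ) (z₀ : ℂ) (u : Circle) (T : ℝ≥0∞) (γ v : ℝ → ℂ) : Prop where
  length_pos : 0 < T
  geodesic : IsGeodesicOn ρ (rayDomain T) γ v
  start : γ 0 = z₀
  direction : v 0 = Real.exp (-ρ z₀) * (u : ℂ)
  maximal : ∀ (T' : ℝ≥0∞) (γ' v' : ℝ → ℂ), T < T' → IsGeodesicOn ρ (rayDomain T') γ' v' →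
    ¬ EqOn γ' γ (rayDomain T)

/-- `γ(t) → ζ` in the Euclidean sense as `t` increases to `T ≤ ∞`. -/
def HasLimitPoint (T : ℝ≥0∞) (γ : ℝ → ℂ) (ζ : Circle) : Prop :=
  Tendsto γ (comap ENNReal.ofReal (𝓝[<] T)) (𝓝 (ζ : ℂ))

/-- The Unique Limit Point property: from each `z₀` in the disk, every maximal geodesic ray has a
limit point on the unit circle, the limit point depends continuously on the initial direction, and
every point of the unit circle is the limit point of such a ray. -/
def ULP (ρ : ℂ → ℝ) : Prop :=
  ∀ z₀ ∈ ball (0 : ℂ) 1,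
    (∃ E : Circle → Circle, Continuous E ∧
      ∀ (u : Circle) (T : ℝ≥0∞) (γ v : ℝ → ℂ), IsMaximalRay ρ z₀ u T γ v →
        HasLimitPoint T γ (E u)) ∧
    ∀ ζ : Circle, ∃ (u : Circle) (T : ℝ≥0∞) (γ v : ℝ → ℂ),
      IsMaximalRay ρ z₀ u T γ v ∧ HasLimitPoint T γ ζ

/-- (ULP) together with continuity of the length of the maximal geodesic rays from any given point
of the disk, as a function with values in `[0, ∞]` of the initial direction. -/
def ULPStar (ρ : ℂ → ℝ) : Prop :=
  ULP ρ ∧ ∀ z₀ ∈ ball (0 : ℂ) 1,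
    ∃ len : Circle → ℝ≥0∞, Continuous len ∧
      ∀ (u : Circle) (T : ℝ≥0∞) (γ v : ℝ → ℂ), IsMaximalRay ρ z₀ u T γ v → T = len u

/-- (Geodesic) completeness of the metric `e^{2ρ} |dz|²` of the unit disk: all maximally extended
geodesic rays have infinite length. -/
def IsCompleteMetric (ρ : ℂ → ℝ) : Prop :=
  ∀ z₀ ∈ ball (0 : ℂ) 1, ∀ (u : Circle) (T : ℝ≥0∞) (γ v : ℝ → ℂ),
    IsMaximalRay ρ z₀ u T γ v → T = ⊤

end

/-! The lift is the real part of a holomorphic null curve `F` in `ℂ³`, studied along the geodesics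
of `e^{2ρ} |dz|²` issuing from the origin. Three ingredients combine.

Polar coordinates. Non-positive curvature makes the exponential map expanding, because normal Jacobi
fields vanishing at the start grow at least linearly; so it is a local diffeomorphism. Continuity of
the ray lengths keeps limits of lifted paths in its domain, so segments lift through it, and it is a
homeomorphism of a star-shaped domain onto the disk (`IsPolarSystem.exists_inverse`): a
Cartan–Hadamard argument for possibly incomplete metrics. Injectivity identifies rays with the
joining geodesics, and extending rays backwards shows that they are strictly shorter than a finite
`δ` (`IsPolarSystem.len_lt`).

Growth. Along a unit-speed geodesic put `V = e^{(ρ - σ)/2}`, so that the image curve `φ` in space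
has speed `V⁻²`. The criterion is what is needed for `U = V ‖φ - p‖` to satisfy `U'' ≥ -(π²/δ²) U`
for every point `p` off the curve (`IsNullCurve.neg_le_of_criterion`, `IsControlledCurve.le`).
Placing `p` slightly behind the starting point makes `U'/U` large initially, and Sturm comparison
with a sine, or with `1 + t` if `δ = ∞`, gives `U ≥ c₀ (1 + t)` for all directions near a given one
(`IsNullCurve.exists_growth`). After inversion at `p` the curve has speed `U⁻²`, which is uniformly
integrable, so the surface has a limit in the sphere at the end of every ray
(`HasGrowth.exists_tendsto`), continuous in the direction.

Consistency. Several rays may end at the same boundary point `ζ`; those that matter form an arc of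
directions (`IsExpInverse.exists_arc`). Where the limit of the surface is finite, the growth bound
makes `F` itself converge, not only its real part, and a Lindelöf theorem in the sector swept by the
arc shows that the limits along its two edges coincide (`IsExpInverse.eq_zero_of_sector`,
`IsExpInverse.limit_eq_of_sector`). Hence the limit is constant on the arc
(`IsExpInverse.surface_limit_eq`), and the lift has a limit at every boundary point. -/

open scoped NNReal ComplexConjugate

/-! ### Autonomous ordinary differential equations -/

/-- `α` solves `α' = X(α)` on `[0, s]` inside `O`, with initial value `y`. -/
structure SolvesOn {E : Type*} [NormedAddCommGroup E] [NormedSpace ℝ E] (X : E → E) (O : Set E)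
    (y : E) (s : ℝ) (α : ℝ → E) : Prop where
  start : α 0 = y
  mem : ∀ t ∈ Icc 0 s, α t ∈ O
  deriv : ∀ t ∈ Icc 0 s, HasDerivWithinAt α (X (α t)) (Icc 0 s) t

section ODE

variable {E : Type*} [NormedAddCommGroup E] [NormedSpace ℝ E]

theorem HasDerivWithinAt.Ici_of_Icc {α : ℝ → E} {α' : E} {a s t : ℝ} (ht : t ∈ Ico a s)
    (h : HasDerivWithinAt α α' (Icc a s) t) : HasDerivWithinAt α α' (Ici t) t :=
  (h.mono (Icc_subset_Icc_left ht.1)).mono_of_mem_nhdsWithin (Icc_mem_nhdsGE ht.2)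

theorem SolvesOn.continuousOn {X : E → E} {O : Set E} {y : E} {s : ℝ} {α : ℝ → E}
    (h : SolvesOn X O y s α) : ContinuousOn α (Icc 0 s) :=
  fun t ht => (h.deriv t ht).continuousWithinAt

theorem SolvesOn.mono {X : E → E} {O : Set E} {y : E} {s s' : ℝ} {α : ℝ → E}
    (h : SolvesOn X O y s α) (hs : s' ≤ s) : SolvesOn X O y s' α :=
  ⟨h.start, fun t ht => h.mem t ⟨ht.1, ht.2.trans hs⟩, fun t ht =>
    (h.deriv t ⟨ht.1, ht.2.trans hs⟩).mono (Icc_subset_Icc_right hs)⟩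

theorem SolvesOn.congr {X : E → E} {O : Set E} {y : E} {s : ℝ} {α β : ℝ → E} (hs : 0 ≤ s)
    (h : SolvesOn X O y s α) (he : EqOn β α (Icc 0 s)) : SolvesOn X O y s β :=
  ⟨by rw [he ⟨le_rfl, hs⟩, h.start], fun t ht => by rw [he ht]; exact h.mem t ht, fun t ht => by
    rw [he ht]; exact (h.deriv t ht).congr he (he ht)⟩

/-- Concatenation of two solutions. -/
theorem SolvesOn.append {X : E → E} {O : Set E} {y : E} {s r : ℝ} {α β : ℝ → E} (hs : 0 ≤ s)
    (hr : 0 ≤ r) (h : SolvesOn X O y s α) (h' : SolvesOn X O (α s) r β) :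
    SolvesOn X O y (s + r) (fun t => if t ≤ s then α t else β (t - s)) := by
  set γ : ℝ → E := fun t => if t ≤ s then α t else β (t - s) with hγ
  have e1 : EqOn γ α (Icc 0 s) := fun t ht => by simp [hγ, ht.2]
  have e2 : EqOn γ (fun t => β (t - s)) (Icc s (s + r)) := fun t ht => by
    rcases eq_or_lt_of_le ht.1 with rfl | h1
    · simp [hγ, h'.start]
    · simp [hγ, not_le.2 h1]
  have hu : Icc (0 : ℝ) (s + r) = Icc 0 s ∪ Icc s (s + r) :=
    (Icc_union_Icc_eq_Icc hs (by linarith)).symm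
  have hd2 : ∀ t ∈ Icc s (s + r), HasDerivWithinAt γ (X (γ t)) (Icc s (s + r)) t := by
    intro t ht
    rw [e2 ht]
    refine HasDerivWithinAt.congr ?_ e2 (e2 ht)
    have h3 := h'.deriv (t - s) ⟨by linarith [ht.1], by linarith [ht.2]⟩
    have h4 : HasDerivWithinAt (fun t : ℝ => t - s) 1 (Icc s (s + r)) t :=
      (hasDerivWithinAt_id t _).sub_const s
    have h5 : MapsTo (fun t : ℝ => t - s) (Icc s (s + r)) (Icc 0 r) :=
      fun u hu => ⟨by linarith [hu.1], by linarith [hu.2]⟩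
    simpa [Function.comp_def] using h3.scomp t h4 h5
  have hd1 : ∀ t ∈ Icc 0 s, HasDerivWithinAt γ (X (γ t)) (Icc 0 s) t := by
    intro t ht
    rw [e1 ht]
    exact (h.deriv t ht).congr e1 (e1 ht)
  refine ⟨by rw [e1 ⟨le_rfl, hs⟩, h.start], fun t ht => ?_, fun t ht => ?_⟩
  · rw [hu] at ht
    rcases ht with ht | ht
    · rw [e1 ht]; exact h.mem t ht
    · rw [e2 ht]; exact h'.mem _ ⟨by linarith [ht.1], by linarith [ht.2]⟩
  · rw [hu]
    rcases lt_trichotomy t s with hts | rfl | hts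
    · have := hd1 t ⟨ht.1, hts.le⟩
      refine this.mono_of_mem_nhdsWithin ?_
      rw [← hu]
      refine mem_nhdsWithin.2 ⟨Iio s, isOpen_Iio, hts, fun u hu => ⟨hu.2.1, (show u < s from hu.1).le⟩⟩
    · exact (hd1 t ⟨ht.1, le_rfl⟩).union (hd2 t ⟨le_rfl, by linarith⟩)
    · have := hd2 t ⟨hts.le, ht.2⟩
      refine this.mono_of_mem_nhdsWithin ?_
      rw [← hu]
      refine mem_nhdsWithin.2 ⟨Ioi s, isOpen_Ioi, hts, fun u hu => ⟨(show s < u from hu.1).le, hu.2.2⟩⟩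

theorem eqOn_of_solutions {Y : E → E} {K : ℝ≥0} (hK : LipschitzWith K Y) {s : ℝ} {α β : ℝ → E}
    (hα : ∀ t ∈ Icc 0 s, HasDerivWithinAt α (Y (α t)) (Icc 0 s) t)
    (hβ : ∀ t ∈ Icc 0 s, HasDerivWithinAt β (Y (β t)) (Icc 0 s) t) (h : α 0 = β 0) :
    EqOn α β (Icc 0 s) :=
  ODE_solution_unique (v := fun _ => Y) (fun _ => hK) (fun t ht => (hα t ht).continuousWithinAt)
    (fun t ht => (hα t (Ico_subset_Icc_self ht)).Ici_of_Icc ht)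
    (fun t ht => (hβ t ht).continuousWithinAt)
    (fun t ht => (hβ t (Ico_subset_Icc_self ht)).Ici_of_Icc ht) h

variable [FiniteDimensional ℝ E]

/-- A `C¹` vector field on an open set agrees near a compact set with a compactly supported one. -/
theorem exists_compactly_supported_field {X : E → E} {O K : Set E} (hO : IsOpen O)
    (hX : ContDiffOn ℝ 1 X O) (hK : IsCompact K) (hKO : K ⊆ O) :
    ∃ Y : E → E, ContDiff ℝ 1 Y ∧ HasCompactSupport Y ∧
      ∃ W, IsOpen W ∧ K ⊆ W ∧ W ⊆ O ∧ EqOn Y X W := by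
  obtain ⟨K', hK', hKK', hK'O⟩ := exists_compact_between hK hO hKO
  obtain ⟨χ, h0, h1, -⟩ := exists_contMDiffMap_zero_one_nhds_of_isClosed (n := 1) (modelWithCornersSelf ℝ E)
    (isOpen_interior (s := K')).isClosed_compl hK.isClosed
    (by rw [disjoint_compl_left_iff_subset]; exact hKK')
  have hχ : ContDiff ℝ 1 χ := χ.contMDiff.contDiff
  rw [eventually_nhdsSet_iff_exists] at h0 h1
  obtain ⟨U, hU, hKU, hU0⟩ := h0
  obtain ⟨W, hW, hKW, hW1⟩ := h1
  refine ⟨fun x => χ x • X x, ?_, ?_, W ∩ O, hW.inter hO, subset_inter hKW hKO, inter_subset_right, ?_⟩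
  · rw [contDiff_iff_contDiffAt]
    intro x
    by_cases hx : x ∈ interior K'
    · exact hχ.contDiffAt.smul (hX.contDiffAt (hO.mem_nhds (hK'O (interior_subset hx))))
    · refine (contDiffAt_const (c := (0 : E))).congr_of_eventuallyEq ?_
      filter_upwards [hU.mem_nhds (hKU hx)] with z hz
      simp [hU0 z hz]
  · refine HasCompactSupport.intro hK' fun x hx => ?_
    simp [hU0 x (hKU fun h => hx (interior_subset h))]
  · intro x hx
    simp [hW1 x hx.1]

/-- The field is bounded by some `C` and globally Lipschitz. A ball of radius `C * s` cannot be left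
in time `s`, so a single application of Picard–Lindelöf reaches any prescribed time. -/
theorem exists_solution_of_compactSupport {Y : E → E} (hY : ContDiff ℝ 1 Y)
    (hc : HasCompactSupport Y) (s : ℝ) (hs : 0 ≤ s) (y : E) :
    ∃ α : ℝ → E, α 0 = y ∧ ∀ t ∈ Icc 0 s, HasDerivWithinAt α (Y (α t)) (Icc 0 s) t := by
  obtain ⟨K, hK⟩ := hY.lipschitzWith_of_hasCompactSupport hc one_ne_zero
  obtain ⟨C, hC⟩ := hY.continuous.bounded_above_of_compact_support hc
  have hC0 : 0 ≤ C := (norm_nonneg _).trans (hC 0)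
  have hPL : IsPicardLindelof (fun _ => Y) (⟨0, le_rfl, hs⟩ : Icc 0 s) y
      (⟨C * s, by positivity⟩ : ℝ≥0) 0 ⟨C, hC0⟩ K := by
    refine .of_time_independent (fun x _ => hC x) hK.lipschitzOnWith ?_
    simp [max_eq_left hs]
    rfl
  exact hPL.exists_eq_forall_mem_Icc_hasDerivWithinAt₀

/-- Cutting the field off outside a neighbourhood of the two compact traces makes it globally
Lipschitz without changing either solution. -/
theorem SolvesOn.eqOn {X : E → E} {O : Set E} (hO : IsOpen O) (hX : ContDiffOn ℝ 1 X O) {y : E}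
    {s : ℝ} {α β : ℝ → E} (hα : SolvesOn X O y s α) (hβ : SolvesOn X O y s β) :
    EqOn α β (Icc 0 s) := by
  have hcα := isCompact_Icc.image_of_continuousOn hα.continuousOn
  have hcβ := isCompact_Icc.image_of_continuousOn hβ.continuousOn
  obtain ⟨Y, hY, hc, W, -, hKW, -, hYX⟩ := exists_compactly_supported_field hO hX (hcα.union hcβ)
    (union_subset (image_subset_iff.2 hα.mem) (image_subset_iff.2 hβ.mem))
  obtain ⟨K, hK⟩ := hY.lipschitzWith_of_hasCompactSupport hc one_ne_zero
  refine eqOn_of_solutions hK (fun t ht => ?_) (fun t ht => ?_) (hα.start.trans hβ.start.symm)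
  · rw [hYX (hKW (Or.inl (mem_image_of_mem _ ht)))]; exact hα.deriv t ht
  · rw [hYX (hKW (Or.inr (mem_image_of_mem _ ht)))]; exact hβ.deriv t ht

/-- Solutions starting in a compact set exist for a uniform time. -/
theorem exists_uniform_time {X : E → E} {O K : Set E} (hO : IsOpen O) (hX : ContDiffOn ℝ 1 X O)
    (hK : IsCompact K) (hKO : K ⊆ O) : ∃ ε > 0, ∀ y ∈ K, ∃ α, SolvesOn X O y ε α := by
  obtain ⟨Y, hY, hc, W, hW, hKW, hWO, hYX⟩ := exists_compactly_supported_field hO hX hK hKO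
  obtain ⟨C, hC⟩ := hY.continuous.bounded_above_of_compact_support hc
  have hC0 : 0 ≤ C := (norm_nonneg _).trans (hC 0)
  obtain ⟨r, hr, hrW⟩ := hK.exists_thickening_subset_open hW hKW
  -- In this time a point moves by less than `r`, so it stays in the thickening inside `W`; `C + 1`
  -- covers `C = 0`.
  refine ⟨r / (2 * (C + 1)), by positivity, fun y hy => ?_⟩
  set ε := r / (2 * (C + 1)) with hε
  have hε0 : 0 < ε := by positivity
  obtain ⟨α, h0, hα⟩ := exists_solution_of_compactSupport hY hc ε hε0.le y
  have hmem : ∀ t ∈ Icc 0 ε, α t ∈ W := fun t ht => by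
    apply hrW
    rw [mem_thickening_iff]
    refine ⟨y, hy, ?_⟩
    have := (convex_Icc (0 : ℝ) ε).norm_image_sub_le_of_norm_hasDerivWithin_le hα
      (fun x _ => hC (α x)) ⟨le_rfl, hε0.le⟩ ht
    rw [dist_eq_norm, ← h0]
    refine this.trans_lt ?_
    have h1 : ‖t - 0‖ ≤ ε := by rw [sub_zero, Real.norm_eq_abs, abs_of_nonneg ht.1]; exact ht.2
    calc C * ‖t - 0‖ ≤ C * ε := by gcongr
      _ < r := by rw [hε, mul_div_assoc', div_lt_iff₀ (by positivity)]; nlinarith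
  exact ⟨α, h0, fun t ht => hWO (hmem t ht), fun t ht => by
    rw [← hYX (hmem t ht)]; exact hα t ht⟩

/-- Near a solution on `[0, 1]` there is a flow, and the solutions of the linearized equation give
its strict derivative with respect to the initial value. -/
theorem SolvesOn.exists_flow {F : Type*} [NormedAddCommGroup F] [NormedSpace ℝ F]
    {X : E → E} {O : Set E} (hO : IsOpen O) (hX : ContDiffOn ℝ 1 X O)
    {y : E} {α : ℝ → E} (hα : SolvesOn X O y 1 α) :
    ∃ Φ : E → ℝ → E, (∀ᶠ y' in 𝓝 y, SolvesOn X O y' 1 (Φ y')) ∧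
      ∀ (J : F → ℝ → E) (ι D : F →L[ℝ] E) (C : ℝ), (∀ d, J d 0 = ι d) →
        (∀ d, ∀ t ∈ Icc (0 : ℝ) 1,
          HasDerivWithinAt (J d) (fderiv ℝ X (α t) (J d t)) (Icc 0 1) t) →
        (∀ d, ∀ t ∈ Icc (0 : ℝ) 1, ‖J d t‖ ≤ C * ‖d‖) → (∀ d, D d = J d 1) →
        ∀ x₀, HasStrictFDerivAt (fun x => Φ (y + ι (x - x₀)) 1) D x₀ := by
  have hcα := isCompact_Icc.image_of_continuousOn hα.continuousOn
  obtain ⟨Y, hY, hc, W, hW, hKW, hWO, hYX⟩ := exists_compactly_supported_field hO hX hcα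
    (image_subset_iff.2 hα.mem)
  obtain ⟨K, hK⟩ := hY.lipschitzWith_of_hasCompactSupport hc one_ne_zero
  choose Φ hΦ0 hΦ using exists_solution_of_compactSupport hY hc 1 zero_le_one
  have hdist : ∀ y₁ y₂, ∀ t ∈ Icc (0 : ℝ) 1, dist (Φ y₁ t) (Φ y₂ t) ≤ dist y₁ y₂ * Real.exp K := by
    intro y₁ y₂ t ht
    have h1 := dist_le_of_trajectories_ODE (v := fun _ => Y) (fun _ => hK)
      (fun t ht => (hΦ y₁ t ht).continuousWithinAt)
      (fun t ht => (hΦ y₁ t (Ico_subset_Icc_self ht)).Ici_of_Icc ht)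
      (fun t ht => (hΦ y₂ t ht).continuousWithinAt)
      (fun t ht => (hΦ y₂ t (Ico_subset_Icc_self ht)).Ici_of_Icc ht)
      (δ := dist y₁ y₂) (by rw [hΦ0, hΦ0]) t ht
    refine h1.trans ?_
    gcongr
    nlinarith [ht.2, K.2]
  have hαΦ : EqOn (Φ y) α (Icc 0 1) := by
    refine eqOn_of_solutions hK (hΦ y) (fun t ht => ?_) ((hΦ0 y).trans hα.start.symm)
    rw [hYX (hKW (mem_image_of_mem _ ht))]; exact hα.deriv t ht
  obtain ⟨r, hr, hrW⟩ := hcα.exists_thickening_subset_open hW hKW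
  refine ⟨Φ, ?_, ?_⟩
  · have : ∀ᶠ y' in 𝓝 y, dist y' y * Real.exp K < r := by
      have h : Tendsto (fun y' => dist y' y * Real.exp K) (𝓝 y) (𝓝 (dist y y * Real.exp K)) :=
        (continuous_id.dist continuous_const).mul continuous_const |>.tendsto y
      rw [dist_self, zero_mul] at h
      exact h.eventually_lt_const hr
    filter_upwards [this] with y' hy'
    have hmem : ∀ t ∈ Icc (0 : ℝ) 1, Φ y' t ∈ W := fun t ht => by
      apply hrW
      rw [mem_thickening_iff]
      refine ⟨α t, mem_image_of_mem _ ht, ?_⟩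
      rw [← hαΦ ht]
      exact (hdist y' y t ht).trans_lt hy'
    exact ⟨hΦ0 y', fun t ht => hWO (hmem t ht), fun t ht => by
      rw [← hYX (hmem t ht)]; exact hΦ y' t ht⟩
  · intro J ι D C hJ0 hJ hJC hD x₀
    have hC : ∀ d, ‖J d 1‖ ≤ C * ‖d‖ := fun d => hJC d 1 ⟨zero_le_one, le_rfl⟩
    set C' := |C| + 1 with hC'
    have hC'0 : 0 < C' := by positivity
    have hJC' : ∀ d, ∀ t ∈ Icc (0 : ℝ) 1, ‖J d t‖ ≤ C' * ‖d‖ := fun d t ht =>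
      (hJC d t ht).trans (by gcongr; rw [hC']; linarith [le_abs_self C])
    have hfd : ∀ t ∈ Icc (0 : ℝ) 1, fderiv ℝ X (α t) = fderiv ℝ Y (α t) := fun t ht =>
      (Filter.EventuallyEq.fderiv_eq (by
        filter_upwards [hW.mem_nhds (hKW (mem_image_of_mem _ ht))] with z hz using hYX hz)).symm
    have huc : UniformContinuous (fderiv ℝ Y) :=
      (hc.fderiv ℝ).uniformContinuous_of_continuous (hY.continuous_fderiv one_ne_zero)
    -- A strictly positive Lipschitz constant selects the exponential form of the Gronwall bound.
    set K' : ℝ≥0 := K + 1 with hK'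
    have hKK' : LipschitzWith K' Y := hK.weaken (by simp [hK'])
    have hK'0 : (K' : ℝ) ≠ 0 := by positivity
    refine HasStrictFDerivAt.of_isLittleO ?_
    rw [Asymptotics.isLittleO_iff]
    intro c hc0
    -- Gronwall turns a defect `c / G * (C' * ‖d‖)` of the approximate trajectory `Φ y₂ + J d` into
    -- a final error of exactly `c * ‖d‖`.
    set G := C' * ((Real.exp K' - 1) / K') with hG
    have hG0 : 0 < G := by
      have : (1 : ℝ) < Real.exp K' := Real.one_lt_exp_iff.2 (by positivity)
      have : 0 < Real.exp K' - 1 := by linarith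
      positivity
    obtain ⟨η, hη, hηY⟩ := Metric.uniformContinuous_iff.1 huc (c / G) (by positivity)
    have ev : ∀ᶠ x in 𝓝 x₀, ‖ι (x - x₀)‖ * Real.exp K < η / 2 ∧ C' * ‖x - x₀‖ < η / 4 := by
      have h1 : Tendsto (fun x => ‖ι (x - x₀)‖ * Real.exp K) (𝓝 x₀) (𝓝 (‖ι (x₀ - x₀)‖ * Real.exp K)) :=
        Continuous.tendsto (by fun_prop) x₀
      have h2 : Tendsto (fun x => C' * ‖x - x₀‖) (𝓝 x₀) (𝓝 (C' * ‖x₀ - x₀‖)) :=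
        Continuous.tendsto (by fun_prop) x₀
      simp only [sub_self, map_zero, norm_zero, zero_mul, mul_zero] at h1 h2
      exact (h1.eventually_lt_const (by positivity)).and (h2.eventually_lt_const (by positivity))
    rw [nhds_prod_eq]
    filter_upwards [ev.prod_mk ev] with p hp
    obtain ⟨⟨h1, h1'⟩, ⟨h2, h2'⟩⟩ := hp
    set d := p.1 - p.2 with hd
    set y₁ := y + ι (p.1 - x₀) with hy₁
    set y₂ := y + ι (p.2 - x₀) with hy₂
    have hy12 : y₁ = y₂ + ι d := by rw [hy₁, hy₂, hd]; simp only [map_sub]; abel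
    have hdn : C' * ‖d‖ < η / 2 := by
      have : ‖d‖ ≤ ‖p.1 - x₀‖ + ‖p.2 - x₀‖ := by
        rw [hd, show p.1 - p.2 = (p.1 - x₀) - (p.2 - x₀) by abel]; exact norm_sub_le _ _
      nlinarith
    have near : ∀ t ∈ Icc (0 : ℝ) 1, dist (Φ y₂ t) (α t) < η / 2 := fun t ht => by
      rw [← hαΦ ht]
      refine (hdist y₂ y t ht).trans_lt ?_
      rw [hy₂, dist_eq_norm, add_sub_cancel_left]; exact h2
    have hβ : ∀ t ∈ Icc (0 : ℝ) 1, HasDerivWithinAt (fun t => Φ y₂ t + J d t)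
        (Y (Φ y₂ t) + fderiv ℝ Y (α t) (J d t)) (Icc 0 1) t := fun t ht => by
      rw [← hfd t ht]; exact (hΦ y₂ t ht).add (hJ d t ht)
    -- Both `Φ y₂ t` and `Φ y₂ t + J d t` lie in a ball about `α t` on which the derivative of `Y`
    -- varies by at most `c / G`, so the mean value inequality bounds the linearization error.
    have err : ∀ t ∈ Ico (0 : ℝ) 1, dist (Y (Φ y₂ t) + fderiv ℝ Y (α t) (J d t))
        (Y (Φ y₂ t + J d t)) ≤ c / G * (C' * ‖d‖) := fun t ht' => by
      have ht := Ico_subset_Icc_self ht'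
      have hJd := hJC' d t ht
      have m1 : Φ y₂ t ∈ ball (α t) η := by
        rw [mem_ball]; linarith [near t ht]
      have m2 : Φ y₂ t + J d t ∈ ball (α t) η := by
        rw [mem_ball, dist_eq_norm]
        have := near t ht
        rw [dist_eq_norm] at this
        calc ‖Φ y₂ t + J d t - α t‖ = ‖(Φ y₂ t - α t) + J d t‖ := by congr 1; abel
          _ ≤ ‖Φ y₂ t - α t‖ + ‖J d t‖ := norm_add_le _ _
          _ < η := by linarith
      have := (convex_ball (α t) η).norm_image_sub_le_of_norm_fderiv_le' (𝕜 := ℝ) (f := Y)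
        (φ := fderiv ℝ Y (α t)) (C := c / G)
        (fun x _ => hY.differentiable one_ne_zero x)
        (fun x hx => by rw [← dist_eq_norm]; exact (hηY hx).le) m1 m2
      rw [add_sub_cancel_left] at this
      rw [dist_eq_norm, ← norm_neg]
      calc _ = ‖Y (Φ y₂ t + J d t) - Y (Φ y₂ t) - fderiv ℝ Y (α t) (J d t)‖ := by
            congr 1; abel
        _ ≤ _ := this.trans (by gcongr)
    have key := dist_le_of_approx_trajectories_ODE (v := fun _ => Y) (fun _ => hKK')
      (fun t ht => (hΦ y₁ t ht).continuousWithinAt)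
      (fun t ht => (hΦ y₁ t (Ico_subset_Icc_self ht)).Ici_of_Icc ht)
      (εf := 0) (fun t ht => by simp)
      (fun t ht => (hβ t ht).continuousWithinAt)
      (fun t ht => (hβ t (Ico_subset_Icc_self ht)).Ici_of_Icc ht)
      err (δ := 0) (by simp [hΦ0, hJ0, hy12]) 1 ⟨zero_le_one, le_rfl⟩
    rw [gronwallBound_of_K_ne_0 hK'0] at key
    have e1 : Φ (y + ι (p.1 - x₀)) 1 - Φ (y + ι (p.2 - x₀)) 1 - D (p.1 - p.2)
        = Φ y₁ 1 - (Φ y₂ 1 + J d 1) := by rw [hD]; abel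
    rw [e1, ← dist_eq_norm]
    refine key.trans (le_of_eq ?_)
    simp only [sub_zero, zero_mul, zero_add, mul_one]
    rw [hG]
    have : Real.exp K' - 1 ≠ 0 := by
      intro h
      rw [hG, h] at hG0
      simp at hG0
    field_simp

end ODE

/-! ### Wirtinger calculus -/

theorem fderiv_eq_dz_dzbar (F : ℂ → ℂ) (z w : ℂ) :
    fderiv ℝ F z w = dz F z * w + dzbar F z * conj w := by
  have h : w = w.re • (1 : ℂ) + w.im • I := by simp
  have h1 : fderiv ℝ F z w = w.re * fderiv ℝ F z 1 + w.im * fderiv ℝ F z I := by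
    conv_lhs => rw [h]
    rw [map_add, map_smul, map_smul]; simp
  have h2 : conj w = w.re - w.im * I := by
    apply Complex.ext <;> simp
  have h3 : w = w.re + w.im * I := (re_add_im w).symm
  rw [h1, h2, dz, dzbar]
  conv_rhs => rw [h3]
  simp only [add_re, ofReal_re, mul_re, I_re, mul_zero, ofReal_im, I_im, add_im, mul_im, mul_one,
    add_zero, zero_add, sub_self]
  linear_combination (w.im * fderiv ℝ F z I) * I_sq

theorem HasDerivWithinAt.comp_dz {F : ℂ → ℂ} {γ : ℝ → ℂ} {v : ℂ} {s : Set ℝ} {t : ℝ}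
    (hF : DifferentiableAt ℝ F (γ t)) (hγ : HasDerivWithinAt γ v s t) :
    HasDerivWithinAt (fun t => F (γ t)) (dz F (γ t) * v + dzbar F (γ t) * conj v) s t := by
  rw [← fderiv_eq_dz_dzbar]
  exact hF.hasFDerivAt.comp_hasDerivWithinAt t hγ

/-- The Wirtinger derivative of a real-valued function. -/
noncomputable def gradZ (ρ : ℂ → ℝ) : ℂ → ℂ := dz fun w => (ρ w : ℂ)

theorem fderiv_ofReal_apply {ρ : ℂ → ℝ} {z : ℂ} (h : DifferentiableAt ℝ ρ z) (w : ℂ) :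
    fderiv ℝ (fun w => (ρ w : ℂ)) z w = (fderiv ℝ ρ z w : ℝ) := by
  have := (ofRealCLM.hasFDerivAt.comp z h.hasFDerivAt).fderiv
  have e : (fun w => (ρ w : ℂ)) = ofRealCLM ∘ ρ := rfl
  rw [e, this]; rfl

theorem gradZ_eq {ρ : ℂ → ℝ} {z : ℂ} (h : DifferentiableAt ℝ ρ z) :
    gradZ ρ z = ((fderiv ℝ ρ z 1 : ℝ) - I * (fderiv ℝ ρ z I : ℝ)) / 2 := by
  rw [gradZ, dz, fderiv_ofReal_apply h, fderiv_ofReal_apply h]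

theorem fderiv_real_eq {ρ : ℂ → ℝ} {z : ℂ} (h : DifferentiableAt ℝ ρ z) (w : ℂ) :
    fderiv ℝ ρ z w = 2 * (gradZ ρ z * w).re := by
  have h0 : w = w.re • (1 : ℂ) + w.im • I := by simp
  have h1 : fderiv ℝ ρ z w = w.re * fderiv ℝ ρ z 1 + w.im * fderiv ℝ ρ z I := by
    conv_lhs => rw [h0]
    rw [map_add, map_smul, map_smul]; simp
  rw [h1, gradZ_eq h]
  simp
  ring

theorem HasDerivWithinAt.comp_gradZ {ρ : ℂ → ℝ} {γ : ℝ → ℂ} {v : ℂ} {s : Set ℝ} {t : ℝ}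
    (hρ : DifferentiableAt ℝ ρ (γ t)) (hγ : HasDerivWithinAt γ v s t) :
    HasDerivWithinAt (fun t => ρ (γ t)) (2 * (gradZ ρ (γ t) * v).re) s t := by
  rw [← fderiv_real_eq hρ]
  exact hρ.hasFDerivAt.comp_hasDerivWithinAt t hγ

theorem ContDiffAt.eventually_differentiableAt {ρ : ℂ → ℝ} {z : ℂ} (h : ContDiffAt ℝ 2 ρ z) :
    ∀ᶠ w in 𝓝 z, DifferentiableAt ℝ ρ w := by
  filter_upwards [h.eventually (by simp)] with w hw using hw.differentiableAt (by norm_num)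

theorem ContDiffAt.gradZ_eventuallyEq {ρ : ℂ → ℝ} {z : ℂ} (h : ContDiffAt ℝ 2 ρ z) :
    gradZ ρ =ᶠ[𝓝 z] fun z => ((fderiv ℝ ρ z 1 : ℝ) - I * (fderiv ℝ ρ z I : ℝ)) / 2 := by
  filter_upwards [h.eventually_differentiableAt] with w hw using gradZ_eq hw

theorem hasFDerivAt_gradZ {ρ : ℂ → ℝ} {z : ℂ} (h : ContDiffAt ℝ 2 ρ z) :
    HasFDerivAt (gradZ ρ)
      ((2⁻¹ : ℂ) • (ofRealCLM.comp ((ContinuousLinearMap.apply ℝ ℝ 1).comp (fderiv ℝ (fderiv ℝ ρ) z))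
        - I • ofRealCLM.comp ((ContinuousLinearMap.apply ℝ ℝ I).comp (fderiv ℝ (fderiv ℝ ρ) z)))) z := by
  have h1 : DifferentiableAt ℝ (fderiv ℝ ρ) z :=
    (h.fderiv_right (m := 1) (by norm_num)).differentiableAt one_ne_zero
  have h2 : ∀ w : ℂ, HasFDerivAt (fun z => ((fderiv ℝ ρ z w : ℝ) : ℂ))
      (ofRealCLM.comp ((ContinuousLinearMap.apply ℝ ℝ w).comp (fderiv ℝ (fderiv ℝ ρ) z))) z :=
    fun w => ofRealCLM.hasFDerivAt.comp z
      ((ContinuousLinearMap.apply ℝ ℝ w).hasFDerivAt.comp z h1.hasFDerivAt)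
  refine HasFDerivAt.congr_of_eventuallyEq ?_ h.gradZ_eventuallyEq
  have := ((h2 1).sub ((h2 I).const_smul I)).const_smul (2⁻¹ : ℂ)
  refine this.congr_of_eventuallyEq (Eventually.of_forall fun w => ?_)
  simp only [Pi.smul_apply, Pi.sub_apply, smul_eq_mul]
  ring

theorem laplacian_eq {ρ : ℂ → ℝ} {z : ℂ} :
    Laplacian.laplacian ρ z = fderiv ℝ (fderiv ℝ ρ) z 1 1 + fderiv ℝ (fderiv ℝ ρ) z I I := by
  rw [InnerProductSpace.laplacian_eq_iteratedFDeriv_complexPlane]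
  simp [iteratedFDeriv_two_apply]

theorem dzbar_gradZ {ρ : ℂ → ℝ} {z : ℂ} (h : ContDiffAt ℝ 2 ρ z) :
    dzbar (gradZ ρ) z = ((Laplacian.laplacian ρ z / 4 : ℝ) : ℂ) := by
  have hs : fderiv ℝ (fderiv ℝ ρ) z 1 I = fderiv ℝ (fderiv ℝ ρ) z I 1 :=
    (h.isSymmSndFDerivAt (by simp)).eq 1 I
  rw [dzbar, (hasFDerivAt_gradZ h).fderiv, laplacian_eq]
  simp [hs]
  ring_nf
  simp
  ring

theorem dzdzbar_eq {ρ : ℂ → ℝ} {z : ℂ} (h : ContDiffAt ℝ 2 ρ z) :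
    dzdzbar ρ z = Laplacian.laplacian ρ z / 4 := by
  have := dzbar_gradZ h
  rw [dzdzbar]
  change (dzbar (gradZ ρ) z).re = _
  rw [this, ofReal_re]

theorem dzbar_gradZ_eq {ρ : ℂ → ℝ} {z : ℂ} (h : ContDiffAt ℝ 2 ρ z) :
    dzbar (gradZ ρ) z = (dzdzbar ρ z : ℂ) := by
  rw [dzbar_gradZ h, dzdzbar_eq h]

theorem gaussCurvature_eq {ρ : ℂ → ℝ} {z : ℂ} (h : ContDiffAt ℝ 2 ρ z) :
    Real.exp (2 * ρ z) * gaussCurvature ρ z = -(4 * dzdzbar ρ z) := by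
  rw [gaussCurvature, dzdzbar_eq h]
  have : Real.exp (2 * ρ z) * Real.exp (-2 * ρ z) = 1 := by
    rw [← Real.exp_add]; simp
  linear_combination -Laplacian.laplacian ρ z * this

theorem contDiffOn_gradZ {ρ : ℂ → ℝ} {s : Set ℂ} (hs : IsOpen s) (h : ContDiffOn ℝ ∞ ρ s) :
    ContDiffOn ℝ ∞ (gradZ ρ) s := by
  have h1 : ContDiffOn ℝ ∞ (fderiv ℝ ρ) s := h.fderiv_of_isOpen hs (by simp)
  have h2 : ∀ w : ℂ, ContDiffOn ℝ ∞ (fun z => ((fderiv ℝ ρ z w : ℝ) : ℂ)) s := fun w =>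
    ofRealCLM.contDiff.comp_contDiffOn (h1.clm_apply contDiffOn_const)
  refine (((h2 1).sub ((contDiffOn_const (c := I)).mul (h2 I))).div_const 2).congr fun z hz => ?_
  exact gradZ_eq ((h.contDiffAt (hs.mem_nhds hz)).differentiableAt (by simp))

/-! ### The geodesic flow of a conformal metric -/

/-- The vector field on phase space whose integral curves are the (affinely parametrized)
geodesics of `e^{2ρ} |dz|²`. -/
noncomputable def geodesicField (ρ : ℂ → ℝ) (p : ℂ × ℂ) : ℂ × ℂ := (p.2, -2 * gradZ ρ p.1 * p.2 ^ 2)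

/-- Phase space over the unit disk. -/
def phaseSpace : Set (ℂ × ℂ) := ball (0 : ℂ) 1 ×ˢ univ

theorem isOpen_phaseSpace : IsOpen phaseSpace := isOpen_ball.prod isOpen_univ

theorem contDiffOn_geodesicField {ρ : ℂ → ℝ} (hρ : ContDiffOn ℝ ∞ ρ (ball 0 1)) :
    ContDiffOn ℝ 1 (geodesicField ρ) phaseSpace := by
  have h1 : ContDiffOn ℝ 1 (fun p : ℂ × ℂ => gradZ ρ p.1) phaseSpace :=
    ((contDiffOn_gradZ isOpen_ball hρ).of_le (by simp)).comp contDiffOn_fst fun p hp => hp.1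
  exact contDiffOn_snd.prodMk ((contDiffOn_const.mul h1).mul (contDiffOn_snd.pow 2))

theorem contDiffAt_two {ρ : ℂ → ℝ} (hρ : ContDiffOn ℝ ∞ ρ (ball 0 1)) {z : ℂ}
    (hz : z ∈ ball (0 : ℂ) 1) : ContDiffAt ℝ 2 ρ z :=
  (hρ.contDiffAt (isOpen_ball.mem_nhds hz)).of_le (by norm_cast)

/-- The linearized flow governs Jacobi fields. The curvature enters through the `conj` term, the
`z̄`-derivative of `ρ_z`. -/
theorem fderiv_geodesicField {ρ : ℂ → ℝ} {p : ℂ × ℂ}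
    (hp : ContDiffAt ℝ 2 ρ p.1) (q : ℂ × ℂ) :
    fderiv ℝ (geodesicField ρ) p q = (q.2, -2 * (dz (gradZ ρ) p.1 * q.1
      + dzdzbar ρ p.1 * conj q.1) * p.2 ^ 2 - 4 * gradZ ρ p.1 * p.2 * q.2) := by
  have h1 : HasFDerivAt (gradZ ρ) (fderiv ℝ (gradZ ρ) p.1) p.1 :=
    (hasFDerivAt_gradZ hp).differentiableAt.hasFDerivAt
  have h2 : HasFDerivAt (fun p : ℂ × ℂ => gradZ ρ p.1)
      ((fderiv ℝ (gradZ ρ) p.1).comp (ContinuousLinearMap.fst ℝ ℂ ℂ)) p :=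
    HasFDerivAt.comp p h1 hasFDerivAt_fst
  have h3 : HasFDerivAt (fun p : ℂ × ℂ => p.2) (ContinuousLinearMap.snd ℝ ℂ ℂ) p := hasFDerivAt_snd
  have h4 := h3.prodMk ((h2.const_mul (-2)).mul (h3.pow 2))
  have h5 : HasFDerivAt (geodesicField ρ) _ p := h4
  rw [h5.fderiv]
  ext1
  · simp
  · simp [fderiv_eq_dz_dzbar, dzbar_gradZ_eq hp]
    ring

/-! ### Comparison for the scalar Jacobi equation -/

theorem MonotoneOn.of_hasDerivWithinAt_Icc {f f' : ℝ → ℝ} {a b : ℝ}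
    (hf : ∀ t ∈ Icc a b, HasDerivWithinAt f (f' t) (Icc a b) t) (h0 : ∀ t ∈ Icc a b, 0 ≤ f' t) :
    MonotoneOn f (Icc a b) := by
  refine monotoneOn_of_hasDerivWithinAt_nonneg (convex_Icc a b)
    (fun t ht => (hf t ht).continuousWithinAt)
    (fun t ht => (hf t (interior_subset ht)).mono interior_subset)
    (fun t ht => h0 t (interior_subset ht))

/-- The solution of `b'' = q b`, `b(0) = 0`, `b'(0) = 1` with `q ≥ 0`. -/
theorem exists_jacobi_solution {q : ℝ → ℝ} (hq : ContinuousOn q (Icc 0 1))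
    (hq0 : ∀ t ∈ Icc (0 : ℝ) 1, 0 ≤ q t) :
    ∃ b b' : ℝ → ℝ, b 0 = 0 ∧ b' 0 = 1 ∧ 1 ≤ b 1 ∧
      (∀ t ∈ Icc (0 : ℝ) 1, HasDerivWithinAt b (b' t) (Icc 0 1) t) ∧
      ∀ t ∈ Icc (0 : ℝ) 1, HasDerivWithinAt b' (q t * b t) (Icc 0 1) t := by
  obtain ⟨Q, hQ⟩ := isCompact_Icc.exists_bound_of_continuousOn hq
  set K : ℝ := max 1 Q with hK
  have hK1 : 1 ≤ K := le_max_left _ _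
  have hQK : ∀ t ∈ Icc (0 : ℝ) 1, |q t| ≤ K := fun t ht => (hQ t ht).trans (le_max_right _ _)
  set R := Real.exp K with hR
  have hR0 : 0 < R := Real.exp_pos _
  -- The linear system is unbounded, so it is solved with its unknowns clamped to `[-R, R]`, which
  -- gives a bounded Lipschitz field. Gronwall bounds the solution by `R = exp K` on `[0, 1]`, so
  -- the clamp is never active.
  set cl : ℝ → ℝ := fun x => max (-R) (min x R) with hcl
  have cl_lip : ∀ x y, |cl x - cl y| ≤ |x - y| := fun x y => by
    have h1 := abs_max_sub_max_le_abs (min x R) (min y R) (-R)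
    have h2 := abs_min_sub_min_le_max x R y R
    simp only [sub_self, abs_zero] at h2
    rw [max_comm (min x R), max_comm (min y R)] at h1
    exact h1.trans (h2.trans (by simp))
  have cl_id : ∀ x, |x| ≤ R → cl x = x := fun x hx => by
    rw [abs_le] at hx
    simp only [hcl]; rw [min_eq_left hx.2, max_eq_right hx.1]
  have cl_le : ∀ x, |cl x| ≤ |x| := fun x => by
    have := cl_lip x 0
    rwa [cl_id 0 (by simp [hR0.le]), sub_zero, sub_zero] at this
  have cl_R : ∀ x, |cl x| ≤ R := fun x => abs_le.2
    ⟨le_max_left _ _, max_le (by linarith) (min_le_right _ _)⟩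
  set f : ℝ → ℝ × ℝ → ℝ × ℝ := fun t y => (cl y.2, q t * cl y.1) with hf
  have hPL : IsPicardLindelof f (⟨0, le_rfl, zero_le_one⟩ : Icc (0 : ℝ) 1) ((0 : ℝ), (1 : ℝ))
      (⟨K * R, by positivity⟩ : ℝ≥0) 0 ⟨K * R, by positivity⟩ ⟨K, by linarith⟩ := by
    refine ⟨fun t ht => LipschitzOnWith.of_dist_le_mul fun y _ y' _ => ?_, fun y _ => ?_,
      fun t ht y _ => ?_, by simp⟩
    · rw [Prod.dist_eq]
      have h1 : dist y.2 y'.2 ≤ dist y y' := le_max_right _ _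
      have h2 : dist y.1 y'.1 ≤ dist y y' := le_max_left _ _
      refine max_le ?_ ?_
      · simp only [hf, Real.dist_eq] at *
        calc _ ≤ _ := cl_lip _ _
          _ ≤ 1 * dist y y' := by rw [one_mul]; exact h1
          _ ≤ _ := mul_le_mul_of_nonneg_right hK1 dist_nonneg
      · simp only [hf, Real.dist_eq] at *
        rw [← mul_sub, abs_mul]
        exact mul_le_mul (hQK t ht) ((cl_lip _ _).trans h2) (abs_nonneg _) (by linarith)
    · exact continuousOn_const.prodMk (hq.mul continuousOn_const)
    · rw [Prod.norm_def]
      refine max_le ?_ ?_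
      · change |cl y.2| ≤ K * R
        nlinarith [cl_R y.2]
      · change |q t * cl y.1| ≤ K * R
        rw [abs_mul]
        exact mul_le_mul (hQK t ht) (cl_R _) (abs_nonneg _) (by linarith)
  obtain ⟨y, hy0, hy⟩ := hPL.exists_eq_forall_mem_Icc_hasDerivWithinAt₀
  simp only at hy0
  have bd : ∀ t ∈ Icc (0 : ℝ) 1, ‖y t‖ ≤ R := by
    intro t ht
    have := norm_le_gronwallBound_of_norm_deriv_right_le (f := y) (f' := fun t => f t (y t))
      (δ := 1) (K := K) (ε := 0) (fun t ht => (hy t ht).continuousWithinAt)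
      (fun t ht => (hy t (Ico_subset_Icc_self ht)).Ici_of_Icc ht) (by rw [hy0]; simp [Prod.norm_def])
      (fun t ht => by
        rw [add_zero, Prod.norm_def]
        have h1 : |(y t).2| ≤ ‖y t‖ := norm_snd_le (y t)
        have h2 : |(y t).1| ≤ ‖y t‖ := norm_fst_le (y t)
        refine max_le ?_ ?_
        · change |cl (y t).2| ≤ _
          nlinarith [cl_le (y t).2, norm_nonneg (y t)]
        · change |q t * cl (y t).1| ≤ _
          rw [abs_mul]
          exact mul_le_mul (hQK t (Ico_subset_Icc_self ht)) ((cl_le _).trans h2) (abs_nonneg _)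
            (by linarith)) t ht
    rw [gronwallBound_ε0] at this
    refine this.trans ?_
    rw [one_mul, hR]
    exact Real.exp_le_exp.2 (by nlinarith [ht.2])
  have d1 : ∀ t ∈ Icc (0 : ℝ) 1, HasDerivWithinAt (fun t => (y t).1) ((y t).2) (Icc 0 1) t := by
    intro t ht
    have := (hasFDerivAt_fst (𝕜 := ℝ) (p := y t)).comp_hasDerivWithinAt t (hy t ht)
    simpa [hf, cl_id _ ((norm_snd_le (y t)).trans (bd t ht)), Function.comp_def] using this
  have d2 : ∀ t ∈ Icc (0 : ℝ) 1, HasDerivWithinAt (fun t => (y t).2) (q t * (y t).1) (Icc 0 1) t := by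
    intro t ht
    have := (hasFDerivAt_snd (𝕜 := ℝ) (p := y t)).comp_hasDerivWithinAt t (hy t ht)
    simpa [hf, cl_id _ ((norm_fst_le (y t)).trans (bd t ht)), Function.comp_def] using this
  have i0 : (0 : ℝ) ∈ Icc (0 : ℝ) 1 := ⟨le_rfl, zero_le_one⟩
  have i1 : (1 : ℝ) ∈ Icc (0 : ℝ) 1 := ⟨zero_le_one, le_rfl⟩
  -- `(b b')' = b'² + q b² ≥ 0` gives `b b' ≥ 0`; then `(b'²)' = 2 q b b' ≥ 0` gives `b'² ≥ 1`.
  have m1 := MonotoneOn.of_hasDerivWithinAt_Icc (fun t ht => (d1 t ht).mul (d2 t ht))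
    (fun t ht => by
      have h1 := mul_nonneg (hq0 t ht) (mul_self_nonneg (y t).1)
      have h2 := mul_self_nonneg (y t).2
      linarith)
  have p1 : ∀ t ∈ Icc (0 : ℝ) 1, 0 ≤ (y t).1 * (y t).2 := fun t ht => by
    have := m1 i0 ht ht.1
    simpa [hy0] using this
  have m2 := MonotoneOn.of_hasDerivWithinAt_Icc (fun t ht => (d2 t ht).mul (d2 t ht))
    (fun t ht => by nlinarith [mul_nonneg (hq0 t ht) (p1 t ht)])
  have p2 : ∀ t ∈ Icc (0 : ℝ) 1, 1 ≤ (y t).2 * (y t).2 := fun t ht => by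
    have := m2 i0 ht ht.1
    simpa [hy0] using this
  -- Since `b'² ≥ 1`, the function `b'` cannot cross zero and keeps the sign of `b'(0) = 1`.
  have p3 : ∀ t ∈ Icc (0 : ℝ) 1, 1 ≤ (y t).2 := fun t ht => by
    by_contra! hlt
    have hneg : (y t).2 ≤ 0 := by nlinarith [p2 t ht]
    have hc : ContinuousOn (fun t => (y t).2) (Icc 0 t) := fun s hs =>
      (d2 s ⟨hs.1, hs.2.trans ht.2⟩).continuousWithinAt.mono (Icc_subset_Icc_right ht.2)
    obtain ⟨s, hs, hs0⟩ := intermediate_value_Icc' ht.1 hc (show (0 : ℝ) ∈ Icc _ _ from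
      ⟨hneg, by simp [hy0]⟩)
    have := p2 s ⟨hs.1, hs.2.trans ht.2⟩
    simp only at hs0
    rw [hs0] at this
    norm_num at this
  have m3 := MonotoneOn.of_hasDerivWithinAt_Icc
    (fun t ht => (d1 t ht).sub (hasDerivWithinAt_id t _)) (fun t ht => by linarith [p3 t ht])
  have p4 := m3 i0 i1 zero_le_one
  refine ⟨fun t => (y t).1, fun t => (y t).2, by simp [hy0], by simp [hy0], ?_, d1, d2⟩
  simp [hy0] at p4
  exact p4

/-! ### The exponential map -/

/-- The domain of the exponential map at `z₀`, normalized so that Euclidean lengths in it are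
`e^{2ρ} |dz|²`-lengths of geodesics. -/
def expDomain (ρ : ℂ → ℝ) (z₀ : ℂ) : Set ℂ :=
  {x | ∃ α, SolvesOn (geodesicField ρ) phaseSpace (z₀, Real.exp (-ρ z₀) * x) 1 α}

open Classical in
/-- The geodesic, with its velocity, defining the exponential map. -/
noncomputable def expCurve (ρ : ℂ → ℝ) (z₀ x : ℂ) : ℝ → ℂ × ℂ :=
  if h : x ∈ expDomain ρ z₀ then h.choose else fun _ => (z₀, 0)

/-- The exponential map at `z₀`. -/
noncomputable def expMap (ρ : ℂ → ℝ) (z₀ x : ℂ) : ℂ := (expCurve ρ z₀ x 1).1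

theorem solvesOn_expCurve {ρ : ℂ → ℝ} {z₀ x : ℂ} (hx : x ∈ expDomain ρ z₀) :
    SolvesOn (geodesicField ρ) phaseSpace (z₀, Real.exp (-ρ z₀) * x) 1 (expCurve ρ z₀ x) := by
  rw [expCurve, dif_pos hx]; exact hx.choose_spec

theorem expMap_mem {ρ : ℂ → ℝ} {z₀ x : ℂ} (hx : x ∈ expDomain ρ z₀) :
    expMap ρ z₀ x ∈ ball (0 : ℂ) 1 :=
  ((solvesOn_expCurve hx).mem 1 ⟨zero_le_one, le_rfl⟩).1

theorem SolvesOn.hasDerivWithinAt_fst {ρ : ℂ → ℝ} {y : ℂ × ℂ} {s t : ℝ} {α : ℝ → ℂ × ℂ}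
    (h : SolvesOn (geodesicField ρ) phaseSpace y s α) (ht : t ∈ Icc 0 s) :
    HasDerivWithinAt (fun t => (α t).1) (α t).2 (Icc 0 s) t :=
  (hasFDerivAt_fst (𝕜 := ℝ) (p := α t)).comp_hasDerivWithinAt t (h.deriv t ht)

theorem SolvesOn.hasDerivWithinAt_snd {ρ : ℂ → ℝ} {y : ℂ × ℂ} {s t : ℝ} {α : ℝ → ℂ × ℂ}
    (h : SolvesOn (geodesicField ρ) phaseSpace y s α) (ht : t ∈ Icc 0 s) :
    HasDerivWithinAt (fun t => (α t).2) (-2 * gradZ ρ (α t).1 * (α t).2 ^ 2) (Icc 0 s) t :=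
  (hasFDerivAt_snd (𝕜 := ℝ) (p := α t)).comp_hasDerivWithinAt t (h.deriv t ht)

theorem solvesOn_of_components {ρ : ℂ → ℝ} {y : ℂ × ℂ} {s : ℝ} {γ v : ℝ → ℂ}
    (h0 : γ 0 = y.1) (h0' : v 0 = y.2) (hm : ∀ t ∈ Icc 0 s, γ t ∈ ball (0 : ℂ) 1)
    (hγ : ∀ t ∈ Icc 0 s, HasDerivWithinAt γ (v t) (Icc 0 s) t)
    (hv : ∀ t ∈ Icc 0 s, HasDerivWithinAt v (-2 * gradZ ρ (γ t) * v t ^ 2) (Icc 0 s) t) :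
    SolvesOn (geodesicField ρ) phaseSpace y s fun t => (γ t, v t) :=
  ⟨Prod.ext h0 h0', fun t ht => ⟨hm t ht, mem_univ _⟩, fun t ht => (hγ t ht).prodMk (hv t ht)⟩

/-- In the derivative of `e^{2ρ} |v|²`, the term `4 Re(ρ_z v) |v|²` from the factor cancels `2 Re(v̄
· (-2 ρ_z v²))` from the velocity. -/
theorem SolvesOn.speed {ρ : ℂ → ℝ} (hρ : ContDiffOn ℝ ∞ ρ (ball 0 1)) {y : ℂ × ℂ} {s : ℝ}
    {α : ℝ → ℂ × ℂ} (h : SolvesOn (geodesicField ρ) phaseSpace y s α) :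
    ∀ t ∈ Icc 0 s, Real.exp (ρ (α t).1) * ‖(α t).2‖ = Real.exp (ρ y.1) * ‖y.2‖ := by
  have key : ∀ t ∈ Icc 0 s, HasDerivWithinAt
      (fun t => Real.exp (ρ (α t).1) ^ 2 * normSq (α t).2) 0 (Icc 0 s) t := fun t ht => by
    have h1 := (h.hasDerivWithinAt_fst ht).comp_gradZ
      ((contDiffAt_two hρ (h.mem t ht).1).differentiableAt (by norm_num))
    have h2 := h.hasDerivWithinAt_snd ht
    have h3 : HasDerivWithinAt (fun t => normSq (α t).2)
        (2 * (conj (α t).2 * (-2 * gradZ ρ (α t).1 * (α t).2 ^ 2)).re) (Icc 0 s) t := by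
      have a1 := (reCLM.hasFDerivAt (x := (α t).2)).comp_hasDerivWithinAt t h2
      have a2 := (imCLM.hasFDerivAt (x := (α t).2)).comp_hasDerivWithinAt t h2
      refine ((a1.mul a1).add (a2.mul a2)).congr_deriv ?_
      simp only [reCLM_apply, imCLM_apply, Function.comp_apply, mul_re (conj (α t).2), conj_re, conj_im]
      ring
    refine ((h1.exp.pow 2).mul h3).congr_deriv ?_
    simp only [normSq_apply, pow_two, mul_re, mul_im, conj_re, conj_im, neg_re, neg_im, re_ofNat, im_ofNat, Pi.pow_apply]
    push_cast
    ring
  intro t ht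
  have h0 : (0 : ℝ) ∈ Icc 0 s := ⟨le_rfl, ht.1.trans ht.2⟩
  have c := constant_of_has_deriv_right_zero (fun t ht => (key t ht).continuousWithinAt)
    (fun t ht => (key t (Ico_subset_Icc_self ht)).Ici_of_Icc ht) t ht
  simp only [h.start] at c
  rw [← Complex.sq_norm, ← Complex.sq_norm, ← mul_pow, ← mul_pow] at c
  exact (pow_left_inj₀ (by positivity) (by positivity) two_ne_zero).1 c

/-- The acceleration is quadratic in the velocity, so it scales by `c²` under a time change by `c`.
-/
theorem SolvesOn.rescale {ρ : ℂ → ℝ} {z w : ℂ} {s s' c : ℝ} {α : ℝ → ℂ × ℂ}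
    (h : SolvesOn (geodesicField ρ) phaseSpace (z, w) s α) (hc : 0 ≤ c) (hs : c * s' ≤ s) :
    SolvesOn (geodesicField ρ) phaseSpace (z, c * w) s'
      fun t => ((α (c * t)).1, c * (α (c * t)).2) := by
  have hm : MapsTo (fun t => c * t) (Icc 0 s') (Icc 0 s) := fun t ht =>
    ⟨mul_nonneg hc ht.1, (mul_le_mul_of_nonneg_left ht.2 hc).trans hs⟩
  have hd : ∀ t, HasDerivWithinAt (fun t : ℝ => c * t) c (Icc 0 s') t := fun t => by
    simpa using (hasDerivWithinAt_id t (Icc 0 s')).const_mul c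
  refine solvesOn_of_components (by simp [h.start]) (by simp [h.start])
    (fun t ht => (h.mem _ (hm ht)).1) (fun t ht => ?_) (fun t ht => ?_)
  · have := (h.hasDerivWithinAt_fst (hm ht)).scomp t (hd t) hm
    simpa [Function.comp_def] using this
  · have := ((h.hasDerivWithinAt_snd (hm ht)).scomp t (hd t) hm).const_mul (c : ℂ)
    refine this.congr_deriv ?_
    rw [real_smul]; ring

/-- By homogeneity, running a geodesic for time `s` amounts to running for unit time the one with
`s` times its initial velocity. This translates between geodesics of any length and `expMap`. -/
theorem SolvesOn.mem_expDomain {ρ : ℂ → ℝ} (hρ : ContDiffOn ℝ ∞ ρ (ball 0 1)) {z₀ x : ℂ} {s : ℝ}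
    {α : ℝ → ℂ × ℂ} (hs : 0 ≤ s)
    (h : SolvesOn (geodesicField ρ) phaseSpace (z₀, Real.exp (-ρ z₀) * x) s α) :
    (s * x : ℂ) ∈ expDomain ρ z₀ ∧ expMap ρ z₀ (s * x) = (α s).1 ∧
      (expCurve ρ z₀ (s * x) 1).2 = s * (α s).2 := by
  have h1 := h.rescale (s' := 1) hs (by simp)
  rw [mul_left_comm] at h1
  have hmem : (s * x : ℂ) ∈ expDomain ρ z₀ := ⟨_, h1⟩
  have h2 := (solvesOn_expCurve hmem).eqOn isOpen_phaseSpace (contDiffOn_geodesicField hρ) h1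
    (show (1 : ℝ) ∈ Icc 0 1 from ⟨zero_le_one, le_rfl⟩)
  refine ⟨hmem, ?_, ?_⟩
  · rw [expMap, h2]; simp
  · rw [h2]; simp

theorem zero_mem_expDomain {ρ : ℂ → ℝ} {z₀ : ℂ} (hz₀ : z₀ ∈ ball (0 : ℂ) 1) :
    (0 : ℂ) ∈ expDomain ρ z₀ := by
  refine ⟨fun _ => (z₀, 0), ⟨by simp, fun t _ => ⟨hz₀, mem_univ _⟩, fun t _ => ?_⟩⟩
  have : geodesicField ρ (z₀, 0) = 0 := by simp [geodesicField]
  rw [this]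
  exact hasDerivWithinAt_const _ _ _

theorem expMap_zero {ρ : ℂ → ℝ} (hρ : ContDiffOn ℝ ∞ ρ (ball 0 1)) {z₀ : ℂ}
    (hz₀ : z₀ ∈ ball (0 : ℂ) 1) : expMap ρ z₀ 0 = z₀ := by
  have h := solvesOn_expCurve (zero_mem_expDomain (ρ := ρ) hz₀)
  have := (h.mono (zero_le_one (α := ℝ))).mem_expDomain hρ le_rfl
  simpa [h.start] using this.2.1

theorem ofReal_mul_mem_expDomain {ρ : ℂ → ℝ} (hρ : ContDiffOn ℝ ∞ ρ (ball 0 1)) {z₀ x : ℂ} {r : ℝ}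
    (hx : x ∈ expDomain ρ z₀) (hr : r ∈ Icc (0 : ℝ) 1) :
    (r * x : ℂ) ∈ expDomain ρ z₀ ∧ expMap ρ z₀ (r * x) = (expCurve ρ z₀ x r).1 ∧
      (expCurve ρ z₀ (r * x) 1).2 = r * (expCurve ρ z₀ x r).2 :=
  ((solvesOn_expCurve hx).mono hr.2).mem_expDomain hρ hr.1

theorem norm_expCurve_snd {ρ : ℂ → ℝ} (hρ : ContDiffOn ℝ ∞ ρ (ball 0 1)) {z₀ x : ℂ}
    (hx : x ∈ expDomain ρ z₀) {t : ℝ} (ht : t ∈ Icc (0 : ℝ) 1) :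
    Real.exp (ρ (expCurve ρ z₀ x t).1) * ‖(expCurve ρ z₀ x t).2‖ = ‖x‖ := by
  rw [(solvesOn_expCurve hx).speed hρ t ht]
  simp only [norm_mul, norm_real, Real.norm_eq_abs, Real.abs_exp]
  rw [← mul_assoc, ← Real.exp_add]
  simp

theorem continuousOn_dzdzbar {ρ : ℂ → ℝ} (hρ : ContDiffOn ℝ ∞ ρ (ball 0 1)) :
    ContinuousOn (dzdzbar ρ) (ball 0 1) := by
  have h := (contDiffOn_gradZ isOpen_ball hρ).continuousOn_fderiv_of_isOpen isOpen_ball (by simp)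
  have h1 : ∀ w : ℂ, ContinuousOn (fun z => fderiv ℝ (gradZ ρ) z w) (ball 0 1) := fun w =>
    h.clm_apply continuousOn_const
  exact continuous_re.comp_continuousOn
    (((h1 1).add ((continuousOn_const (c := I)).mul (h1 I))).div_const 2)

/-- The Jacobi fields along a geodesic, as solutions of the linearized geodesic equation. -/
theorem exists_linearized_solution {ρ : ℂ → ℝ} (hρ : ContDiffOn ℝ ∞ ρ (ball 0 1))
    (hcurv : ∀ z ∈ ball (0 : ℂ) 1, 0 ≤ dzdzbar ρ z) {z₀ x : ℂ} (hx : x ∈ expDomain ρ z₀) :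
    ∃ (J : ℂ → ℝ → ℂ × ℂ) (D : ℂ →L[ℝ] ℂ × ℂ) (C : ℝ),
      (∀ d, J d 0 = (0, Real.exp (-ρ z₀) * d)) ∧
      (∀ d, ∀ t ∈ Icc (0 : ℝ) 1, HasDerivWithinAt (J d)
        (fderiv ℝ (geodesicField ρ) (expCurve ρ z₀ x t) (J d t)) (Icc 0 1) t) ∧
      (∀ d, ∀ t ∈ Icc (0 : ℝ) 1, ‖J d t‖ ≤ C * ‖d‖) ∧ (∀ d, D d = J d 1) ∧
      ∀ d, ‖d‖ ≤ Real.exp (ρ (expMap ρ z₀ x)) * ‖(D d).1‖ := by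
  have hα := solvesOn_expCurve hx
  have hz₀ : z₀ ∈ ball (0 : ℂ) 1 := by
    have := (hα.mem 0 ⟨le_rfl, zero_le_one⟩).1
    rwa [hα.start] at this
  have i0 : (0 : ℝ) ∈ Icc (0 : ℝ) 1 := ⟨le_rfl, zero_le_one⟩
  have i1 : (1 : ℝ) ∈ Icc (0 : ℝ) 1 := ⟨zero_le_one, le_rfl⟩
  set c := Real.exp (-ρ z₀) with hc
  have hc0 : 0 < c := Real.exp_pos _
  -- At `x = 0` the geodesic is constant and has no tangential and normal directions.
  rcases eq_or_ne x 0 with rfl | hx0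
  · have hconst : SolvesOn (geodesicField ρ) phaseSpace (z₀, c * 0) 1 fun _ => (z₀, 0) := by
      refine ⟨by simp, fun t _ => ⟨hz₀, mem_univ _⟩, fun t _ => ?_⟩
      have : geodesicField ρ (z₀, 0) = 0 := by simp [geodesicField]
      rw [this]; exact hasDerivWithinAt_const _ _ _
    have heq := hα.eqOn isOpen_phaseSpace (contDiffOn_geodesicField hρ) hconst
    refine ⟨fun d t => (t * (c * d), c * d),
      ((c : ℂ) • (1 : ℂ →L[ℝ] ℂ)).prod ((c : ℂ) • (1 : ℂ →L[ℝ] ℂ)), c, fun d => by simp,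
      fun d t ht => ?_, fun d t ht => ?_, fun d => by simp, fun d => ?_⟩
    · rw [heq ht, fderiv_geodesicField (contDiffAt_two hρ hz₀)]
      refine HasDerivWithinAt.congr_deriv (f' := (1 * (c * d), 0)) ?_ (by simp)
      exact HasDerivWithinAt.prodMk ((hasDerivWithinAt_id t _).ofReal_comp.mul_const _)
        (hasDerivWithinAt_const _ _ _)
    · simp only [Prod.norm_def, norm_mul, norm_real, Real.norm_eq_abs, abs_of_pos hc0, abs_of_nonneg ht.1]
      refine max_le ?_ le_rfl
      have : 0 ≤ c * ‖d‖ := by positivity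
      nlinarith [ht.2]
    · rw [expMap_zero hρ hz₀]
      simp only [ContinuousLinearMap.prod_apply, smul_apply,
        one_apply_eq_self, smul_eq_mul, norm_mul, norm_real, Real.norm_eq_abs, abs_of_pos hc0]
      rw [← mul_assoc, hc, ← Real.exp_add]; simp
  · set γ : ℝ → ℂ := fun t => (expCurve ρ z₀ x t).1 with hγ
    set v : ℝ → ℂ := fun t => (expCurve ρ z₀ x t).2 with hv
    have hγm : ∀ t ∈ Icc (0 : ℝ) 1, γ t ∈ ball (0 : ℂ) 1 := fun t ht => (hα.mem t ht).1
    have hγd : ∀ t ∈ Icc (0 : ℝ) 1, HasDerivWithinAt γ (v t) (Icc 0 1) t := fun t ht =>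
      hα.hasDerivWithinAt_fst ht
    set a : ℝ → ℂ := fun t => -2 * gradZ ρ (γ t) * v t ^ 2 with ha
    have hvd : ∀ t ∈ Icc (0 : ℝ) 1, HasDerivWithinAt v (a t) (Icc 0 1) t := fun t ht =>
      hα.hasDerivWithinAt_snd ht
    set a' : ℝ → ℂ := fun t => -2 * (dz (gradZ ρ) (γ t) * v t + dzdzbar ρ (γ t) * conj (v t)) * v t ^ 2
      - 4 * gradZ ρ (γ t) * v t * a t with ha'
    have had : ∀ t ∈ Icc (0 : ℝ) 1, HasDerivWithinAt a (a' t) (Icc 0 1) t := fun t ht => by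
      have h2 := contDiffAt_two hρ (hγm t ht)
      have h1 := (hγd t ht).comp_dz (hasFDerivAt_gradZ h2).differentiableAt
      refine ((h1.const_mul (-2)).mul ((hvd t ht).pow 2)).congr_deriv ?_
      rw [dzbar_gradZ_eq h2]
      simp only [ha', Pi.pow_apply]
      push_cast
      ring
    have hγc : ContinuousOn γ (Icc 0 1) := fun t ht => (hγd t ht).continuousWithinAt
    have hvc : ContinuousOn v (Icc 0 1) := fun t ht => (hvd t ht).continuousWithinAt
    have hac : ContinuousOn a (Icc 0 1) := fun t ht => (had t ht).continuousWithinAt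
    -- `t γ'` and `i b γ'` will be the tangential and normal Jacobi fields vanishing at `t = 0`. The
    -- second requires `b'' = 4 ρ_{z z̄} |γ'|² b`, whose coefficient is nonnegative by the curvature
    -- hypothesis.
    obtain ⟨b, b', hb0, hb'0, hb1, hb, hb'⟩ := exists_jacobi_solution
      (q := fun t => 4 * dzdzbar ρ (γ t) * normSq (v t))
      ((continuousOn_const.mul ((continuousOn_dzdzbar hρ).comp hγc hγm)).mul
        (continuous_normSq.comp_continuousOn hvc))
      (fun t ht => mul_nonneg (mul_nonneg (by norm_num) (hcurv _ (hγm t ht))) (normSq_nonneg _))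
    set J₁ : ℝ → ℂ × ℂ := fun t => (t * v t, v t + t * a t) with hJ₁
    set J₂ : ℝ → ℂ × ℂ := fun t => (I * b t * v t, I * b' t * v t + I * b t * a t) with hJ₂
    have hid : ∀ t : ℝ, HasDerivWithinAt (fun t : ℝ => (t : ℂ)) 1 (Icc 0 1) t := fun t =>
      (hasDerivWithinAt_id t _).ofReal_comp
    have d1 : ∀ t ∈ Icc (0 : ℝ) 1, HasDerivWithinAt J₁
        (fderiv ℝ (geodesicField ρ) (expCurve ρ z₀ x t) (J₁ t)) (Icc 0 1) t := fun t ht => by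
      rw [fderiv_geodesicField (contDiffAt_two hρ (hγm t ht))]
      refine (((hid t).mul (hvd t ht)).prodMk ((hvd t ht).add ((hid t).mul (had t ht)))).congr_deriv ?_
      change _ = (_, -2 * (dz (gradZ ρ) (γ t) * _ + dzdzbar ρ (γ t) * conj _) * v t ^ 2 - 4 * gradZ ρ (γ t) * v t * _)
      simp only [hJ₁, ha', ha, map_mul, conj_ofReal]
      refine Prod.ext ?_ ?_ <;> simp only <;> ring
    have d2 : ∀ t ∈ Icc (0 : ℝ) 1, HasDerivWithinAt J₂
        (fderiv ℝ (geodesicField ρ) (expCurve ρ z₀ x t) (J₂ t)) (Icc 0 1) t := fun t ht => by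
      rw [fderiv_geodesicField (contDiffAt_two hρ (hγm t ht))]
      have hB := (hb t ht).ofReal_comp.const_mul I
      have hB' := (hb' t ht).ofReal_comp.const_mul I
      refine ((hB.mul (hvd t ht)).prodMk ((hB'.mul (hvd t ht)).add (hB.mul (had t ht)))).congr_deriv ?_
      change _ = (_, -2 * (dz (gradZ ρ) (γ t) * _ + dzdzbar ρ (γ t) * conj _) * v t ^ 2 - 4 * gradZ ρ (γ t) * v t * _)
      simp only [hJ₂, ha', ha, map_mul, conj_ofReal, conj_I]
      have hn : ((normSq (v t) : ℝ) : ℂ) = v t * conj (v t) := (mul_conj _).symm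
      refine Prod.ext ?_ ?_
      · simp only
      · simp only
        push_cast
        rw [hn]
        ring
    obtain ⟨C₁, hC₁⟩ := isCompact_Icc.exists_bound_of_continuousOn
      (fun t ht => (d1 t ht).continuousWithinAt : ContinuousOn J₁ (Icc 0 1))
    obtain ⟨C₂, hC₂⟩ := isCompact_Icc.exists_bound_of_continuousOn
      (fun t ht => (d2 t ht).continuousWithinAt : ContinuousOn J₂ (Icc 0 1))
    have hv0 : v 0 = c * x := by simp only [hv, hα.start, hc]
    set m : ℂ →L[ℝ] ℂ := (x⁻¹ : ℂ) • (1 : ℂ →L[ℝ] ℂ) with hm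
    have hmd : ∀ d, m d = x⁻¹ * d := fun d => by simp [hm]
    set D : ℂ →L[ℝ] ℂ × ℂ := (reCLM.comp m).smulRight (J₁ 1) + (imCLM.comp m).smulRight (J₂ 1) with hD
    have hDd : ∀ d, D d = (x⁻¹ * d).re • J₁ 1 + (x⁻¹ * d).im • J₂ 1 := fun d => by
      simp [hD, hmd]
    refine ⟨fun d t => (x⁻¹ * d).re • J₁ t + (x⁻¹ * d).im • J₂ t, D, ‖x⁻¹‖ * C₁ + ‖x⁻¹‖ * C₂,
      fun d => ?_, fun d t ht => ?_, fun d t ht => ?_, hDd, fun d => ?_⟩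
    · simp only [hJ₁, hJ₂, hb0, hb'0]
      refine Prod.ext (by simp) ?_
      simp only [Prod.snd_add, Prod.smul_snd, real_smul, hv0]
      have : ((x⁻¹ * d).re : ℂ) + (x⁻¹ * d).im * I = x⁻¹ * d := re_add_im _
      calc _ = (((x⁻¹ * d).re : ℂ) + (x⁻¹ * d).im * I) * (c * x) := by push_cast; ring
        _ = _ := by rw [this]; field_simp
    · rw [map_add, map_smul, map_smul]
      exact ((d1 t ht).const_smul (x⁻¹ * d).re).add ((d2 t ht).const_smul (x⁻¹ * d).im)
    · refine (norm_add_le _ _).trans ?_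
      rw [norm_smul, norm_smul, add_mul, mul_right_comm, mul_right_comm _ C₂, ← norm_mul]
      exact add_le_add
        (mul_le_mul (abs_re_le_norm _) (hC₁ t ht) (norm_nonneg _) (norm_nonneg _))
        (mul_le_mul (abs_im_le_norm _) (hC₂ t ht) (norm_nonneg _) (norm_nonneg _))
    · set l := x⁻¹ * d with hl
      have e1 : (D d).1 = (l.re + l.im * b 1 * I) * v 1 := by
        rw [hDd]
        simp only [hJ₁, hJ₂, Prod.fst_add, Prod.smul_fst, real_smul]
        push_cast; ring
      -- Expansion of the exponential map: `b 1 ≥ 1` stretches the normal component, while the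
      -- tangential one keeps its length.
      have e2 : ‖l‖ ≤ ‖(l.re + l.im * b 1 * I : ℂ)‖ := by
        rw [← sq_le_sq₀ (norm_nonneg _) (norm_nonneg _), Complex.sq_norm, Complex.sq_norm]
        simp only [normSq_apply, add_re, ofReal_re, mul_re, ofReal_im, I_re, I_im, add_im, mul_im]
        nlinarith [mul_self_nonneg l.im, mul_nonneg (mul_self_nonneg l.im)
          (show 0 ≤ b 1 * b 1 - 1 by nlinarith)]
      have e3 : Real.exp (ρ (expMap ρ z₀ x)) * ‖v 1‖ = ‖x‖ := norm_expCurve_snd hρ hx i1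
      rw [e1, norm_mul, mul_left_comm, e3]
      calc ‖d‖ = ‖l‖ * ‖x‖ := by rw [hl, ← norm_mul]; congr 1; field_simp
        _ ≤ _ := by gcongr

/-- The derivative is the time-one value of the Jacobi fields, and their lower bound makes the map
expanding from the Euclidean metric to `e^{2ρ} |dz|²`. -/
theorem expDomain_mem_nhds_and_hasStrictFDerivAt {ρ : ℂ → ℝ} (hρ : ContDiffOn ℝ ∞ ρ (ball 0 1))
    (hcurv : ∀ z ∈ ball (0 : ℂ) 1, 0 ≤ dzdzbar ρ z) {z₀ x : ℂ} (hx : x ∈ expDomain ρ z₀) :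
    expDomain ρ z₀ ∈ 𝓝 x ∧ ∃ D : ℂ →L[ℝ] ℂ, HasStrictFDerivAt (expMap ρ z₀) D x ∧
      ∀ d, ‖d‖ ≤ Real.exp (ρ (expMap ρ z₀ x)) * ‖D d‖ := by
  have hX := contDiffOn_geodesicField hρ
  obtain ⟨Φ, hΦ, hstrict⟩ := (solvesOn_expCurve hx).exists_flow (F := ℂ) isOpen_phaseSpace hX
  obtain ⟨J, D, C, hJ0, hJ, hJC, hD, hDd⟩ := exists_linearized_solution hρ hcurv hx
  set c := Real.exp (-ρ z₀) with hc
  set ι : ℂ →L[ℝ] ℂ × ℂ := (ContinuousLinearMap.inr ℝ ℂ ℂ).comp ((c : ℂ) • (1 : ℂ →L[ℝ] ℂ)) with hι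
  have hιd : ∀ d, ι d = (0, c * d) := fun d => by simp [hι]
  have e1 : ∀ x', (z₀, c * x) + ι (x' - x) = ((z₀, c * x') : ℂ × ℂ) := fun x' => by
    rw [hιd]; refine Prod.ext (by simp) ?_; simp only [Prod.snd_add]; ring
  have s1 := hstrict J ι D C (fun d => by rw [hJ0, hιd]) hJ hJC hD x
  have ev : ∀ᶠ x' in 𝓝 x, SolvesOn (geodesicField ρ) phaseSpace (z₀, c * x') 1 (Φ (z₀, c * x')) := by
    have ht : Tendsto (fun x' => ((z₀, c * x') : ℂ × ℂ)) (𝓝 x) (𝓝 (z₀, c * x)) :=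
      Continuous.tendsto (by fun_prop) x
    exact ht.eventually hΦ
  refine ⟨by filter_upwards [ev] with x' h' using ⟨_, h'⟩,
    (ContinuousLinearMap.fst ℝ ℂ ℂ).comp D, ?_, fun d => hDd d⟩
  have s2 := (ContinuousLinearMap.fst ℝ ℂ ℂ).hasStrictFDerivAt.comp x s1
  refine s2.congr_of_eventuallyEq ?_
  filter_upwards [ev] with x' h'
  have hx' : x' ∈ expDomain ρ z₀ := ⟨_, h'⟩
  have := (solvesOn_expCurve hx').eqOn isOpen_phaseSpace hX h'
    (show (1 : ℝ) ∈ Icc 0 1 from ⟨zero_le_one, le_rfl⟩)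
  simp only [e1, expMap, this]
  rfl

theorem isOpen_expDomain {ρ : ℂ → ℝ} (hρ : ContDiffOn ℝ ∞ ρ (ball 0 1))
    (hcurv : ∀ z ∈ ball (0 : ℂ) 1, 0 ≤ dzdzbar ρ z) (z₀ : ℂ) : IsOpen (expDomain ρ z₀) :=
  isOpen_iff_mem_nhds.2 fun _ hx => (expDomain_mem_nhds_and_hasStrictFDerivAt hρ hcurv hx).1

theorem continuousOn_expMap {ρ : ℂ → ℝ} (hρ : ContDiffOn ℝ ∞ ρ (ball 0 1))
    (hcurv : ∀ z ∈ ball (0 : ℂ) 1, 0 ≤ dzdzbar ρ z) (z₀ : ℂ) :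
    ContinuousOn (expMap ρ z₀) (expDomain ρ z₀) := fun x hx => by
  obtain ⟨D, hD, -⟩ := (expDomain_mem_nhds_and_hasStrictFDerivAt hρ hcurv hx).2
  exact hD.continuousAt.continuousWithinAt

/-! ### Geodesic rays -/

theorem IsGeodesicOn.solvesOn {ρ : ℂ → ℝ} {s : ℝ} {γ v : ℝ → ℂ}
    (h : IsGeodesicOn ρ (Icc 0 s) γ v) :
    SolvesOn (geodesicField ρ) phaseSpace (γ 0, v 0) s fun t => (γ t, v t) :=
  solvesOn_of_components rfl rfl h.mem_disk h.velocity h.equation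

theorem IsGeodesicOn.mono {ρ : ℂ → ℝ} {S S' : Set ℝ} {γ v : ℝ → ℂ} (h : IsGeodesicOn ρ S γ v)
    (hS : S' ⊆ S) : IsGeodesicOn ρ S' γ v :=
  ⟨fun t ht => h.mem_disk t (hS ht), fun t ht => (h.velocity t (hS ht)).mono hS,
    fun t ht => h.unit_speed t (hS ht), fun t ht => (h.equation t (hS ht)).mono hS⟩

theorem IsGeodesicOn.expMap_eq {ρ : ℂ → ℝ} (hρ : ContDiffOn ℝ ∞ ρ (ball 0 1)) {z₀ u : ℂ} {s : ℝ}
    {γ v : ℝ → ℂ} (h : IsGeodesicOn ρ (Icc 0 s) γ v) (h0 : γ 0 = z₀)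
    (hv : v 0 = Real.exp (-ρ z₀) * u) {t : ℝ} (ht : t ∈ Icc 0 s) :
    (t * u : ℂ) ∈ expDomain ρ z₀ ∧ expMap ρ z₀ (t * u) = γ t := by
  have h1 := h.solvesOn.mono ht.2
  rw [h0, hv] at h1
  have := h1.mem_expDomain hρ ht.1
  exact ⟨this.1, this.2.1⟩

theorem SolvesOn.isGeodesicOn {ρ : ℂ → ℝ} (hρ : ContDiffOn ℝ ∞ ρ (ball 0 1)) {z u : ℂ} (hu : ‖u‖ = 1)
    {s : ℝ} {γ v : ℝ → ℂ}
    (h : SolvesOn (geodesicField ρ) phaseSpace (z, Real.exp (-ρ z) * u) s fun t => (γ t, v t)) :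
    IsGeodesicOn ρ (Icc 0 s) γ v :=
  ⟨fun t ht => (h.mem t ht).1, fun t ht => h.hasDerivWithinAt_fst ht, fun t ht => by
    rw [h.speed hρ t ht]
    simp only [norm_mul, norm_real, Real.norm_eq_abs, Real.abs_exp, hu, mul_one]
    rw [← Real.exp_add]; simp, fun t ht => h.hasDerivWithinAt_snd ht⟩

/-- The velocity of the geodesic ray in the direction `u`. -/
noncomputable def rayVelocity (ρ : ℂ → ℝ) (z₀ u : ℂ) (t : ℝ) : ℂ :=
  if t = 0 then Real.exp (-ρ z₀) * u else (expCurve ρ z₀ (t * u) 1).2 / t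

theorem solvesOn_ray {ρ : ℂ → ℝ} (hρ : ContDiffOn ℝ ∞ ρ (ball 0 1)) {z₀ u : ℂ} {s : ℝ} (hs : 0 < s)
    (h : (s * u : ℂ) ∈ expDomain ρ z₀) :
    SolvesOn (geodesicField ρ) phaseSpace (z₀, Real.exp (-ρ z₀) * u) s
      fun t => (expMap ρ z₀ (t * u), rayVelocity ρ z₀ u t) := by
  have h1 := (solvesOn_expCurve h).rescale (c := 1 / s) (s' := s) (by positivity)
    (by rw [one_div_mul_cancel hs.ne'])
  have e : ((1 / s : ℝ) : ℂ) * (Real.exp (-ρ z₀) * (s * u)) = Real.exp (-ρ z₀) * u := by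
    have : (s : ℂ) ≠ 0 := by exact_mod_cast hs.ne'
    push_cast; field_simp
  rw [e] at h1
  refine h1.congr hs.le fun t ht => ?_
  have h2 := (h1.mono ht.2).mem_expDomain hρ ht.1
  refine Prod.ext h2.2.1 ?_
  simp only [rayVelocity]
  split_ifs with ht0
  · subst ht0
    have := congrArg Prod.snd h1.start
    exact this.symm
  · rw [h2.2.2]
    have : (t : ℂ) ≠ 0 := by exact_mod_cast ht0
    field_simp

theorem isGeodesicOn_ray {ρ : ℂ → ℝ} (hρ : ContDiffOn ℝ ∞ ρ (ball 0 1)) {z₀ u : ℂ} (hu : ‖u‖ = 1)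
    {s : ℝ} (hs : 0 < s) (h : (s * u : ℂ) ∈ expDomain ρ z₀) :
    IsGeodesicOn ρ (Icc 0 s) (fun t => expMap ρ z₀ (t * u)) (rayVelocity ρ z₀ u) :=
  (solvesOn_ray hρ hs h).isGeodesicOn hρ hu

theorem Icc_mem_nhdsWithin_rayDomain {T : ℝ≥0∞} {s t : ℝ} (hts : t < s) :
    Icc 0 s ∈ 𝓝[rayDomain T] t :=
  mem_nhdsWithin.2 ⟨Iio s, isOpen_Iio, hts, fun _ hu => ⟨hu.2.1, (mem_Iio.1 hu.1).le⟩⟩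

/-- `T` is the supremum of the times at which the ray exists. By openness it is not attained,
whereas a longer geodesic extending the ray would place `T u` itself in the domain. -/
theorem exists_isMaximalRay {ρ : ℂ → ℝ} (hρ : ContDiffOn ℝ ∞ ρ (ball 0 1))
    (hcurv : ∀ z ∈ ball (0 : ℂ) 1, 0 ≤ dzdzbar ρ z) {z₀ : ℂ} (hz₀ : z₀ ∈ ball (0 : ℂ) 1)
    (u : Circle) : ∃ T : ℝ≥0∞,
      IsMaximalRay ρ z₀ u T (fun t => expMap ρ z₀ (t * u)) (rayVelocity ρ z₀ u) ∧
        ∀ t : ℝ, 0 ≤ t → ((t * u : ℂ) ∈ expDomain ρ z₀ ↔ ENNReal.ofReal t < T) := by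
  set S : Set ℝ := {t | 0 ≤ t ∧ (t * u : ℂ) ∈ expDomain ρ z₀} with hS
  have hSo : ∀ t ∈ S, ∃ s ∈ S, t < s := fun t ht => by
    have hc : Tendsto (fun s : ℝ => (s * u : ℂ)) (𝓝 t) (𝓝 (t * u)) :=
      Continuous.tendsto (by fun_prop) t
    have h1 := hc.eventually ((isOpen_expDomain hρ hcurv z₀).mem_nhds ht.2)
    obtain ⟨s, hs1, hs2⟩ := ((h1.filter_mono nhdsWithin_le_nhds).and
      (self_mem_nhdsWithin (a := t) (s := Ioi t))).exists
    exact ⟨s, ⟨ht.1.trans (le_of_lt hs2), hs1⟩, hs2⟩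
  have hSd : ∀ s ∈ S, ∀ t, 0 ≤ t → t ≤ s → t ∈ S := fun s hs t ht hts => by
    refine ⟨ht, ?_⟩
    rcases eq_or_lt_of_le hs.1 with h | h
    · have : t = 0 := by linarith
      subst this; simpa using zero_mem_expDomain hz₀
    · exact ((isGeodesicOn_ray hρ u.norm_coe h hs.2).expMap_eq hρ
        (by simp [expMap_zero hρ hz₀]) (by simp [rayVelocity]) ⟨ht, hts⟩).1
  have h0S : (0 : ℝ) ∈ S := ⟨le_rfl, by simpa using zero_mem_expDomain hz₀⟩
  set T : ℝ≥0∞ := sSup (ENNReal.ofReal '' S) with hT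
  have hmem : ∀ t : ℝ, 0 ≤ t → ((t * u : ℂ) ∈ expDomain ρ z₀ ↔ ENNReal.ofReal t < T) := by
    refine fun t ht => ⟨fun h => ?_, fun h => ?_⟩
    · obtain ⟨s, hs, hts⟩ := hSo t ⟨ht, h⟩
      exact ((ENNReal.ofReal_lt_ofReal_iff (by linarith)).2 hts).trans_le
        (le_sSup (mem_image_of_mem _ hs))
    · obtain ⟨_, ⟨s, hs, rfl⟩, hts⟩ := lt_sSup_iff.1 h
      exact (hSd s hs t ht (ENNReal.ofReal_lt_ofReal_iff'.1 hts).1.le).2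
  have hgeo : ∀ t ∈ rayDomain T, ∃ s, t < s ∧
      IsGeodesicOn ρ (Icc 0 s) (fun t => expMap ρ z₀ (t * u)) (rayVelocity ρ z₀ u) := fun t ht => by
    obtain ⟨s, hs, hts⟩ := hSo t ⟨ht.1, (hmem t ht.1).2 ht.2⟩
    exact ⟨s, hts, isGeodesicOn_ray hρ u.norm_coe (ht.1.trans_lt hts) hs.2⟩
  have hgT : IsGeodesicOn ρ (rayDomain T) (fun t => expMap ρ z₀ (t * u)) (rayVelocity ρ z₀ u) := by
    refine ⟨fun t ht => ?_, fun t ht => ?_, fun t ht => ?_, fun t ht => ?_⟩ <;>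
      obtain ⟨s, hts, hg⟩ := hgeo t ht
    · exact hg.mem_disk t ⟨ht.1, hts.le⟩
    · exact (hg.velocity t ⟨ht.1, hts.le⟩).mono_of_mem_nhdsWithin (Icc_mem_nhdsWithin_rayDomain hts)
    · exact hg.unit_speed t ⟨ht.1, hts.le⟩
    · exact (hg.equation t ⟨ht.1, hts.le⟩).mono_of_mem_nhdsWithin (Icc_mem_nhdsWithin_rayDomain hts)
  have hTpos : 0 < T := by
    have := (hmem 0 le_rfl).1 h0S.2
    simpa using this
  refine ⟨T, ⟨hTpos, hgT, by simp [expMap_zero hρ hz₀], by simp [rayVelocity], ?_⟩, hmem⟩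
  intro T' γ' v' hTT' hg' heq
  have hTtop : T ≠ ⊤ := hTT'.ne_top
  set τ := T.toReal with hτ
  have hτT : ENNReal.ofReal τ = T := ENNReal.ofReal_toReal hTtop
  have hτ0 : 0 < τ := ENNReal.toReal_pos hTpos.ne' hTtop
  have hsub : Icc 0 τ ⊆ rayDomain T' := fun t ht =>
    ⟨ht.1, ((ENNReal.ofReal_le_ofReal ht.2).trans_eq hτT).trans_lt hTT'⟩
  have h0 : (0 : ℝ) ∈ rayDomain T := ⟨le_rfl, by simpa using hTpos⟩
  have hsubT : rayDomain T ⊆ rayDomain T' := fun t ht => ⟨ht.1, ht.2.trans hTT'⟩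
  have hIco : Ico 0 τ ⊆ rayDomain T := fun t ht =>
    ⟨ht.1, by rw [← hτT]; exact (ENNReal.ofReal_lt_ofReal_iff hτ0).2 ht.2⟩
  have e0 : γ' 0 = z₀ := by rw [heq h0]; simp [expMap_zero hρ hz₀]
  -- Only the positions of the longer curve are known to agree with the ray, so its initial velocity
  -- is recovered as a one-sided derivative.
  have ev : v' 0 = rayVelocity ρ z₀ u 0 := by
    have h1 := ((hg'.velocity 0 (hsubT h0)).mono hsubT).congr heq.symm (heq h0).symm
    exact (uniqueDiffOn_Ico 0 τ 0 ⟨le_rfl, hτ0⟩).eq_deriv _ (h1.mono hIco)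
      ((hgT.velocity 0 h0).mono hIco)
  have := ((hg'.mono hsub).expMap_eq hρ (u := u) e0 (by rw [ev]; simp [rayVelocity])
    ⟨hτ0.le, le_rfl⟩).1
  rw [hmem τ hτ0.le, hτT] at this
  exact lt_irrefl _ this

/-- The polar description of the disk by geodesic rays from `z₀`: `len` and `E` give the lengths
and the limit points of the rays, as functions of their initial directions. -/
structure IsPolarSystem (ρ : ℂ → ℝ) (z₀ : ℂ) (len : Circle → ℝ≥0∞) (E : Circle → Circle) : Prop where
  base_mem : z₀ ∈ ball (0 : ℂ) 1
  continuous_len : Continuous len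
  continuous_endpoint : Continuous E
  surjective_endpoint : Function.Surjective E
  mem_iff : ∀ (u : Circle) (t : ℝ), 0 ≤ t → ((t * u : ℂ) ∈ expDomain ρ z₀ ↔ ENNReal.ofReal t < len u)
  tendsto : ∀ u : Circle, Tendsto (fun t : ℝ => expMap ρ z₀ (t * u))
    (comap ENNReal.ofReal (𝓝[<] len u)) (𝓝 (E u))

theorem comap_ofReal_nhdsLT_neBot {T : ℝ≥0∞} (hT : 0 < T) : (comap ENNReal.ofReal (𝓝[<] T)).NeBot := by
  have : (𝓝[<] T).NeBot := nhdsLT_neBot_of_exists_lt ⟨0, hT⟩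
  rw [comap_neBot_iff]
  intro s hs
  obtain ⟨x, hx, hxT⟩ := (inter_mem hs self_mem_nhdsWithin : s ∩ Iio T ∈ 𝓝[<] T) |> this.nonempty_of_mem
  exact ⟨x.toReal, by rwa [ENNReal.ofReal_toReal (mem_Iio.1 hxT).ne_top]⟩

/-- In the complete case all lengths are `∞`, hence trivially continuous; in the other case (ULP*)
gives continuity. From here on the two cases are treated alike. -/
theorem exists_isPolarSystem {ρ : ℂ → ℝ} (hρ : ContDiffOn ℝ ∞ ρ (ball 0 1))
    (hcurv : ∀ z ∈ ball (0 : ℂ) 1, 0 ≤ dzdzbar ρ z)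
    (hcomplete : IsCompleteMetric ρ → ULP ρ) (hincomplete : ¬ IsCompleteMetric ρ → ULPStar ρ)
    {z₀ : ℂ} (hz₀ : z₀ ∈ ball (0 : ℂ) 1) : ∃ len E, IsPolarSystem ρ z₀ len E := by
  have hulp : ULP ρ := by
    by_cases h : IsCompleteMetric ρ
    · exact hcomplete h
    · exact (hincomplete h).1
  obtain ⟨len, hlen, hT⟩ : ∃ len : Circle → ℝ≥0∞, Continuous len ∧
      ∀ (u : Circle) (T : ℝ≥0∞) (γ v : ℝ → ℂ), IsMaximalRay ρ z₀ u T γ v → T = len u := by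
    by_cases h : IsCompleteMetric ρ
    · exact ⟨fun _ => ⊤, continuous_const, fun u T γ v hr => h z₀ hz₀ u T γ v hr⟩
    · exact (hincomplete h).2 z₀ hz₀
  obtain ⟨⟨E, hE, hlim⟩, hsurj⟩ := hulp z₀ hz₀
  have hray : ∀ u : Circle,
      IsMaximalRay ρ z₀ u (len u) (fun t => expMap ρ z₀ (t * u)) (rayVelocity ρ z₀ u) ∧
        ∀ t : ℝ, 0 ≤ t → ((t * u : ℂ) ∈ expDomain ρ z₀ ↔ ENNReal.ofReal t < len u) := fun u => by
    obtain ⟨T, h1, h2⟩ := exists_isMaximalRay hρ hcurv hz₀ u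
    have := hT _ _ _ _ h1
    subst this
    exact ⟨h1, h2⟩
  refine ⟨len, E, hz₀, hlen, hE, fun ζ => ?_, fun u => (hray u).2, fun u => hlim _ _ _ _ (hray u).1⟩
  obtain ⟨u, T, γ, v, h1, h2⟩ := hsurj ζ
  have := comap_ofReal_nhdsLT_neBot h1.length_pos
  exact ⟨u, Circle.ext (tendsto_nhds_unique (hlim _ _ _ _ h1) h2)⟩

/-- The direction `x / |x|` of a nonzero complex number. -/
noncomputable def direction (x : ℂ) : Circle := Circle.exp x.arg

theorem coe_direction {x : ℂ} (hx : x ≠ 0) : (direction x : ℂ) = x / ‖x‖ := by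
  have h : (‖x‖ : ℂ) ≠ 0 := by exact_mod_cast norm_ne_zero_iff.2 hx
  rw [direction, Circle.coe_exp, eq_div_iff h, mul_comm, norm_mul_exp_arg_mul_I]

theorem norm_mul_direction (x : ℂ) : (‖x‖ * direction x : ℂ) = x := by
  by_cases hx : x = 0
  · simp [hx]
  · rw [coe_direction hx, mul_div_cancel₀]
    exact_mod_cast norm_ne_zero_iff.2 hx

theorem direction_mul {t : ℝ} (ht : 0 < t) (u : Circle) : direction (t * u) = u := by
  have h : (t * u : ℂ) ≠ 0 := mul_ne_zero (by exact_mod_cast ht.ne') u.coe_ne_zero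
  apply Circle.ext
  have : (t : ℂ) ≠ 0 := by exact_mod_cast ht.ne'
  rw [coe_direction h, norm_mul, Circle.norm_coe, norm_real, Real.norm_eq_abs, abs_of_pos ht, mul_one]
  field_simp

theorem Circle.isInducing_coe : Topology.IsInducing (fun u : Circle => (u : ℂ)) := ⟨rfl⟩

theorem tendsto_direction {x : ℂ} (hx : x ≠ 0) : Tendsto direction (𝓝 x) (𝓝 (direction x)) := by
  rw [Circle.isInducing_coe.tendsto_nhds_iff]
  have h1 : Tendsto (fun y : ℂ => y / ‖y‖) (𝓝 x) (𝓝 (x / ‖x‖)) :=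
    tendsto_id.div (continuous_ofReal.continuousAt.tendsto.comp (continuous_norm.tendsto x))
      (by simpa using hx)
  change Tendsto _ _ (𝓝 ((direction x : ℂ)))
  rw [coe_direction hx]
  refine h1.congr' ?_
  filter_upwards [isOpen_ne.mem_nhds hx] with y hy using (coe_direction hy).symm

theorem IsPolarSystem.mem_expDomain_iff {ρ : ℂ → ℝ} {z₀ : ℂ} {len : Circle → ℝ≥0∞} {E : Circle → Circle}
    (hP : IsPolarSystem ρ z₀ len E) (x : ℂ) :
    x ∈ expDomain ρ z₀ ↔ ENNReal.ofReal ‖x‖ < len (direction x) := by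
  rw [← hP.mem_iff _ _ (norm_nonneg x), norm_mul_direction]

/-- The end phases of the geodesics lie in a compact set, so all of them continue by a uniform
fraction `ε`, that is, `(1 + ε) ‖X i‖ ≤ len (direction (X i))`. Continuity of `len` passes this to
the limit and leaves room beyond `‖x‖`. -/
theorem IsPolarSystem.mem_expDomain_of_tendsto {ρ : ℂ → ℝ} (hρ : ContDiffOn ℝ ∞ ρ (ball 0 1))
    {z₀ : ℂ} {len : Circle → ℝ≥0∞} {E : Circle → Circle} (hP : IsPolarSystem ρ z₀ len E)
    {κ : Type*} {l : Filter κ} [l.NeBot] {X : κ → ℂ} {x p : ℂ} (hX : ∀ᶠ i in l, X i ∈ expDomain ρ z₀)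
    (hx : Tendsto X l (𝓝 x)) (hp : p ∈ ball (0 : ℂ) 1)
    (hXp : Tendsto (fun i => expMap ρ z₀ (X i)) l (𝓝 p)) : x ∈ expDomain ρ z₀ := by
  rcases eq_or_ne x 0 with rfl | hx0
  · exact zero_mem_expDomain hP.base_mem
  obtain ⟨r, hr, hrB⟩ := nhds_basis_closedBall.mem_iff.1 (isOpen_ball.mem_nhds hp)
  have hKc : IsCompact (closedBall p r) := isCompact_closedBall p r
  obtain ⟨M, hM⟩ := hKc.exists_bound_of_continuousOn (f := fun z => Real.exp (-ρ z))
    (Real.continuous_exp.comp_continuousOn (hρ.continuousOn.mono hrB).neg)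
  set B := M * (‖x‖ + 1) with hB
  obtain ⟨ε, hε, hsol⟩ := exists_uniform_time isOpen_phaseSpace (contDiffOn_geodesicField hρ)
    (hKc.prod (isCompact_closedBall (0 : ℂ) B)) (fun y hy => ⟨hrB hy.1, mem_univ _⟩)
  have hev : ∀ᶠ i in l, ENNReal.ofReal ((1 + ε) * ‖X i‖) ≤ len (direction (X i)) := by
    have h2 : ∀ᶠ i in l, ‖X i‖ < ‖x‖ + 1 := hx.norm.eventually_lt_const (by linarith)
    filter_upwards [hX, hXp.eventually (closedBall_mem_nhds p hr), h2] with i hi hpi hni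
    have hs := solvesOn_expCurve hi
    have hvel : Real.exp (ρ (expMap ρ z₀ (X i))) * ‖(expCurve ρ z₀ (X i) 1).2‖ = ‖X i‖ :=
      norm_expCurve_snd hρ hi ⟨zero_le_one, le_rfl⟩
    have hmemK : expCurve ρ z₀ (X i) 1 ∈ closedBall p r ×ˢ closedBall (0 : ℂ) B := by
      refine ⟨hpi, ?_⟩
      rw [mem_closedBall_zero_iff]
      have h3 : ‖(expCurve ρ z₀ (X i) 1).2‖ = Real.exp (-ρ (expMap ρ z₀ (X i))) * ‖X i‖ := by
        rw [← hvel, ← mul_assoc, ← Real.exp_add]; simp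
      have h4 := hM _ hpi
      rw [Real.norm_eq_abs, Real.abs_exp] at h4
      rw [h3, hB]
      exact mul_le_mul h4 hni.le (norm_nonneg _) ((Real.exp_pos _).le.trans h4)
    obtain ⟨β, hβ⟩ := hsol _ hmemK
    have h5 := ((hs.append zero_le_one hε.le hβ).mem_expDomain hρ (by positivity)).1
    have h6 : (((1 + ε : ℝ) : ℂ) * X i) = (((1 + ε) * ‖X i‖ : ℝ) : ℂ) * direction (X i) := by
      rw [ofReal_mul, mul_assoc, norm_mul_direction]
    rw [h6, hP.mem_iff _ _ (by positivity)] at h5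
    exact h5.le
  have h7 : ENNReal.ofReal ((1 + ε) * ‖x‖) ≤ len (direction x) := by
    refine le_of_tendsto_of_tendsto ?_ ?_ hev
    · exact (ENNReal.continuous_ofReal.tendsto _).comp (hx.norm.const_mul (1 + ε))
    · exact (hP.continuous_len.tendsto _).comp ((tendsto_direction hx0).comp hx)
  rw [hP.mem_expDomain_iff]
  refine lt_of_lt_of_le ?_ h7
  have := norm_pos_iff.2 hx0
  exact (ENNReal.ofReal_lt_ofReal_iff (by positivity)).2 (by nlinarith)

/-! ### Lifting segments through a local diffeomorphism -/

/-- `x` is a lift through `P : U → ℂ` of the path `c` on `[0, s]`, starting at `0`. -/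
structure IsLift (P : ℂ → ℂ) (U : Set ℂ) (c : ℝ → ℂ) (s : ℝ) (x : ℝ → ℂ) : Prop where
  cont : ContinuousOn x (Icc 0 s)
  start : x 0 = 0
  mem : ∀ t ∈ Icc 0 s, x t ∈ U
  lift : ∀ t ∈ Icc 0 s, P (x t) = c t

theorem IsLift.mono {P : ℂ → ℂ} {U : Set ℂ} {c : ℝ → ℂ} {s s' : ℝ} {x : ℝ → ℂ}
    (h : IsLift P U c s x) (hs : s' ≤ s) : IsLift P U c s' x :=
  ⟨h.cont.mono (Icc_subset_Icc_right hs), h.start, fun t ht => h.mem t ⟨ht.1, ht.2.trans hs⟩,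
    fun t ht => h.lift t ⟨ht.1, ht.2.trans hs⟩⟩

theorem exists_equiv_of_norm_le {D : ℂ →L[ℝ] ℂ} {M : ℝ} (h : ∀ d, ‖d‖ ≤ M * ‖D d‖) :
    ∃ D' : ℂ ≃L[ℝ] ℂ, (D' : ℂ →L[ℝ] ℂ) = D := by
  have hinj : Function.Injective (D : ℂ →ₗ[ℝ] ℂ) := by
    refine (injective_iff_map_eq_zero _).2 fun d hd => ?_
    have := h d
    rw [show D d = 0 from hd, norm_zero, mul_zero] at this
    exact norm_le_zero_iff.1 this
  exact ⟨(LinearEquiv.ofInjectiveEndo (D : ℂ →ₗ[ℝ] ℂ) hinj).toContinuousLinearEquiv, rfl⟩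

/-- The coincidence set is closed, and open to the right because `P` is locally injective. -/
theorem IsLift.eqOn {P : ℂ → ℂ} {U : Set ℂ} {c : ℝ → ℂ} {s : ℝ}
    (hP : ∀ x ∈ U, ∃ D : ℂ ≃L[ℝ] ℂ, HasStrictFDerivAt P (D : ℂ →L[ℝ] ℂ) x) {x y : ℝ → ℂ}
    (hx : IsLift P U c s x) (hy : IsLift P U c s y) : EqOn x y (Icc 0 s) := by
  have hcl : IsClosed ({t | x t = y t} ∩ Icc 0 s) := by
    rw [inter_comm]
    exact (hx.cont.prodMk hy.cont).preimage_isClosed_of_isClosed isClosed_Icc isClosed_diagonal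
  have := hcl.Icc_subset_of_forall_mem_nhdsWithin (by simp [hx.start, hy.start]) fun t ht => by
    have htI := Ico_subset_Icc_self ht.2
    obtain ⟨D, hD⟩ := hP _ (hx.mem t htI)
    have hI : Icc 0 s ∈ 𝓝[>] t :=
      mem_of_superset (Ioc_mem_nhdsGT ht.2.2) fun r hr => ⟨ht.2.1.trans hr.1.le, hr.2⟩
    have hl : 𝓝[>] t ≤ 𝓝[Icc 0 s] t := le_inf nhdsWithin_le_nhds (le_principal_iff.2 hI)
    have h1 := (hx.cont t htI).tendsto.mono_left hl
    have h2 := (hy.cont t htI).tendsto.mono_left hl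
    rw [← show x t = y t from ht.1] at h2
    filter_upwards [h1.eventually hD.eventually_left_inverse, h2.eventually hD.eventually_left_inverse,
      hI] with r hr1 hr2 hrI
    rw [← hr1, ← hr2, hx.lift r hrI, hy.lift r hrI]
  exact fun t ht => this ht

/-- The lift has derivative `D⁻¹ w`. The expansion bound is required only over points of the path,
where one constant `M` can serve. -/
theorem IsLift.lipschitz {P : ℂ → ℂ} {U : Set ℂ} {c : ℝ → ℂ} {s M : ℝ} {w : ℂ}
    (hc : ∀ t, HasDerivAt c w t)
    (hP : ∀ x ∈ U, ∃ D : ℂ ≃L[ℝ] ℂ, HasStrictFDerivAt P (D : ℂ →L[ℝ] ℂ) x ∧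
      ∀ t ∈ Icc (0 : ℝ) 1, P x = c t → ∀ d, ‖d‖ ≤ M * ‖D d‖) {x : ℝ → ℂ} (hs : s ≤ 1)
    (hx : IsLift P U c s x) {t t' : ℝ} (ht : t ∈ Icc 0 s) (ht' : t' ∈ Icc 0 s) :
    ‖x t' - x t‖ ≤ M * ‖w‖ * ‖t' - t‖ := by
  have : ∀ r ∈ Icc 0 s, ∃ x', HasDerivWithinAt x x' (Icc 0 s) r ∧ ‖x'‖ ≤ M * ‖w‖ := fun r hr => by
    obtain ⟨D, hD, hDM⟩ := hP _ (hx.mem r hr)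
    refine ⟨D.symm w, ?_, ?_⟩
    · have h1 := hD.to_localInverse.hasFDerivAt
      rw [hx.lift r hr] at h1
      have h2 := h1.comp_hasDerivWithinAt r (hc r).hasDerivWithinAt (s := Icc 0 s)
      refine h2.congr_of_eventuallyEq_of_mem ?_ hr
      filter_upwards [(hx.cont r hr).tendsto.eventually hD.eventually_left_inverse,
        self_mem_nhdsWithin] with q hq hqI
      rw [← hq, hx.lift q hqI]; rfl
    · simpa using hDM r ⟨hr.1, hr.2.trans hs⟩ (hx.lift r hr) (D.symm w)
  choose! x' hx' hb using this
  exact (convex_Icc 0 s).norm_image_sub_le_of_norm_hasDerivWithin_le hx' hb ht ht'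

/-- Continuity method on the set of times up to which a lift exists: the Lipschitz bound produces a
limit, `hlim` keeps it in `U`, and a local inverse of `P` continues past it. -/
theorem exists_isLift {P : ℂ → ℂ} {U : Set ℂ} {c : ℝ → ℂ} {M : ℝ} {w : ℂ} (hU : IsOpen U)
    (h0 : (0 : ℂ) ∈ U) (hc : ∀ t, HasDerivAt c w t) (hc0 : P 0 = c 0)
    (hP : ∀ x ∈ U, ∃ D : ℂ ≃L[ℝ] ℂ, HasStrictFDerivAt P (D : ℂ →L[ℝ] ℂ) x ∧
      ∀ t ∈ Icc (0 : ℝ) 1, P x = c t → ∀ d, ‖d‖ ≤ M * ‖D d‖)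
    (hlim : ∀ (s : ℝ) (x : ℝ → ℂ) (y : ℂ), s ∈ Ioc (0 : ℝ) 1 → (∀ t ∈ Ico 0 s, x t ∈ U ∧ P (x t) = c t) →
      Tendsto x (𝓝[<] s) (𝓝 y) → y ∈ U) :
    ∃ x, IsLift P U c 1 x := by
  have hP' : ∀ x ∈ U, ∃ D : ℂ ≃L[ℝ] ℂ, HasStrictFDerivAt P (D : ℂ →L[ℝ] ℂ) x := fun x hx =>
    let ⟨D, hD, _⟩ := hP x hx; ⟨D, hD⟩
  have hcc : Continuous c := continuous_iff_continuousAt.2 fun t => (hc t).continuousAt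
  set A : Set ℝ := {s | ∃ x, IsLift P U c s x} with hA
  have hAd : ∀ s ∈ A, ∀ t ≤ s, t ∈ A := fun s ⟨x, hx⟩ t ht => ⟨x, hx.mono ht⟩
  have hcl : IsClosed (A ∩ Icc 0 1) := by
    refine isClosed_of_closure_subset fun s hs => ?_
    have hsI : s ∈ Icc (0 : ℝ) 1 := closure_minimal inter_subset_right isClosed_Icc hs
    refine ⟨?_, hsI⟩
    by_cases hex : ∃ a ∈ A, s ≤ a
    · obtain ⟨a, ha, hsa⟩ := hex
      exact hAd a ha s hsa
    push Not at hex
    have hlt : ∀ t < s, t ∈ A := fun t ht => by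
      obtain ⟨a, ha, hat⟩ := mem_closure_iff.1 hs (Ioi t) isOpen_Ioi ht
      exact hAd a hat.1 t (le_of_lt ha)
    have hs0 : 0 < s := by
      rcases eq_or_lt_of_le hsI.1 with h | h
      · exfalso
        obtain ⟨a, ha, haA⟩ := mem_closure_iff.1 hs univ isOpen_univ (mem_univ s)
        exact absurd (hex a haA.1) (by rw [← h]; exact not_lt.2 haA.2.1)
      · exact h
    choose! X hX using fun (a : ℝ) (ha : a ∈ A) => ha
    have hXe : ∀ t t', 0 ≤ t → t ≤ t' → t' < s → X t t = X t' t := fun t t' h1 h2 h3 =>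
      (hX t (hlt t (h2.trans_lt h3))).eqOn hP' ((hX t' (hlt t' h3)).mono h2) ⟨h1, le_rfl⟩
    have hlip : ∀ t t', 0 ≤ t → t ≤ t' → t' < s → ‖X t' t' - X t t‖ ≤ |M| * ‖w‖ * ‖t' - t‖ :=
      fun t t' h1 h2 h3 => by
        rw [hXe t t' h1 h2 h3]
        refine ((hX t' (hlt t' h3)).lipschitz hc hP (h3.le.trans hsI.2) ⟨h1, h2⟩
          ⟨h1.trans h2, le_rfl⟩).trans ?_
        gcongr
        exact le_abs_self M
    have hL : LipschitzOnWith ⟨|M| * ‖w‖, by positivity⟩ (fun t => X t t) (Ico 0 s) := by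
      refine LipschitzOnWith.of_dist_le_mul fun t ht t' ht' => ?_
      rcases le_total t t' with h | h
      · rw [dist_comm, dist_comm t t', dist_eq_norm, dist_eq_norm]
        exact hlip t t' ht.1 h ht'.2
      · rw [dist_eq_norm, dist_eq_norm]
        exact hlip t' t ht'.1 h ht.2
    -- By uniqueness the diagonal `t ↦ X t t` glues all partial lifts; extending this Lipschitz map
    -- to the line supplies the missing value at `s`.
    obtain ⟨g, hg, hge⟩ := hL.extend_finite_dimension
    have hgc : Continuous g := hg.continuous
    have hgX : ∀ t ∈ Ico 0 s, g t ∈ U ∧ P (g t) = c t := fun t ht => by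
      rw [← hge ht]
      have := hX t (hlt t ht.2)
      exact ⟨this.mem t ⟨ht.1, le_rfl⟩, this.lift t ⟨ht.1, le_rfl⟩⟩
    have hgs : Tendsto g (𝓝[<] s) (𝓝 (g s)) := hgc.continuousAt.tendsto.mono_left nhdsWithin_le_nhds
    have hgsU : g s ∈ U := hlim s g (g s) ⟨hs0, hsI.2⟩ hgX hgs
    refine ⟨g, hgc.continuousOn, ?_, fun t ht => ?_, fun t ht => ?_⟩
    · rw [← hge ⟨le_rfl, hs0⟩]; exact (hX 0 (hlt 0 hs0)).start
    · rcases eq_or_lt_of_le ht.2 with rfl | h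
      · exact hgsU
      · exact (hgX t ⟨ht.1, h⟩).1
    · rcases eq_or_lt_of_le ht.2 with rfl | h
      · obtain ⟨D, hD⟩ := hP' _ hgsU
        have h1 : Tendsto (fun r => P (g r)) (𝓝[<] t) (𝓝 (P (g t))) := hD.continuousAt.tendsto.comp hgs
        have h2 : Tendsto c (𝓝[<] t) (𝓝 (c t)) := hcc.continuousAt.tendsto.mono_left nhdsWithin_le_nhds
        refine tendsto_nhds_unique (h1.congr' ?_) h2
        filter_upwards [Ioo_mem_nhdsLT hs0] with r hr using (hgX r ⟨hr.1.le, hr.2⟩).2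
      · exact (hgX t ⟨ht.1, h⟩).2
  have hall := hcl.Icc_subset_of_forall_mem_nhdsWithin
    (show (0 : ℝ) ∈ A from ⟨fun _ => 0, continuousOn_const, rfl, fun _ _ => h0, fun t ht => by
      have : t = 0 := le_antisymm ht.2 ht.1
      rw [this, hc0]⟩) fun s hs => by
    obtain ⟨x, hx⟩ := hs.1
    have hss : s ∈ Icc 0 s := ⟨hs.2.1, le_rfl⟩
    obtain ⟨D, hD⟩ := hP' _ (hx.mem s hss)
    set e := hD.toOpenPartialHomeomorph P with he
    have hxs : x s ∈ e.source := hD.mem_toOpenPartialHomeomorph_source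
    have hPe : ∀ y, e y = P y := fun y => by rw [he, hD.toOpenPartialHomeomorph_coe]
    have hV : IsOpen (c ⁻¹' (e.target ∩ e.symm ⁻¹' U)) :=
      (e.symm.isOpen_inter_preimage hU).preimage hcc
    have hsV : s ∈ c ⁻¹' (e.target ∩ e.symm ⁻¹' U) := by
      have : c s = e (x s) := by rw [hPe, hx.lift s hss]
      refine ⟨?_, ?_⟩
      · rw [this]; exact e.map_source hxs
      · rw [mem_preimage, this, e.left_inv hxs]; exact hx.mem s hss
    obtain ⟨η, hη, hηV⟩ := Metric.isOpen_iff.1 hV s hsV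
    have hm : Ioo s (s + η) ∈ 𝓝[>] s := Ioo_mem_nhdsGT (by linarith)
    filter_upwards [hm] with r hr
    have hV' : ∀ t ∈ Icc s r, t ∈ c ⁻¹' (e.target ∩ e.symm ⁻¹' U) := fun t ht => hηV (by
      rw [mem_ball, Real.dist_eq, abs_of_nonneg (by linarith [ht.1])]; linarith [ht.2, hr.2])
    set y : ℝ → ℂ := fun t => if t ≤ s then x t else e.symm (c t) with hy
    have e1 : EqOn y x (Icc 0 s) := fun t ht => by simp [hy, ht.2]
    have e2 : EqOn y (fun t => e.symm (c t)) (Icc s r) := fun t ht => by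
      rcases eq_or_lt_of_le ht.1 with rfl | h
      · have : c s = e (x s) := by rw [hPe, hx.lift s hss]
        simp [hy, this, e.left_inv hxs]
      · simp [hy, not_le.2 h]
    have hun : Icc 0 r = Icc 0 s ∪ Icc s r := (Icc_union_Icc_eq_Icc hs.2.1 hr.1.le).symm
    refine ⟨y, ?_, ?_, fun t ht => ?_, fun t ht => ?_⟩
    · rw [hun]
      refine ContinuousOn.union_of_isClosed (hx.cont.congr e1) (ContinuousOn.congr ?_ e2)
        isClosed_Icc isClosed_Icc
      exact e.continuousOn_symm.comp hcc.continuousOn fun t ht => (hV' t ht).1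
    · rw [e1 ⟨le_rfl, hs.2.1⟩, hx.start]
    · rw [hun] at ht
      rcases ht with ht | ht
      · rw [e1 ht]; exact hx.mem t ht
      · rw [e2 ht]; exact (hV' t ht).2
    · rw [hun] at ht
      rcases ht with ht | ht
      · rw [e1 ht]; exact hx.lift t ht
      · rw [e2 ht, ← hPe]; exact e.right_inv (hV' t ht).1
  exact hall ⟨zero_le_one, le_rfl⟩

theorem expMap_localEquiv {ρ : ℂ → ℝ} (hρ : ContDiffOn ℝ ∞ ρ (ball 0 1))
    (hcurv : ∀ z ∈ ball (0 : ℂ) 1, 0 ≤ dzdzbar ρ z) {z₀ x : ℂ} (hx : x ∈ expDomain ρ z₀) :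
    ∃ D : ℂ ≃L[ℝ] ℂ, HasStrictFDerivAt (expMap ρ z₀) (D : ℂ →L[ℝ] ℂ) x ∧
      ∀ d, ‖d‖ ≤ Real.exp (ρ (expMap ρ z₀ x)) * ‖D d‖ := by
  obtain ⟨D, hD, hDM⟩ := (expDomain_mem_nhds_and_hasStrictFDerivAt hρ hcurv hx).2
  obtain ⟨D', rfl⟩ := exists_equiv_of_norm_le hDM
  exact ⟨D', hD, hDM⟩

theorem segment_mem_ball {z₀ p : ℂ} (hz₀ : z₀ ∈ ball (0 : ℂ) 1) (hp : p ∈ ball (0 : ℂ) 1) {t : ℝ}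
    (ht : t ∈ Icc (0 : ℝ) 1) : z₀ + t * (p - z₀) ∈ ball (0 : ℂ) 1 := by
  have := (convex_ball (0 : ℂ) 1).add_smul_sub_mem hz₀ hp ht
  simpa using this

/-- The expansion constant is a bound for `e^ρ` on the compact segment, and limits of partial lifts
stay in the domain by `IsPolarSystem.mem_expDomain_of_tendsto`. -/
theorem IsPolarSystem.exists_segment_lift {ρ : ℂ → ℝ} (hρ : ContDiffOn ℝ ∞ ρ (ball 0 1))
    (hcurv : ∀ z ∈ ball (0 : ℂ) 1, 0 ≤ dzdzbar ρ z) {z₀ : ℂ} {len : Circle → ℝ≥0∞}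
    {E : Circle → Circle} (hP : IsPolarSystem ρ z₀ len E) {p : ℂ} (hp : p ∈ ball (0 : ℂ) 1) :
    ∃ x, IsLift (expMap ρ z₀) (expDomain ρ z₀) (fun t => z₀ + t * (p - z₀)) 1 x := by
  have hc : ∀ t : ℝ, HasDerivAt (fun t : ℝ => z₀ + t * (p - z₀)) (p - z₀) t := fun t => by
    have := ((hasDerivAt_id t).ofReal_comp.mul_const (p - z₀)).const_add z₀
    simpa using this
  have hm : ∀ t ∈ Icc (0 : ℝ) 1, z₀ + t * (p - z₀) ∈ ball (0 : ℂ) 1 := fun t ht =>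
    segment_mem_ball hP.base_mem hp ht
  obtain ⟨M, hM⟩ := isCompact_Icc.exists_bound_of_continuousOn
    (f := fun t : ℝ => Real.exp (ρ (z₀ + t * (p - z₀)))) (s := Icc (0 : ℝ) 1)
    (Real.continuous_exp.comp_continuousOn (hρ.continuousOn.comp (by fun_prop) hm))
  refine exists_isLift (M := M) (isOpen_expDomain hρ hcurv z₀) (zero_mem_expDomain hP.base_mem) hc
    (by simp [expMap_zero hρ hP.base_mem]) (fun x hx => ?_) (fun s x y hs hx hxy => ?_)
  · obtain ⟨D, hD, hDM⟩ := expMap_localEquiv hρ hcurv hx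
    refine ⟨D, hD, fun t ht htx d => (hDM d).trans ?_⟩
    rw [htx]
    gcongr
    exact (le_abs_self _).trans (hM t ht)
  · have hev : ∀ᶠ t in 𝓝[<] s, t ∈ Ico 0 s := by
      filter_upwards [Ioo_mem_nhdsLT hs.1] with t ht using ⟨ht.1.le, ht.2⟩
    refine hP.mem_expDomain_of_tendsto hρ (l := 𝓝[<] s) (X := x) (p := z₀ + s * (p - z₀))
      (hev.mono fun t ht => (hx t ht).1) hxy (hm s ⟨hs.1.le, hs.2⟩) ?_
    refine Tendsto.congr' (hev.mono fun t ht => (hx t ht).2.symm) ?_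
    exact (hc s).continuousAt.tendsto.mono_left nhdsWithin_le_nhds

/-- The exponential map is a homeomorphism onto the disk. -/
theorem IsPolarSystem.exists_inverse {ρ : ℂ → ℝ} (hρ : ContDiffOn ℝ ∞ ρ (ball 0 1))
    (hcurv : ∀ z ∈ ball (0 : ℂ) 1, 0 ≤ dzdzbar ρ z) {z₀ : ℂ} {len : Circle → ℝ≥0∞}
    {E : Circle → Circle} (hP : IsPolarSystem ρ z₀ len E) :
    ∃ S : ℂ → ℂ, ContinuousOn S (ball 0 1) ∧
      (∀ p ∈ ball (0 : ℂ) 1, S p ∈ expDomain ρ z₀ ∧ expMap ρ z₀ (S p) = p) ∧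
      ∀ x ∈ expDomain ρ z₀, S (expMap ρ z₀ x) = x := by
  have hloc : ∀ x ∈ expDomain ρ z₀, ∃ D : ℂ ≃L[ℝ] ℂ,
      HasStrictFDerivAt (expMap ρ z₀) (D : ℂ →L[ℝ] ℂ) x := fun x hx =>
    let ⟨D, hD, _⟩ := expMap_localEquiv hρ hcurv hx; ⟨D, hD⟩
  choose! X hX using fun p (hp : p ∈ ball (0 : ℂ) 1) => hP.exists_segment_lift hρ hcurv hp
  have i1 : (1 : ℝ) ∈ Icc (0 : ℝ) 1 := ⟨zero_le_one, le_rfl⟩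
  have hS1 : ∀ p ∈ ball (0 : ℂ) 1, X p 1 ∈ expDomain ρ z₀ ∧ expMap ρ z₀ (X p 1) = p := fun p hp =>
    ⟨(hX p hp).mem 1 i1, by rw [(hX p hp).lift 1 i1]; simp⟩
  -- Continuity of the lifts of `z₀ + t (p - z₀)` jointly in `(t, p)` is homotopy lifting for a
  -- local homeomorphism; it is then restricted to `t = 1`.
  have hcont : ContinuousOn (fun p => X p 1) (ball 0 1) := by
    have hopen := isOpen_expDomain hρ hcurv z₀
    set pr : expDomain ρ z₀ → ℂ := fun x => expMap ρ z₀ x with hpr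
    have hlh : IsLocalHomeomorph pr := by
      have h1 : IsLocalHomeomorphOn (expMap ρ z₀) (expDomain ρ z₀) := by
        intro x hx
        obtain ⟨D, hD⟩ := hloc x hx
        exact ⟨hD.toOpenPartialHomeomorph _, hD.mem_toOpenPartialHomeomorph_source,
          (hD.toOpenPartialHomeomorph_coe).symm⟩
      rw [isLocalHomeomorph_iff_isLocalHomeomorphOn_univ]
      exact h1.comp hopen.isOpenEmbedding_subtypeVal.isLocalHomeomorph.isLocalHomeomorphOn
        fun x _ => x.2
    set f : C(unitInterval × ball (0 : ℂ) 1, ℂ) :=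
      ⟨fun q => z₀ + (q.1 : ℝ) * ((q.2 : ℂ) - z₀), by fun_prop⟩ with hf
    set g : unitInterval × ball (0 : ℂ) 1 → expDomain ρ z₀ :=
      fun q => ⟨X q.2 q.1, (hX q.2 q.2.2).mem q.1 q.1.2⟩ with hg
    have hgc : Continuous g := by
      refine hlh.continuous_lift (T2Space.isSeparatedMap pr) f ?_ ?_ fun a => ?_
      · ext q
        exact (hX q.2 q.2.2).lift q.1 q.1.2
      · have : (fun a : ball (0 : ℂ) 1 => g (0, a)) = fun _ => ⟨0, zero_mem_expDomain hP.base_mem⟩ := by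
          ext a
          exact (hX a a.2).start
        rw [this]; exact continuous_const
      · refine Continuous.subtype_mk ?_ _
        exact (hX a a.2).cont.comp_continuous continuous_subtype_val fun t => t.2
    rw [continuousOn_iff_continuous_domRestrict]
    have : (ball (0 : ℂ) 1).domRestrict (fun p => X p 1) = fun a => (g (1, a) : ℂ) := by
      ext a; simp [hg]
    rw [this]
    exact continuous_subtype_val.comp (hgc.comp (by fun_prop))
  refine ⟨fun p => X p 1, hcont, hS1, fun x hx => ?_⟩
  have hseg : ∀ t ∈ Icc (0 : ℝ) 1, (t * x : ℂ) ∈ expDomain ρ z₀ := fun t ht =>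
    (ofReal_mul_mem_expDomain hρ hx ht).1
  have hPc : ContinuousOn (fun t : ℝ => expMap ρ z₀ (t * x)) (Icc 0 1) :=
    (continuousOn_expMap hρ hcurv z₀).comp (by fun_prop) hseg
  have hSc : ContinuousOn (fun t : ℝ => X (expMap ρ z₀ (t * x)) 1) (Icc 0 1) :=
    hcont.comp hPc fun t ht => expMap_mem (hseg t ht)
  -- The left inverse identity holds at `t = 0` on the radius `t x`, and the set where it holds is
  -- closed, and open to the right by local injectivity.
  have hcl : IsClosed ({t : ℝ | X (expMap ρ z₀ (t * x)) 1 = t * x} ∩ Icc 0 1) := by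
    rw [inter_comm]
    exact (hSc.prodMk (by fun_prop : ContinuousOn (fun t : ℝ => (t * x : ℂ)) (Icc 0 1))).preimage_isClosed_of_isClosed
      isClosed_Icc isClosed_diagonal
  have h0 : X z₀ 1 = 0 := by
    have h1 : IsLift (expMap ρ z₀) (expDomain ρ z₀) (fun t => z₀ + t * (z₀ - z₀)) 1 fun _ => 0 :=
      ⟨continuousOn_const, rfl, fun _ _ => zero_mem_expDomain hP.base_mem, fun t _ => by
        simp [expMap_zero hρ hP.base_mem]⟩
    exact (hX z₀ hP.base_mem).eqOn hloc h1 i1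
  have := hcl.Icc_subset_of_forall_mem_nhdsWithin
    (by simp [expMap_zero hρ hP.base_mem, h0]) fun t ht => by
    have htI := Ico_subset_Icc_self ht.2
    have hI : Icc 0 1 ∈ 𝓝[>] t :=
      mem_of_superset (Ioc_mem_nhdsGT ht.2.2) fun r hr => ⟨ht.2.1.trans hr.1.le, hr.2⟩
    have hl : 𝓝[>] t ≤ 𝓝[Icc 0 1] t := le_inf nhdsWithin_le_nhds (le_principal_iff.2 hI)
    obtain ⟨D, hD⟩ := hloc _ (hseg t htI)
    have h1 := (hSc t htI).tendsto.mono_left hl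
    have h2 : Tendsto (fun t : ℝ => (t * x : ℂ)) (𝓝[>] t) (𝓝 (t * x)) :=
      (Continuous.tendsto (by fun_prop) t).mono_left nhdsWithin_le_nhds
    rw [show X (expMap ρ z₀ (t * x)) 1 = t * x from ht.1] at h1
    filter_upwards [h1.eventually hD.eventually_left_inverse, h2.eventually hD.eventually_left_inverse,
      hI] with r hr1 hr2 hrI
    rw [← hr1, (hS1 _ (expMap_mem (hseg r hrI))).2, hr2]
  simpa using this i1

theorem IsPolarSystem.injOn {ρ : ℂ → ℝ} (hρ : ContDiffOn ℝ ∞ ρ (ball 0 1))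
    (hcurv : ∀ z ∈ ball (0 : ℂ) 1, 0 ≤ dzdzbar ρ z) {z₀ : ℂ} {len : Circle → ℝ≥0∞}
    {E : Circle → Circle} (hP : IsPolarSystem ρ z₀ len E) :
    InjOn (expMap ρ z₀) (expDomain ρ z₀) := by
  obtain ⟨S, -, -, hS⟩ := hP.exists_inverse hρ hcurv
  exact fun x hx y hy h => by rw [← hS x hx, ← hS y hy, h]

/-! ### The lengths of geodesic rays -/

theorem exists_unit_direction {ρ : ℂ → ℝ} {γ v : ℝ → ℂ} {s : Set ℝ} (h : IsGeodesicOn ρ s γ v)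
    (h0 : (0 : ℝ) ∈ s) : ∃ u : Circle, v 0 = Real.exp (-ρ (γ 0)) * u := by
  have h1 := h.unit_speed 0 h0
  have hv : v 0 ≠ 0 := by
    intro h2; rw [h2] at h1; simp at h1
  refine ⟨direction (v 0), ?_⟩
  have h3 : ‖v 0‖ = Real.exp (-ρ (γ 0)) := by
    rw [Real.exp_neg]; field_simp; linarith
  rw [← h3, norm_mul_direction]

/-- Any point of the ray is also reached by a geodesic shorter than `δ`, and injectivity of the
exponential map forces the two parameters to agree. -/
theorem IsPolarSystem.len_le {ρ : ℂ → ℝ} (hρ : ContDiffOn ℝ ∞ ρ (ball 0 1))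
    (hcurv : ∀ z ∈ ball (0 : ℂ) 1, 0 ≤ dzdzbar ρ z) {z₀ : ℂ} {len : Circle → ℝ≥0∞}
    {E : Circle → Circle} (hP : IsPolarSystem ρ z₀ len E) {δ : ℝ≥0∞}
    (hjoin : JoinedByGeodesicsShorterThan ρ δ) (u : Circle) : len u ≤ δ := by
  refine le_of_forall_lt fun a ha => ?_
  have hat : ENNReal.ofReal a.toReal = a := ENNReal.ofReal_toReal ha.ne_top
  set t := a.toReal with ht
  have ht0 : 0 ≤ t := ENNReal.toReal_nonneg
  have hmem : (t * u : ℂ) ∈ expDomain ρ z₀ := (hP.mem_iff u t ht0).2 (by rwa [hat])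
  obtain ⟨L, γ, v, hL, hLδ, hg, h0, h1⟩ := hjoin z₀ hP.base_mem _ (expMap_mem hmem)
  obtain ⟨u', hu'⟩ := exists_unit_direction hg ⟨le_rfl, hL⟩
  rw [h0] at hu'
  obtain ⟨h2, h3⟩ := hg.expMap_eq hρ h0 hu' ⟨hL, le_rfl⟩
  have h4 := hP.injOn hρ hcurv h2 hmem (h3.trans h1)
  have h5 := congrArg norm h4
  simp only [norm_mul, norm_real, Real.norm_eq_abs, Circle.norm_coe, mul_one, abs_of_nonneg hL,
    abs_of_nonneg ht0] at h5
  rw [← hat, ← h5]; exact hLδ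

theorem SolvesOn.reverse {ρ : ℂ → ℝ} {y : ℂ × ℂ} {s : ℝ} {α : ℝ → ℂ × ℂ}
    (h : SolvesOn (geodesicField ρ) phaseSpace y s α) :
    SolvesOn (geodesicField ρ) phaseSpace ((α s).1, -(α s).2) s
      fun t => ((α (s - t)).1, -(α (s - t)).2) := by
  have hm : MapsTo (fun t => s - t) (Icc 0 s) (Icc 0 s) := fun t ht =>
    ⟨by linarith [ht.2], by linarith [ht.1]⟩
  have hd : ∀ t, HasDerivWithinAt (fun t : ℝ => s - t) (-1) (Icc 0 s) t := fun t => by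
    simpa using (hasDerivWithinAt_id t (Icc 0 s)).const_sub s
  refine solvesOn_of_components (by simp) (by simp) (fun t ht => (h.mem _ (hm ht)).1)
    (fun t ht => ?_) (fun t ht => ?_)
  · have := (h.hasDerivWithinAt_fst (hm ht)).scomp t (hd t) hm
    simpa [Function.comp_def] using this
  · have := ((h.hasDerivWithinAt_snd (hm ht)).scomp t (hd t) hm).neg
    refine this.congr_deriv ?_
    simp

/-- Geodesic rays can be extended backwards, so they are strictly shorter than `δ`. -/
theorem IsPolarSystem.len_lt {ρ : ℂ → ℝ} (hρ : ContDiffOn ℝ ∞ ρ (ball 0 1))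
    (hcurv : ∀ z ∈ ball (0 : ℂ) 1, 0 ≤ dzdzbar ρ z) {δ : ℝ≥0∞}
    (hjoin : JoinedByGeodesicsShorterThan ρ δ) (hδ : δ ≠ ⊤)
    (hall : ∀ z ∈ ball (0 : ℂ) 1, ∃ len E, IsPolarSystem ρ z len E)
    {z₀ : ℂ} {len : Circle → ℝ≥0∞} {E : Circle → Circle} (hP : IsPolarSystem ρ z₀ len E)
    (u : Circle) : len u < δ := by
  -- After a step of length `s` back to `z₁`, the ray from `z₁` through `z₀` has length at least `s
  -- + len u`, and at most `δ`. This needs a polar system at `z₁`, hence at every base point.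
  obtain ⟨s, hs, hsm⟩ : ∃ s : ℝ, 0 < s ∧ (s * (-u : ℂ)) ∈ expDomain ρ z₀ := by
    have hc : Tendsto (fun s : ℝ => (s * (-u : ℂ))) (𝓝 0) (𝓝 ((0 : ℝ) * (-u : ℂ))) :=
      Continuous.tendsto (by fun_prop) 0
    rw [ofReal_zero, zero_mul] at hc
    have h1 := hc.eventually ((isOpen_expDomain hρ hcurv z₀).mem_nhds (zero_mem_expDomain hP.base_mem))
    obtain ⟨s, hs1, hs2⟩ := ((h1.filter_mono nhdsWithin_le_nhds).and
      (self_mem_nhdsWithin (a := (0 : ℝ)) (s := Ioi 0))).exists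
    exact ⟨s, hs2, hs1⟩
  have hback := (solvesOn_ray hρ hs hsm).reverse
  set z₁ := expMap ρ z₀ (s * (-u : ℂ)) with hz₁
  set w := rayVelocity ρ z₀ (-u) s with hw
  obtain ⟨len₁, E₁, hP₁⟩ := hall z₁ (expMap_mem hsm)
  have hspeed := (isGeodesicOn_ray hρ (u := (-u : ℂ)) (by rw [norm_neg]; exact u.norm_coe) hs hsm).unit_speed s ⟨hs.le, le_rfl⟩
  have hw0 : -w ≠ 0 := by
    intro h0
    rw [neg_eq_zero] at h0
    rw [← hw, h0] at hspeed
    simp at hspeed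
  have hww : -w = Real.exp (-ρ z₁) * direction (-w) := by
    have h3 : ‖-w‖ = Real.exp (-ρ z₁) := by
      rw [norm_neg, Real.exp_neg]; field_simp; linarith
    rw [← h3, norm_mul_direction]
  have key : ∀ t : ℝ, 0 < t → ENNReal.ofReal t < len u → ENNReal.ofReal (s + t) < len₁ (direction (-w)) := by
    intro t ht htl
    have hfor := solvesOn_ray hρ ht ((hP.mem_iff u t ht.le).2 htl)
    have hend : ((expMap ρ z₀ (((s - s : ℝ) : ℂ) * (-u : ℂ))), -rayVelocity ρ z₀ (-u) (s - s)) =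
        (z₀, Real.exp (-ρ z₀) * (u : ℂ)) := by
      simp [expMap_zero hρ hP.base_mem, rayVelocity]
    have h5 := hback.append hs.le ht.le (r := t) (by rw [hend]; exact hfor)
    have h5' : ∃ α, SolvesOn (geodesicField ρ) phaseSpace
        (z₁, Real.exp (-ρ z₁) * (direction (-w) : ℂ)) (s + t) α := by
      rw [← hww]
      exact ⟨_, h5⟩
    obtain ⟨α, h5'⟩ := h5'
    have h6 := (h5'.mem_expDomain hρ (by positivity)).1
    exact (hP₁.mem_iff _ _ (by positivity)).1 h6
  have hle := hP₁.len_le hρ hcurv hjoin (direction (-w))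
  have hlen : len u ≤ δ := hP.len_le hρ hcurv hjoin u
  have hpos : 0 < len u := by
    have := (hP.mem_iff u 0 le_rfl).1 (by simpa using zero_mem_expDomain hP.base_mem)
    simpa using this
  have hsum : ENNReal.ofReal s + len u ≤ δ := by
    by_contra! hcon
    have h7 : δ - ENNReal.ofReal s < len u := ENNReal.sub_lt_of_lt_add
      (by
        have := key _ (ENNReal.toReal_pos (ENNReal.half_pos hpos.ne').ne'
          (ENNReal.div_ne_top (ne_top_of_le_ne_top hδ hlen) two_ne_zero))
          (by rw [ENNReal.ofReal_toReal (ENNReal.div_ne_top (ne_top_of_le_ne_top hδ hlen) two_ne_zero)]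
              exact ENNReal.half_lt_self hpos.ne' (ne_top_of_le_ne_top hδ hlen))
        refine le_trans ?_ (this.le.trans hle)
        exact ENNReal.ofReal_le_ofReal (by linarith [ENNReal.toReal_nonneg (a := len u / 2)])) (by rwa [add_comm])
    obtain ⟨a, ha1, ha2⟩ := exists_between h7
    have ha0 : 0 < a := (zero_le (a := δ - ENNReal.ofReal s)).trans_lt ha1
    have hat : a ≠ ⊤ := ha2.ne_top
    have h8 := key a.toReal (ENNReal.toReal_pos ha0.ne' hat) (by rwa [ENNReal.ofReal_toReal hat])
    rw [ENNReal.ofReal_add hs.le ENNReal.toReal_nonneg, ENNReal.ofReal_toReal hat] at h8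
    have h9 := h8.trans_le hle
    have h10 : δ < ENNReal.ofReal s + a := by
      rw [add_comm]
      exact (ENNReal.sub_lt_iff_lt_right ENNReal.ofReal_ne_top (by
        by_contra! hc
        exact absurd (h9.trans hc) (by simp))).1 ha1
    exact lt_asymm h9 h10
  refine lt_of_lt_of_le ?_ hsum
  rw [add_comm]
  exact ENNReal.lt_add_right (ne_top_of_le_ne_top hδ hlen) (by simpa using hs)

/-! ### Curves and their inversions -/

section Curve

variable {H : Type*} [NormedAddCommGroup H] [InnerProductSpace ℝ H]

/-- Completing the square: the difference of the two sides is `‖τ‖² / ‖x‖²` times the squared norm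
of `(‖x‖² / (2 ‖τ‖²)) n` plus the part of `x` orthogonal to `τ`. -/
theorem neg_sq_div_le_of_orthogonal {n τ x : H} (hn : ⟪τ, n⟫_ℝ = 0) (hτ : τ ≠ 0) (hx : x ≠ 0) :
    -(‖n‖ ^ 2 * ‖x‖ ^ 2 / (4 * ‖τ‖ ^ 2)) ≤ ⟪n, x⟫_ℝ + ‖τ‖ ^ 2 - ⟪τ, x⟫_ℝ ^ 2 / ‖x‖ ^ 2 := by
  have hτ' : 0 < ‖τ‖ ^ 2 := by positivity
  have hx' : 0 < ‖x‖ ^ 2 := by positivity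
  have h1 : 0 ≤ ‖(‖x‖ ^ 2 / (2 * ‖τ‖ ^ 2)) • n + x - (⟪τ, x⟫_ℝ / ‖τ‖ ^ 2) • τ‖ ^ 2 := by positivity
  rw [← real_inner_self_eq_norm_sq] at h1
  have hn' : ⟪n, τ⟫_ℝ = 0 := by rw [real_inner_comm]; exact hn
  simp only [inner_sub_left, inner_sub_right, inner_add_left, inner_add_right, inner_smul_left,
    inner_smul_right, hn, hn', real_inner_self_eq_norm_sq, conj_trivial, real_inner_comm n x,
    real_inner_comm τ x] at h1
  have h2 := mul_nonneg (div_pos hτ' hx').le h1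
  rw [← sub_nonneg]
  refine h2.trans_eq ?_
  field_simp
  ring

/-- Differentiating `‖φ'‖² = V⁻⁴` shows that `2 (V'/V) φ'` cancels the tangential part of `φ''`. -/
theorem inner_eq_zero_of_speed {φ1 φ2 : ℝ → H} {V V1 : ℝ → ℝ} {s t : ℝ} (hs : 0 < s)
    (ht : t ∈ Icc 0 s) (hφ1 : HasDerivWithinAt φ1 (φ2 t) (Icc 0 s) t)
    (hV : HasDerivWithinAt V (V1 t) (Icc 0 s) t) (hpos : 0 < V t)
    (hspeed : ∀ t ∈ Icc 0 s, ‖φ1 t‖ = (V t ^ 2)⁻¹) :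
    ⟪φ1 t, φ2 t + (2 * (V1 t / V t)) • φ1 t⟫_ℝ = 0 := by
  have h1 := hφ1.norm_sq
  have h2 : HasDerivWithinAt (fun t => ‖φ1 t‖ ^ 2)
      (-(((4 : ℕ) : ℝ) * V t ^ 3 * V1 t) / (V t ^ 4) ^ 2) (Icc 0 s) t := by
    refine (((hV.pow 4).inv (pow_pos hpos 4).ne').congr_of_mem (fun r hr => ?_) ht)
    simp only [hspeed r hr, Pi.inv_apply, Pi.pow_apply]
    rw [inv_pow, ← pow_mul]
  have h3 := (uniqueDiffOn_Icc hs t ht).eq_deriv _ h1 h2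
  rw [inner_add_right, inner_smul_right, real_inner_self_eq_norm_sq, hspeed t ht]
  push_cast at h3
  have h4 : ⟪φ1 t, φ2 t⟫_ℝ = -(4 * V t ^ 3 * V1 t) / (V t ^ 4) ^ 2 / 2 := by linarith
  rw [h4]
  field_simp
  ring

/-- A curve of speed `V⁻²` in Euclidean space, together with two derivatives of the curve and
of `V`, satisfying the second order differential inequality that makes `V ‖φ - p‖` a supersolution
of `u'' = - c u` for each point `p`. -/
structure IsControlledCurve (c s : ℝ) (φ φ1 φ2 : ℝ → H) (V V1 V2 : ℝ → ℝ) : Prop where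
  deriv : ∀ t ∈ Icc 0 s, HasDerivWithinAt φ (φ1 t) (Icc 0 s) t
  deriv_two : ∀ t ∈ Icc 0 s, HasDerivWithinAt φ1 (φ2 t) (Icc 0 s) t
  factor_deriv : ∀ t ∈ Icc 0 s, HasDerivWithinAt V (V1 t) (Icc 0 s) t
  factor_deriv_two : ∀ t ∈ Icc 0 s, HasDerivWithinAt V1 (V2 t) (Icc 0 s) t
  factor_pos : ∀ t ∈ Icc 0 s, 0 < V t
  speed : ∀ t ∈ Icc 0 s, ‖φ1 t‖ = (V t ^ 2)⁻¹
  lower_bound : ∀ t ∈ Icc 0 s,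
    -c ≤ V2 t / V t - ‖φ2 t + (2 * (V1 t / V t)) • φ1 t‖ ^ 2 * V t ^ 4 / 4

theorem IsControlledCurve.mono {c s s' : ℝ} {φ φ1 φ2 : ℝ → H} {V V1 V2 : ℝ → ℝ}
    (h : IsControlledCurve c s φ φ1 φ2 V V1 V2) (hs : s' ≤ s) :
    IsControlledCurve c s' φ φ1 φ2 V V1 V2 := by
  have hsub : Icc 0 s' ⊆ Icc 0 s := Icc_subset_Icc_right hs
  exact ⟨fun t ht => (h.deriv t (hsub ht)).mono hsub, fun t ht => (h.deriv_two t (hsub ht)).mono hsub,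
    fun t ht => (h.factor_deriv t (hsub ht)).mono hsub,
    fun t ht => (h.factor_deriv_two t (hsub ht)).mono hsub, fun t ht => h.factor_pos t (hsub ht),
    fun t ht => h.speed t (hsub ht), fun t ht => h.lower_bound t (hsub ht)⟩

/-- Sturm comparison for `U = V ‖φ - p‖`. With `n = φ'' + 2 (V'/V) φ'` and `τ = φ'`, the quotient
`U''/U` is `V''/V` plus `‖φ - p‖⁻²` times the right-hand side of `neg_sq_div_le_of_orthogonal`,
hence at least `-c`. So the Wronskian `U' y - U y'` is nondecreasing; it starts nonnegative by
`hinit`, and `U / y` is nondecreasing. -/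
theorem IsControlledCurve.le_of_ne {c s : ℝ} {φ φ1 φ2 : ℝ → H} {V V1 V2 : ℝ → ℝ}
    (h : IsControlledCurve c s φ φ1 φ2 V V1 V2) (hs : 0 < s) {p : H} {y y1 : ℝ → ℝ}
    (hy : ∀ t ∈ Icc 0 s, HasDerivWithinAt y (y1 t) (Icc 0 s) t)
    (hy1 : ∀ t ∈ Icc 0 s, HasDerivWithinAt y1 (-c * y t) (Icc 0 s) t)
    (hypos : ∀ t ∈ Icc 0 s, 0 < y t)
    (hp : ∀ t ∈ Icc 0 s, φ t ≠ p)
    (hinit : y1 0 / y 0 ≤ V1 0 / V 0 + ⟪φ1 0, φ 0 - p⟫_ℝ / ‖φ 0 - p‖ ^ 2) :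
    ∀ t ∈ Icc 0 s, V 0 * ‖φ 0 - p‖ / y 0 * y t ≤ V t * ‖φ t - p‖ := by
  have h0 : (0 : ℝ) ∈ Icc 0 s := ⟨le_rfl, hs.le⟩
  have hRpos : ∀ t ∈ Icc 0 s, 0 < ‖φ t - p‖ := fun t ht => norm_pos_iff.2 (sub_ne_zero.2 (hp t ht))
  have hR : ∀ t ∈ Icc 0 s, HasDerivWithinAt (fun t => ‖φ t - p‖)
      (⟪φ1 t, φ t - p⟫_ℝ / ‖φ t - p‖) (Icc 0 s) t := by
    intro t ht
    have h1 := (((h.deriv t ht).sub_const p).norm_sq).sqrt (by simpa using (hRpos t ht).ne')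
    refine (h1.congr_of_mem (fun r hr => ?_) ht).congr_deriv ?_
    · rw [Real.sqrt_sq (norm_nonneg _)]
    · rw [Real.sqrt_sq (norm_nonneg _), real_inner_comm]
      field_simp
  have hB : ∀ t ∈ Icc 0 s, HasDerivWithinAt (fun t => ⟪φ1 t, φ t - p⟫_ℝ)
      (⟪φ1 t, φ1 t⟫_ℝ + ⟪φ2 t, φ t - p⟫_ℝ) (Icc 0 s) t := fun t ht =>
    (h.deriv_two t ht).inner ℝ ((h.deriv t ht).sub_const p)
  set U : ℝ → ℝ := fun t => V t * ‖φ t - p‖ with hU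
  set U1 : ℝ → ℝ := fun t => V1 t * ‖φ t - p‖ + V t * (⟪φ1 t, φ t - p⟫_ℝ / ‖φ t - p‖) with hU1
  have hdU : ∀ t ∈ Icc 0 s, HasDerivWithinAt U (U1 t) (Icc 0 s) t := fun t ht =>
    (h.factor_deriv t ht).mul (hR t ht)
  have hdw : ∀ t ∈ Icc 0 s, ∃ d, 0 ≤ d ∧
      HasDerivWithinAt (fun t => U1 t * y t - U t * y1 t) d (Icc 0 s) t := by
    intro t ht
    have h1 := ((h.factor_deriv_two t ht).mul (hR t ht)).add
      ((h.factor_deriv t ht).mul ((hB t ht).div (hR t ht) (hRpos t ht).ne'))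
    refine ⟨_, ?_, (h1.mul (hy t ht)).sub ((hdU t ht).mul (hy1 t ht))⟩
    have hV := h.factor_pos t ht
    have hτ : φ1 t ≠ 0 := by
      rw [← norm_pos_iff, h.speed t ht]; positivity
    have h2 := neg_sq_div_le_of_orthogonal (inner_eq_zero_of_speed hs ht (h.deriv_two t ht)
      (h.factor_deriv t ht) hV h.speed) hτ (sub_ne_zero.2 (hp t ht))
    have h3 := h.lower_bound t ht
    have h4 := hRpos t ht
    have h5 := hypos t ht
    set N := ‖φ2 t + (2 * (V1 t / V t)) • φ1 t‖ ^ 2 with hN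
    rw [h.speed t ht, inner_add_left, inner_smul_left] at h2
    simp only [Pi.add_apply, Pi.mul_apply, Pi.div_apply, real_inner_self_eq_norm_sq, h.speed t ht, hU, hU1,
      conj_trivial] at h2 ⊢
    set R := ‖φ t - p‖
    set B := ⟪φ1 t, φ t - p⟫_ℝ
    set A := ⟪φ2 t, φ t - p⟫_ℝ
    have h6 := mul_le_mul_of_nonneg_left h2 (mul_pos (div_pos hV h4) h5).le
    have h7 := mul_le_mul_of_nonneg_left h3 (mul_pos (mul_pos hV h4) h5).le
    have h8 : V t / R * y t * -(N * R ^ 2 / (4 * (V t ^ 2)⁻¹ ^ 2)) =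
      -(V t * R * y t * (N * V t ^ 4 / 4)) := by field_simp
    rw [h8] at h6
    have h9 : V t * R * y t * (V2 t / V t - N * V t ^ 4 / 4) =
      R * y t * V2 t - V t * R * y t * (N * V t ^ 4 / 4) := by field_simp
    rw [h9] at h7
    have h10 := add_le_add h6 h7
    rw [← sub_nonneg] at h10
    refine h10.trans_eq ?_
    field_simp
    ring
  have hw : MonotoneOn (fun t => U1 t * y t - U t * y1 t) (Icc 0 s) := by
    choose! d hd hd' using hdw
    exact MonotoneOn.of_hasDerivWithinAt_Icc hd' hd
  have hV0 := h.factor_pos 0 h0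
  have hw0 : 0 ≤ U1 0 * y 0 - U 0 * y1 0 := by
    have h1 := mul_le_mul_of_nonneg_left hinit (mul_pos (mul_pos hV0 (hRpos 0 h0)) (hypos 0 h0)).le
    rw [← sub_nonneg] at h1
    refine h1.trans_eq ?_
    have := hRpos 0 h0
    have := hypos 0 h0
    simp only [hU, hU1]
    field_simp
  have hq : MonotoneOn (fun t => U t / y t) (Icc 0 s) :=
    MonotoneOn.of_hasDerivWithinAt_Icc
      (fun t ht => (hdU t ht).div (hy t ht) (hypos t ht).ne') fun t ht =>
      div_nonneg (hw0.trans (hw h0 ht ht.1)) (sq_nonneg _)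
  intro t ht
  have h1 : U 0 / y 0 ≤ U t / y t := hq h0 ht ht.1
  rwa [le_div_iff₀ (hypos t ht)] at h1

/-- The curve never meets `p`: the comparison holds before the first hitting time, and in the limit
it would bound `0` below by a positive number. -/
theorem IsControlledCurve.le {c s : ℝ} {φ φ1 φ2 : ℝ → H} {V V1 V2 : ℝ → ℝ}
    (h : IsControlledCurve c s φ φ1 φ2 V V1 V2) (hs : 0 ≤ s) {p : H} {y y1 : ℝ → ℝ}
    (hy : ∀ t ∈ Icc 0 s, HasDerivWithinAt y (y1 t) (Icc 0 s) t)
    (hy1 : ∀ t ∈ Icc 0 s, HasDerivWithinAt y1 (-c * y t) (Icc 0 s) t)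
    (hypos : ∀ t ∈ Icc 0 s, 0 < y t) (hp : φ 0 ≠ p)
    (hinit : y1 0 / y 0 ≤ V1 0 / V 0 + ⟪φ1 0, φ 0 - p⟫_ℝ / ‖φ 0 - p‖ ^ 2) :
    ∀ t ∈ Icc 0 s, V 0 * ‖φ 0 - p‖ / y 0 * y t ≤ V t * ‖φ t - p‖ := by
  have h0 : (0 : ℝ) ∈ Icc 0 s := ⟨le_rfl, hs⟩
  have hy0 := hypos 0 h0
  have hstart : V 0 * ‖φ 0 - p‖ / y 0 * y 0 ≤ V 0 * ‖φ 0 - p‖ := by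
    rw [div_mul_cancel₀ _ hy0.ne']
  have hle : ∀ r ∈ Icc 0 s, (∀ t ∈ Icc 0 r, φ t ≠ p) →
      V 0 * ‖φ 0 - p‖ / y 0 * y r ≤ V r * ‖φ r - p‖ := by
    intro r hr hr'
    rcases hr.1.eq_or_lt with rfl | hr0
    · exact hstart
    · have hsub : Icc 0 r ⊆ Icc 0 s := Icc_subset_Icc_right hr.2
      exact (h.mono hr.2).le_of_ne hr0 (fun t ht => (hy t (hsub ht)).mono hsub)
        (fun t ht => (hy1 t (hsub ht)).mono hsub) (fun t ht => hypos t (hsub ht)) hr' hinit r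
        ⟨hr0.le, le_rfl⟩
  have hcφ : ContinuousOn φ (Icc 0 s) := fun t ht => (h.deriv t ht).continuousWithinAt
  have hcV : ContinuousOn V (Icc 0 s) := fun t ht => (h.factor_deriv t ht).continuousWithinAt
  have hcy : ContinuousOn y (Icc 0 s) := fun t ht => (hy t ht).continuousWithinAt
  suffices hne : ∀ t ∈ Icc 0 s, φ t ≠ p from fun t ht =>
    hle t ht fun r hr => hne r ⟨hr.1, hr.2.trans ht.2⟩
  by_contra! hcon
  obtain ⟨t, ht, htp⟩ := hcon
  have hclosed : IsClosed (Icc 0 s ∩ φ ⁻¹' {p}) :=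
    hcφ.preimage_isClosed_of_isClosed isClosed_Icc isClosed_singleton
  have hcomp : IsCompact (Icc 0 s ∩ φ ⁻¹' {p}) :=
    isCompact_Icc.of_isClosed_subset hclosed inter_subset_left
  obtain ⟨r, ⟨hr, hrp⟩, hleast⟩ := hcomp.exists_isLeast ⟨t, ht, htp⟩
  have hr0 : 0 < r := by
    rcases hr.1.eq_or_lt with rfl | hr0
    · exact absurd hrp hp
    · exact hr0
  have hsub : Ico 0 r ⊆ Icc 0 s := fun x hx => ⟨hx.1, hx.2.le.trans hr.2⟩
  have hmem : r ∈ closure (Ico 0 r) := by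
    rw [closure_Ico hr0.ne]; exact ⟨hr0.le, le_rfl⟩
  have : (𝓝[Ico 0 r] r).NeBot := mem_closure_iff_nhdsWithin_neBot.1 hmem
  have hlim : V 0 * ‖φ 0 - p‖ / y 0 * y r ≤ V r * ‖φ r - p‖ := by
    refine le_of_tendsto_of_tendsto (b := 𝓝[Ico 0 r] r)
      (((hcy r hr).mono hsub).tendsto.const_mul _)
      (((hcV r hr).mono hsub).tendsto.mul ((((hcφ r hr).mono hsub).sub continuousWithinAt_const).norm.tendsto)) ?_
    filter_upwards [self_mem_nhdsWithin] with x hx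
    exact hle x (hsub hx) fun w hw hwp =>
      absurd (hleast ⟨hsub ⟨hw.1, hw.2.trans_lt hx.2⟩, hwp⟩) (not_le.2 (hw.2.trans_lt hx.2))
  rw [mem_preimage, mem_singleton_iff] at hrp
  rw [hrp, sub_self, norm_zero, mul_zero] at hlim
  have : 0 < V 0 * ‖φ 0 - p‖ / y 0 * y r :=
    mul_pos (div_pos (mul_pos (h.factor_pos 0 h0) (norm_pos_iff.2 (sub_ne_zero.2 hp))) hy0) (hypos r hr)
  linarith

/-- The inversion in the unit sphere centred at `p`, followed by the translation by `-p`. -/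
noncomputable def invertAt (p x : H) : H := (‖x - p‖ ^ 2)⁻¹ • (x - p)

theorem norm_invertAt (p x : H) : ‖invertAt p x‖ = ‖x - p‖⁻¹ := by
  rw [invertAt, norm_smul, norm_inv, norm_pow, norm_norm]
  rcases eq_or_ne ‖x - p‖ 0 with h | h
  · simp [h]
  · field_simp

theorem invertAt_invertAt (p x : H) : p + invertAt 0 (invertAt p x) = x := by
  rcases eq_or_ne x p with rfl | h
  · simp [invertAt]
  · have h' : ‖x - p‖ ≠ 0 := norm_ne_zero_iff.2 (sub_ne_zero.2 h)
    rw [invertAt, sub_zero, norm_invertAt, invertAt, smul_smul]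
    have : (‖x - p‖⁻¹ ^ 2)⁻¹ * (‖x - p‖ ^ 2)⁻¹ = 1 := by field_simp
    rw [this, one_smul]
    abel

/-- Inversion is conformal with factor `‖x - p‖⁻²`. A curve of speed `V⁻²` thus gets speed `(V ‖φ -
p‖)⁻²`, the quantity that the comparison controls. -/
theorem exists_hasDerivWithinAt_invertAt {φ : ℝ → H} {φ' p : H} {s : Set ℝ} {t : ℝ}
    (h : HasDerivWithinAt φ φ' s t) (hp : φ t ≠ p) :
    ∃ d, HasDerivWithinAt (fun t => invertAt p (φ t)) d s t ∧ ‖d‖ = ‖φ'‖ / ‖φ t - p‖ ^ 2 := by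
  have hR : ‖φ t - p‖ ≠ 0 := norm_ne_zero_iff.2 (sub_ne_zero.2 hp)
  have h1 := (h.sub_const p).norm_sq
  have h2 := (h1.inv (pow_ne_zero 2 hR)).smul (h.sub_const p)
  refine ⟨_, h2, ?_⟩
  rw [← sq_eq_sq₀ (norm_nonneg _) (by positivity), ← real_inner_self_eq_norm_sq]
  simp only [inner_add_left, inner_add_right, inner_smul_left, inner_smul_right,
    real_inner_self_eq_norm_sq, conj_trivial, real_inner_comm φ' (φ t - p), Pi.inv_apply]
  field_simp
  ring

end Curve

/-! ### Limits at the ends of geodesic rays -/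

theorem dist_le_of_norm_deriv_le {Y : Type*} [NormedAddCommGroup Y] [NormedSpace ℝ Y] {Q d : ℝ → Y}
    {C t₀ s : ℝ} (ht₀ : 0 ≤ t₀) (hQ : ∀ t ∈ Icc 0 s, HasDerivWithinAt Q (d t) (Icc 0 s) t)
    (hd : ∀ t ∈ Icc t₀ s, ‖d t‖ ≤ C / (1 + t) ^ 2) {t : ℝ} (ht : t ∈ Icc t₀ s) :
    dist (Q t) (Q s) ≤ C * ((1 + t)⁻¹ - (1 + s)⁻¹) := by
  have hsub : Icc t s ⊆ Icc 0 s := Icc_subset_Icc_left (ht₀.trans ht.1)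
  have h1 : ∀ r ∈ Icc t s, 1 + r ≠ 0 := fun r hr => by linarith [(hsub hr).1]
  have hB : ∀ r ∈ Icc t s, HasDerivAt (fun r => C * ((1 + t)⁻¹ - (1 + r)⁻¹)) (C / (1 + r) ^ 2) r := by
    intro r hr
    refine (((((hasDerivAt_id r).const_add 1).inv (h1 r hr)).const_sub _).const_mul C).congr_deriv ?_
    simp only [id]
    ring
  rw [dist_comm, dist_eq_norm]
  refine image_norm_le_of_norm_deriv_right_le_deriv_boundary' (f := fun r => Q r - Q t) (f' := d)
    (fun r hr => (((hQ r (hsub hr)).continuousWithinAt.mono hsub).sub continuousWithinAt_const))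
    (fun r hr => (((hQ r (hsub (Ico_subset_Icc_self hr))).sub_const _).Ici_of_Icc
      ⟨(hsub (Ico_subset_Icc_self hr)).1, hr.2⟩)) (by simp)
    (fun r hr => (hB r hr).continuousAt.continuousWithinAt)
    (fun r hr => (hB r (Ico_subset_Icc_self hr)).hasDerivWithinAt)
    (fun r hr => hd r ⟨ht.1.trans hr.1, hr.2.le⟩) ⟨ht.2, le_rfl⟩

/-- The polar coordinates of a star-shaped domain in which the ray of direction `u` has
length `len u`. -/
noncomputable def polarDomain (len : Circle → ℝ≥0∞) : Set (Circle × ℝ) :=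
  {q | 0 ≤ q.2 ∧ ENNReal.ofReal q.2 < len q.1}

/-- The filter of the neighbourhoods of the end of the ray of direction `u`. -/
noncomputable def rayEnd (len : Circle → ℝ≥0∞) (u : Circle) : Filter (Circle × ℝ) :=
  comap (fun q => (q.1, ENNReal.ofReal q.2)) (𝓝 (u, len u)) ⊓ 𝓟 (polarDomain len)

theorem tendsto_rayEnd_iff {len : Circle → ℝ≥0∞} {u : Circle} {κ : Type*} {l : Filter κ}
    {f : κ → Circle × ℝ} :
    Tendsto f l (rayEnd len u) ↔ Tendsto (fun i => (f i).1) l (𝓝 u) ∧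
      Tendsto (fun i => ENNReal.ofReal (f i).2) l (𝓝 (len u)) ∧ ∀ᶠ i in l, f i ∈ polarDomain len := by
  rw [rayEnd, tendsto_inf, tendsto_comap_iff, nhds_prod_eq, tendsto_prod_iff', tendsto_principal, and_assoc]
  rfl

theorem mem_rayEnd_iff {len : Circle → ℝ≥0∞} {u : Circle} {A : Set (Circle × ℝ)} :
    A ∈ rayEnd len u ↔ ∀ᶠ y in 𝓝 (u, len u), ∀ q ∈ polarDomain len, (q.1, ENNReal.ofReal q.2) = y → q ∈ A := by
  rw [rayEnd, mem_inf_principal, mem_comap]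
  constructor
  · rintro ⟨B, hB, hBA⟩
    filter_upwards [hB] with y hy q hq hqy
    exact hBA (by rw [mem_preimage, hqy]; exact hy) hq
  · exact fun h => ⟨_, h, fun q hq hq' => hq q hq' rfl⟩

theorem eventually_mem_rayEnd {len : Circle → ℝ≥0∞} (hlen : Continuous len) {u : Circle}
    {A : Set (Circle × ℝ)} (hA : A ∈ rayEnd len u) : ∀ᶠ v in 𝓝 u, A ∈ rayEnd len v := by
  have h1 := (mem_rayEnd_iff.1 hA).eventually_nhds
  have h2 : Tendsto (fun v => (v, len v)) (𝓝 u) (𝓝 (u, len u)) :=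
    (continuous_id.prodMk hlen).tendsto u
  exact (h2.eventually h1).mono fun v hv => mem_rayEnd_iff.2 hv

/-- Puts neighbourhoods of a ray end in product form, with a common starting time for all nearby
directions; `len u = ∞` is allowed. -/
theorem exists_of_mem_rayEnd {len : Circle → ℝ≥0∞} (hlen : Continuous len) {u : Circle} (h0 : 0 < len u)
    {A : Set (Circle × ℝ)} (hA : A ∈ rayEnd len u) :
    ∃ N ∈ 𝓝 u, ∃ t₀, 0 ≤ t₀ ∧ (∀ v ∈ N, ENNReal.ofReal t₀ < len v) ∧
      ∀ v ∈ N, ∀ t, t₀ ≤ t → ENNReal.ofReal t < len v → (v, t) ∈ A := by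
  have h1 := mem_rayEnd_iff.1 hA
  rw [nhds_prod_eq, eventually_prod_iff] at h1
  obtain ⟨p, hp, r, hr, hpr⟩ := h1
  obtain ⟨b, c, hbc, hnhds, hsub⟩ := exists_Icc_mem_subset_of_mem_nhds hr
  obtain ⟨l, hl, hlsub⟩ := exists_Ioc_subset_of_mem_nhds hnhds ⟨0, h0⟩
  obtain ⟨x, hlx, hxu⟩ := exists_between hl
  have hbx : b ≤ x := (hlsub ⟨hlx, hxu.le⟩).1
  have hofx : ENNReal.ofReal x.toReal = x := ENNReal.ofReal_toReal hxu.ne_top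
  refine ⟨{v | p v ∧ x < len v ∧ len v ∈ Icc b c}, ?_, x.toReal, ENNReal.toReal_nonneg,
    fun v hv => by rw [hofx]; exact hv.2.1, fun v hv t ht htv => ?_⟩
  · exact hp.and ((hlen.continuousAt.eventually (lt_mem_nhds hxu)).and
      (hlen.continuousAt.eventually hnhds))
  · refine hpr hv.1 (hsub ⟨?_, htv.le.trans hv.2.2.2⟩) (v, t) ⟨ENNReal.toReal_nonneg.trans ht, htv⟩ rfl
    rw [← hofx] at hbx
    exact hbx.trans (ENNReal.ofReal_le_ofReal ht)

theorem mem_rayEnd_of_lt {len : Circle → ℝ≥0∞} {u : Circle} {N : Set Circle} (hN : N ∈ 𝓝 u) {t₀ : ℝ}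
    (ht₀ : ENNReal.ofReal t₀ < len u) : {q : Circle × ℝ | q.1 ∈ N ∧ t₀ ≤ q.2} ∈ rayEnd len u := by
  rw [mem_rayEnd_iff]
  filter_upwards [prod_mem_nhds hN (lt_mem_nhds ht₀)] with y hy q hq hqy
  subst hqy
  refine ⟨hy.1, ?_⟩
  by_contra! hcon
  exact absurd hy.2 (not_lt.2 (ENNReal.ofReal_le_ofReal hcon.le))

theorem tendsto_prodMk_rayEnd {len : Circle → ℝ≥0∞} {u : Circle} (h0 : 0 < len u) :
    Tendsto (fun t : ℝ => (u, t)) (comap ENNReal.ofReal (𝓝[<] len u)) (rayEnd len u) := by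
  have h1 : Tendsto ENNReal.ofReal (comap ENNReal.ofReal (𝓝[<] len u)) (𝓝[<] len u) := tendsto_comap
  refine tendsto_rayEnd_iff.2 ⟨tendsto_const_nhds, h1.mono_right nhdsWithin_le_nhds, ?_⟩
  filter_upwards [h1.eventually self_mem_nhdsWithin,
    (h1.mono_right nhdsWithin_le_nhds).eventually (lt_mem_nhds h0)] with t ht ht0
  exact ⟨(ENNReal.ofReal_pos.1 ht0).le, ht⟩

theorem rayEnd_neBot {len : Circle → ℝ≥0∞} {u : Circle} (h0 : 0 < len u) : (rayEnd len u).NeBot :=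
  have := comap_ofReal_nhdsLT_neBot h0
  (tendsto_prodMk_rayEnd h0).neBot

/-- Cauchy criterion: near the end `1 / (1 + t)` hardly varies, uniformly over nearby directions, so
tails are short; neighbouring rays are compared at one fixed time `τ`. -/
theorem exists_tendsto_rayEnd {len : Circle → ℝ≥0∞} (hlen : Continuous len) {u : Circle}
    (h0 : 0 < len u) {Y : Type*} [MetricSpace Y] [CompleteSpace Y] {Q : Circle × ℝ → Y} {N : Set Circle}
    (hN : N ∈ 𝓝 u) {t₀ C : ℝ} (ht₀ : 0 ≤ t₀) (hut₀ : ENNReal.ofReal t₀ < len u) (hC : 0 ≤ C)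
    (hQ : ∀ v ∈ N, ∀ t t', t₀ ≤ t → t ≤ t' → ENNReal.ofReal t' < len v →
      dist (Q (v, t)) (Q (v, t')) ≤ C * ((1 + t)⁻¹ - (1 + t')⁻¹))
    (hcont : ∀ t, 0 ≤ t → ENNReal.ofReal t < len u → ContinuousAt (fun v => Q (v, t)) u) :
    ∃ y, Tendsto Q (rayEnd len u) (𝓝 y) := by
  have := rayEnd_neBot h0
  refine cauchy_map_iff_exists_tendsto.1 (Metric.cauchy_iff.2 ⟨inferInstance, fun ε hε => ?_⟩)
  -- This is `1 / (1 + x)` with value `0` at `∞`; its continuity there covers rays of infinite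
  -- length.
  set g : ℝ≥0∞ → ℝ := fun x => ((1 + x)⁻¹).toReal with hg
  have hgof : ∀ t : ℝ, 0 ≤ t → g (ENNReal.ofReal t) = (1 + t)⁻¹ := by
    intro t ht
    simp only [hg]
    rw [ENNReal.toReal_inv, ENNReal.toReal_add ENNReal.one_ne_top ENNReal.ofReal_ne_top,
      ENNReal.toReal_ofReal ht, ENNReal.toReal_one]
  have hgc : ContinuousAt g (len u) := by
    have h1 : (1 + len u)⁻¹ ≠ ⊤ := by simp
    have h2 : Tendsto (fun x : ℝ≥0∞ => 1 + x) (𝓝 (len u)) (𝓝 (1 + len u)) :=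
      tendsto_const_nhds.add tendsto_id
    exact (ENNReal.tendsto_toReal h1).comp (tendsto_inv_iff.2 h2)
  set η := ε / (8 * (C + 1)) with hη
  have hηpos : 0 < η := by positivity
  have hCη : C * (2 * η) ≤ ε / 4 := by
    rw [hη]
    have : C * (2 * (ε / (8 * (C + 1)))) = ε / 4 * (C / (C + 1)) := by field_simp; ring
    rw [this]
    have h2 : C / (C + 1) ≤ 1 := by rw [div_le_one (by positivity)]; linarith
    nlinarith
  have hA : {q : Circle × ℝ | |g (ENNReal.ofReal q.2) - g (len u)| < η} ∈ rayEnd len u := by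
    rw [mem_rayEnd_iff]
    have h1 : ∀ᶠ y in 𝓝 (u, len u), |g y.2 - g (len u)| < η := by
      have h2 : Tendsto (fun y : Circle × ℝ≥0∞ => g y.2) (𝓝 (u, len u)) (𝓝 (g (len u))) :=
        hgc.tendsto.comp (continuous_snd.tendsto _)
      exact (Metric.tendsto_nhds.1 h2 η hηpos)
    filter_upwards [h1] with y hy q _ hqy
    subst hqy
    exact hy
  obtain ⟨N', hN', t₁, ht₁, hNt, hNA⟩ := exists_of_mem_rayEnd hlen h0 hA
  have hu' : u ∈ N' := mem_of_mem_nhds hN'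
  set τ := max t₀ t₁ with hτ
  have hτ0 : 0 ≤ τ := ht₀.trans (le_max_left _ _)
  have hτu : ENNReal.ofReal τ < len u := by
    rcases max_choice t₀ t₁ with h | h
    · rw [hτ, h]; exact hut₀
    · rw [hτ, h]; exact hNt u hu'
  have hB : ∀ᶠ v in 𝓝 u, dist (Q (v, τ)) (Q (u, τ)) < ε / 8 :=
    Metric.tendsto_nhds.1 (hcont τ hτ0 hτu) _ (by positivity)
  have hset := inter_mem (mem_rayEnd_of_lt (inter_mem (inter_mem hN hN') hB) hτu)
    (mem_inf_of_right (mem_principal_self (polarDomain len)))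
  have hest : ∀ q ∈ {q : Circle × ℝ | q.1 ∈ N ∩ N' ∩ {v | dist (Q (v, τ)) (Q (u, τ)) < ε / 8} ∧
      τ ≤ q.2} ∩ polarDomain len, dist (Q q) (Q (u, τ)) < ε / 2 := by
    rintro ⟨v, t⟩ ⟨⟨⟨⟨hv, hv'⟩, hvd⟩, hτt⟩, ht0, htv⟩
    simp only at *
    have h1 := hQ v hv τ t (le_max_left _ _) hτt htv
    have h2 := hNA v hv' t ((le_max_right _ _).trans hτt) htv
    have h3 := hNA v hv' τ (le_max_right _ _) ((ENNReal.ofReal_le_ofReal hτt).trans_lt htv)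
    simp only [mem_ofPred_eq, hgof t ht0, hgof τ hτ0] at h2 h3
    have h4 : (1 + τ)⁻¹ - (1 + t)⁻¹ ≤ 2 * η := by
      rw [abs_lt] at h2 h3; linarith [h2.1, h3.2]
    have h5 := mul_le_mul_of_nonneg_left h4 hC
    have h6 := dist_triangle (Q (v, t)) (Q (v, τ)) (Q (u, τ))
    rw [dist_comm] at h1
    have h7 : dist (Q (v, τ)) (Q (u, τ)) < ε / 8 := hvd
    linarith
  refine ⟨_, image_mem_map hset, ?_⟩
  rintro _ ⟨q, hq, rfl⟩ _ ⟨q', hq', rfl⟩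
  have h1 := hest q hq
  have h2 := hest q' hq'
  have h3 := dist_triangle_right (Q q) (Q q') (Q (u, τ))
  linarith

/-- Membership in the end filter is an open condition on the direction, so limits at nearby ends
stay in a closed neighbourhood of `Φ u`; regularity supplies such neighbourhoods. -/
theorem continuousOn_of_tendsto_rayEnd {len : Circle → ℝ≥0∞} (hlen : Continuous len)
    (h0 : ∀ u, 0 < len u) {Y : Type*} [TopologicalSpace Y] [RegularSpace Y] {Q : Circle × ℝ → Y}
    {A : Set Circle} {Φ : Circle → Y} (hΦ : ∀ u ∈ A, Tendsto Q (rayEnd len u) (𝓝 (Φ u))) :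
    ContinuousOn Φ A := by
  intro u hu
  refine (closed_nhds_basis (Φ u)).tendsto_right_iff.2 fun K ⟨hK, hKc⟩ => ?_
  filter_upwards [(eventually_mem_rayEnd hlen (hΦ u hu hK)).filter_mono nhdsWithin_le_nhds,
    self_mem_nhdsWithin] with v hv hvA
  have := rayEnd_neBot (h0 v)
  exact hKc.mem_of_tendsto (hΦ v hvA) hv

/-! ### Geodesic rays ending near a given boundary point -/

/-- The angle in `(-π, π]` from `ν` to `x`. -/
noncomputable def angleFrom (ν : Circle) (x : ℂ) : ℝ := (x / ν).arg

theorem mul_exp_angleFrom (ν u : Circle) : ν * Circle.exp (angleFrom ν u) = u := by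
  have h : ((u : ℂ) / ν).arg = ((u / ν : Circle) : ℂ).arg := by rw [Circle.coe_div]
  rw [angleFrom, h, Circle.exp_arg, mul_div_cancel]

theorem angleFrom_mul_exp (ν : Circle) {θ : ℝ} (hθ : θ ∈ Ioo (-Real.pi) Real.pi) :
    angleFrom ν ((ν * Circle.exp θ : Circle) : ℂ) = θ := by
  rw [angleFrom, Circle.coe_mul, mul_div_cancel_left₀ _ (Circle.coe_ne_zero ν)]
  exact Circle.arg_exp hθ.1 hθ.2.le

theorem angleFrom_real_mul (ν : Circle) {t : ℝ} (ht : 0 < t) (x : ℂ) :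
    angleFrom ν (t * x) = angleFrom ν x := by
  rw [angleFrom, angleFrom, mul_div_assoc, arg_real_mul _ ht]

theorem angleFrom_direction (ν : Circle) {x : ℂ} (hx : x ≠ 0) :
    angleFrom ν (direction x) = angleFrom ν x := by
  conv_rhs => rw [← norm_mul_direction x, angleFrom_real_mul ν (norm_pos_iff.2 hx)]

theorem direction_eq (ν : Circle) {x : ℂ} (hx : x ≠ 0) : direction x = ν * Circle.exp (angleFrom ν x) := by
  rw [← angleFrom_direction ν hx, mul_exp_angleFrom]

theorem angleFrom_mem_Ioo {ν : Circle} {x : ℂ} (hx : x ≠ 0) (h : direction x ≠ ν * Circle.exp Real.pi) :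
    angleFrom ν x ∈ Ioo (-Real.pi) Real.pi := by
  refine ⟨neg_pi_lt_arg _, lt_of_le_of_ne (arg_le_pi _) fun h' => h ?_⟩
  rw [direction_eq ν hx]
  exact congrArg (fun a => ν * Circle.exp a) h'

theorem continuousAt_angleFrom {ν : Circle} {x : ℂ} (hx : x ≠ 0) (h : direction x ≠ ν * Circle.exp Real.pi) :
    ContinuousAt (angleFrom ν) x := by
  have h1 : x / ν ∈ slitPlane := mem_slitPlane_iff_arg.2
    ⟨(angleFrom_mem_Ioo hx h).2.ne, div_ne_zero hx (Circle.coe_ne_zero ν)⟩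
  exact (continuousAt_arg h1).comp (f := fun x : ℂ => x / ν) (by fun_prop)

theorem direction_coe (u : Circle) : direction u = u := by
  simpa using direction_mul one_pos u

theorem Circle.coe_notMem_ball (ζ : Circle) : (ζ : ℂ) ∉ ball (0 : ℂ) 1 := fun h => by
  rw [mem_ball_zero_iff, Circle.norm_coe] at h
  exact lt_irrefl _ h

/-- `S` is the inverse of the exponential map at `z₀`, which is a homeomorphism onto the disk. -/
structure IsExpInverse (ρ : ℂ → ℝ) (z₀ : ℂ) (S : ℂ → ℂ) : Prop where
  continuousOn : ContinuousOn S (ball 0 1)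
  mem : ∀ z ∈ ball (0 : ℂ) 1, S z ∈ expDomain ρ z₀
  right_inv : ∀ z ∈ ball (0 : ℂ) 1, expMap ρ z₀ (S z) = z
  left_inv : ∀ x ∈ expDomain ρ z₀, S (expMap ρ z₀ x) = x

section Boundary

variable {ρ : ℂ → ℝ} {z₀ : ℂ} {len : Circle → ℝ≥0∞} {E : Circle → Circle} {S : ℂ → ℂ}

theorem IsPolarSystem.len_pos (hP : IsPolarSystem ρ z₀ len E) (u : Circle) : 0 < len u := by
  have := (hP.mem_iff u 0 le_rfl).1 (by simpa using zero_mem_expDomain hP.base_mem)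
  simpa using this

theorem IsExpInverse.polar_mem (hP : IsPolarSystem ρ z₀ len E) (hS : IsExpInverse ρ z₀ S) {z : ℂ}
    (hz : z ∈ ball (0 : ℂ) 1) : (direction (S z), ‖S z‖) ∈ polarDomain len :=
  ⟨norm_nonneg _, (hP.mem_expDomain_iff _).1 (hS.mem z hz)⟩

theorem IsExpInverse.expMap_polar (hS : IsExpInverse ρ z₀ S) {z : ℂ}
    (hz : z ∈ ball (0 : ℂ) 1) : expMap ρ z₀ (‖S z‖ * direction (S z)) = z := by
  rw [norm_mul_direction, hS.right_inv z hz]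

/-- Compactness of `[0, ∞]` gives a limit of `‖S z‖` along the ultrafilter. Were it below `len u`,
then `S z` would converge inside the domain and `z` to an interior point rather than to `ζ`. -/
theorem IsExpInverse.tendsto_rayEnd (hρ : ContDiffOn ℝ ∞ ρ (ball 0 1))
    (hcurv : ∀ z ∈ ball (0 : ℂ) 1, 0 ≤ dzdzbar ρ z)
    (hP : IsPolarSystem ρ z₀ len E) (hS : IsExpInverse ρ z₀ S) {ζ u : Circle} {G : Ultrafilter ℂ}
    (hG : (G : Filter ℂ) ≤ 𝓝[ball 0 1] (ζ : ℂ)) (hu : Tendsto (fun z => direction (S z)) G (𝓝 u)) :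
    Tendsto (fun z => (direction (S z), ‖S z‖)) G (rayEnd len u) := by
  have hball : ∀ᶠ z in (G : Filter ℂ), z ∈ ball (0 : ℂ) 1 := hG self_mem_nhdsWithin
  refine tendsto_rayEnd_iff.2 ⟨hu, ?_, hball.mono fun z hz => hS.polar_mem hP hz⟩
  obtain ⟨L, -, hL⟩ := isCompact_univ.ultrafilter_le_nhds (G.map fun z => ENNReal.ofReal ‖S z‖) (by simp)
  have hL' : Tendsto (fun z => ENNReal.ofReal ‖S z‖) G (𝓝 L) := hL
  have hle : L ≤ len u := le_of_tendsto_of_tendsto hL' ((hP.continuous_len.tendsto u).comp hu)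
    (hball.mono fun z hz => (hS.polar_mem hP hz).2.le)
  rcases hle.eq_or_lt with rfl | hlt
  · exact hL'
  exfalso
  have hr : Tendsto (fun z => ‖S z‖) G (𝓝 L.toReal) := by
    have := (ENNReal.tendsto_toReal hlt.ne_top).comp hL'
    refine this.congr fun z => ?_
    exact ENNReal.toReal_ofReal (norm_nonneg _)
  have hS' : Tendsto S G (𝓝 (L.toReal * u)) := by
    have h1 := ((continuous_ofReal.tendsto _).comp hr).mul ((Circle.isInducing_coe.continuous.tendsto u).comp hu)
    refine h1.congr fun z => ?_
    exact norm_mul_direction (S z)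
  have hmem : (L.toReal * u : ℂ) ∈ expDomain ρ z₀ :=
    (hP.mem_iff u _ ENNReal.toReal_nonneg).2 (by rwa [ENNReal.ofReal_toReal hlt.ne_top])
  have h2 : Tendsto (fun z => expMap ρ z₀ (S z)) G (𝓝 (expMap ρ z₀ (L.toReal * u))) :=
    ((continuousOn_expMap hρ hcurv z₀).continuousAt
      ((isOpen_expDomain hρ hcurv z₀).mem_nhds hmem)).tendsto.comp hS'
  have h3 : Tendsto (fun z => z) (G : Filter ℂ) (𝓝 (ζ : ℂ)) := hG.trans nhdsWithin_le_nhds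
  have h4 := tendsto_nhds_unique (h2.congr' (hball.mono fun z hz => hS.right_inv z hz)) h3
  have h5 := expMap_mem hmem
  rw [h4] at h5
  exact Circle.coe_notMem_ball ζ h5

/-- The tail of the ray is near `E w`, and the remaining compact piece lies in the open disk. -/
theorem IsPolarSystem.exists_le_dist (hρ : ContDiffOn ℝ ∞ ρ (ball 0 1))
    (hcurv : ∀ z ∈ ball (0 : ℂ) 1, 0 ≤ dzdzbar ρ z) (hP : IsPolarSystem ρ z₀ len E) {ζ w : Circle}
    (hw : E w ≠ ζ) : ∃ r > 0, ∀ t, 0 ≤ t → ENNReal.ofReal t < len w → r ≤ dist (expMap ρ z₀ (t * w)) ζ := by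
  have hd : 0 < dist (E w : ℂ) ζ := dist_pos.2 fun h => hw (Circle.ext h)
  have h1 := (hP.tendsto w).dist (tendsto_const_nhds (x := (ζ : ℂ)))
  obtain ⟨A, hA, hAsub⟩ := mem_comap.1 (h1.eventually (lt_mem_nhds (half_lt_self hd)))
  obtain ⟨l, hl, hlA⟩ := (mem_nhdsLT_iff_exists_Ioo_subset' (hP.len_pos w)).1 hA
  have hcont : ContinuousOn (fun t : ℝ => dist (expMap ρ z₀ (t * w)) ζ) (Icc 0 l.toReal) := by
    refine (continuous_id.dist continuous_const).comp_continuousOn ((continuousOn_expMap hρ hcurv z₀).comp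
      (f := fun t : ℝ => (t * w : ℂ)) (by fun_prop) fun t ht => ?_)
    refine (hP.mem_iff w t ht.1).2 (lt_of_le_of_lt ?_ hl)
    rw [← ENNReal.ofReal_toReal (mem_Iio.1 hl).ne_top]
    exact ENNReal.ofReal_le_ofReal ht.2
  obtain ⟨τ, hτ, hmin⟩ := isCompact_Icc.exists_isMinOn ⟨0, le_rfl, ENNReal.toReal_nonneg⟩ hcont
  have hτw : ENNReal.ofReal τ < len w := by
    refine lt_of_le_of_lt ?_ hl
    rw [← ENNReal.ofReal_toReal (mem_Iio.1 hl).ne_top]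
    exact ENNReal.ofReal_le_ofReal hτ.2
  have hpos : 0 < dist (expMap ρ z₀ (τ * w)) ζ := by
    refine dist_pos.2 fun h => ?_
    have h5 := expMap_mem ((hP.mem_iff w τ hτ.1).2 hτw)
    rw [h] at h5
    exact Circle.coe_notMem_ball ζ h5
  refine ⟨min (dist (E w : ℂ) ζ / 2) (dist (expMap ρ z₀ (τ * w)) ζ), lt_min (half_pos hd) hpos,
    fun t ht htw => ?_⟩
  rcases le_or_gt t l.toReal with h | h
  · exact (min_le_right _ _).trans (hmin ⟨ht, h⟩)
  · refine (min_le_left _ _).trans (le_of_lt (hAsub (hlA ⟨?_, htw⟩)))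
    rw [← ENNReal.ofReal_toReal (mem_Iio.1 hl).ne_top]
    exact ENNReal.ofReal_lt_ofReal_iff (ENNReal.toReal_nonneg.trans_lt h) |>.2 h

/-- If a direction strictly between `u₀` and `u`, on the arc avoiding `w`, did not end at `ζ`, its
ray and that of `w` would miss a small lens of the disk at `ζ`. The lens is connected, so the angle
of `S` could not jump across; yet it takes the value of `u₀` and values near that of `u`. -/
theorem IsExpInverse.exists_arc (hρ : ContDiffOn ℝ ∞ ρ (ball 0 1))
    (hcurv : ∀ z ∈ ball (0 : ℂ) 1, 0 ≤ dzdzbar ρ z)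
    (hP : IsPolarSystem ρ z₀ len E) (hS : IsExpInverse ρ z₀ S) {ζ u u₀ : Circle} {G : Ultrafilter ℂ}
    (hG : (G : Filter ℂ) ≤ 𝓝[ball 0 1] (ζ : ℂ)) (hu : Tendsto (fun z => direction (S z)) G (𝓝 u))
    (hu₀ : E u₀ = ζ) :
    ∃ (ν : Circle) (θ₀ θ : ℝ), θ₀ ∈ Ioo (-Real.pi) Real.pi ∧ θ ∈ Ioo (-Real.pi) Real.pi ∧
      ν * Circle.exp θ₀ = u₀ ∧ ν * Circle.exp θ = u ∧
      ∀ α ∈ uIcc θ₀ θ, E (ν * Circle.exp α) = ζ := by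
  have hball : ∀ᶠ z in (G : Filter ℂ), z ∈ ball (0 : ℂ) 1 := hG self_mem_nhdsWithin
  have hζ : Tendsto (fun z => z) (G : Filter ℂ) (𝓝 (ζ : ℂ)) := hG.trans nhdsWithin_le_nhds
  -- Two directions with distinct endpoints, both different from `ζ`, are at hand; at most one of
  -- them is `u`.
  obtain ⟨w, hwE, hwu⟩ : ∃ w, E w ≠ ζ ∧ w ≠ u := by
    obtain ⟨w₁, h₁⟩ := hP.surjective_endpoint (ζ * Circle.exp 1)
    obtain ⟨w₂, h₂⟩ := hP.surjective_endpoint (ζ * Circle.exp 2)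
    have e1 : ∀ x y : ℝ, x ∈ Ioo (-Real.pi) Real.pi → y ∈ Ioo (-Real.pi) Real.pi → x ≠ y →
        ζ * Circle.exp x ≠ ζ * Circle.exp y := fun x y hx hy hxy h => hxy (by
      rw [← angleFrom_mul_exp ζ hx, ← angleFrom_mul_exp ζ hy, h])
    have hpi := Real.pi_gt_three
    have m0 : (0 : ℝ) ∈ Ioo (-Real.pi) Real.pi := ⟨by linarith, by linarith⟩
    have m1 : (1 : ℝ) ∈ Ioo (-Real.pi) Real.pi := ⟨by linarith, by linarith⟩
    have m2 : (2 : ℝ) ∈ Ioo (-Real.pi) Real.pi := ⟨by linarith, by linarith⟩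
    have n1 := e1 1 0 m1 m0 (by norm_num)
    have n2 := e1 2 0 m2 m0 (by norm_num)
    have n3 := e1 1 2 m1 m2 (by norm_num)
    rw [Circle.exp_zero, mul_one] at n1 n2
    by_cases h : w₁ = u
    · refine ⟨w₂, by rwa [h₂], fun h' => n3 ?_⟩
      rw [← h₁, ← h₂, h, h']
    · exact ⟨w₁, by rwa [h₁], h⟩
  -- `ν` is opposite to `w`, so that the branch cut of `angleFrom ν` lies along `w`.
  set ν := w * (Circle.exp Real.pi)⁻¹ with hν
  have hνw : ν * Circle.exp Real.pi = w := by rw [hν, inv_mul_cancel_right]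
  have hang : ∀ v : Circle, v ≠ w → angleFrom ν v ∈ Ioo (-Real.pi) Real.pi ∧ ContinuousAt (angleFrom ν) v := by
    intro v hv
    have h1 : direction (v : ℂ) ≠ ν * Circle.exp Real.pi := by rwa [direction_coe, hνw]
    exact ⟨angleFrom_mem_Ioo (Circle.coe_ne_zero v) h1, continuousAt_angleFrom (Circle.coe_ne_zero v) h1⟩
  have hu₀w : u₀ ≠ w := fun h => hwE (by rw [← h, hu₀])
  set θ₀ := angleFrom ν u₀ with hθ₀
  set θ := angleFrom ν u with hθ
  refine ⟨ν, θ₀, θ, (hang u₀ hu₀w).1, (hang u hwu.symm).1, mul_exp_angleFrom _ _, mul_exp_angleFrom _ _, ?_⟩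
  have hmain : ∀ α ∈ Ioo (min θ₀ θ) (max θ₀ θ), E (ν * Circle.exp α) = ζ := by
    by_contra! hcon
    obtain ⟨α, hα, hαE⟩ := hcon
    have hα' : α ∈ Ioo (-Real.pi) Real.pi :=
      ⟨(lt_min (hang u₀ hu₀w).1.1 (hang u hwu.symm).1.1).trans hα.1,
        hα.2.trans (max_lt (hang u₀ hu₀w).1.2 (hang u hwu.symm).1.2)⟩
    obtain ⟨r₁, hr₁, hR₁⟩ := hP.exists_le_dist hρ hcurv hwE
    obtain ⟨r₂, hr₂, hR₂⟩ := hP.exists_le_dist hρ hcurv hαE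
    set B := ball (0 : ℂ) 1 ∩ ball (ζ : ℂ) (min r₁ r₂) with hB
    have hBr : ∀ z ∈ B, dist z (ζ : ℂ) < r₁ ∧ dist z (ζ : ℂ) < r₂ := fun z hz => lt_min_iff.1 hz.2
    have hBG : B ∈ (G : Filter ℂ) := inter_mem hball (hζ (ball_mem_nhds _ (lt_min hr₁ hr₂)))
    have hS0 : ∀ z ∈ B, S z ≠ 0 := by
      intro z hz h0
      have h1 := hS.expMap_polar hz.1
      rw [h0, norm_zero, ofReal_zero, zero_mul] at h1
      have h2 := hR₁ 0 le_rfl (by simpa using hP.len_pos w)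
      rw [ofReal_zero, zero_mul, h1] at h2
      exact absurd h2 (not_le.2 (hBr z hz).1)
    have hdir : ∀ z ∈ B, ∀ v : Circle, ∀ r, dist z (ζ : ℂ) < r →
        (∀ t, 0 ≤ t → ENNReal.ofReal t < len v → r ≤ dist (expMap ρ z₀ (t * v)) ζ) →
        direction (S z) ≠ v := by
      rintro z hz v r hzr hr rfl
      have h2 := hr ‖S z‖ (norm_nonneg _) (hS.polar_mem hP hz.1).2
      rw [hS.expMap_polar hz.1] at h2
      exact absurd h2 (not_le.2 hzr)
    have hcont : ContinuousOn (fun z => angleFrom ν (S z)) B := fun z hz =>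
      ContinuousAt.comp_continuousWithinAt (g := angleFrom ν) (continuousAt_angleFrom (hS0 z hz)
        (by rw [hνw]; exact hdir z hz w r₁ (hBr z hz).1 hR₁))
        ((hS.continuousOn z hz.1).mono inter_subset_left)
    have hconn : ((fun z => angleFrom ν (S z)) '' B).OrdConnected :=
      (((convex_ball _ _).inter (convex_ball _ _)).isPreconnected.image _ hcont).ordConnected
    have hnot : α ∉ (fun z => angleFrom ν (S z)) '' B := by
      rintro ⟨z, hz, hzα⟩
      refine hdir z hz _ r₂ (hBr z hz).2 hR₂ ?_
      rw [direction_eq ν (hS0 z hz), ← hzα]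
    have h₀mem : θ₀ ∈ (fun z => angleFrom ν (S z)) '' B := by
      have h1 := hP.tendsto u₀
      rw [hu₀] at h1
      have := comap_ofReal_nhdsLT_neBot (hP.len_pos u₀)
      have h2 : Tendsto ENNReal.ofReal (comap ENNReal.ofReal (𝓝[<] len u₀)) (𝓝[<] len u₀) := tendsto_comap
      obtain ⟨t, ht1, ht2, ht3⟩ := ((h1.eventually (ball_mem_nhds _ (lt_min hr₁ hr₂))).and
        ((h2.eventually self_mem_nhdsWithin).and
        ((h2.mono_right nhdsWithin_le_nhds).eventually (lt_mem_nhds (hP.len_pos u₀))))).exists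
      have ht0 : 0 < t := ENNReal.ofReal_pos.1 ht3
      have hdom := (hP.mem_iff u₀ t ht0.le).2 ht2
      refine ⟨_, ⟨expMap_mem hdom, ht1⟩, ?_⟩
      simp only
      rw [hS.left_inv _ hdom, angleFrom_real_mul ν ht0]
    have hlim : Tendsto (fun z => angleFrom ν (S z)) G (𝓝 θ) := by
      have h1 : Tendsto (fun z => angleFrom ν (direction (S z))) G (𝓝 θ) :=
        (hang u hwu.symm).2.tendsto.comp ((Circle.isInducing_coe.continuous.tendsto u).comp hu)
      refine h1.congr' ?_
      filter_upwards [hBG] with z hz using angleFrom_direction ν (hS0 z hz)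
    rcases lt_or_ge θ₀ θ with hlt | hge
    · rw [min_eq_left hlt.le, max_eq_right hlt.le] at hα
      obtain ⟨z, hz1, hz2⟩ := ((hlim.eventually (lt_mem_nhds hα.2)).and hBG).exists
      exact hnot (hconn.out h₀mem ⟨z, hz2, rfl⟩ ⟨hα.1.le, le_of_lt hz1⟩)
    · rw [min_eq_right hge, max_eq_left hge] at hα
      obtain ⟨z, hz1, hz2⟩ := ((hlim.eventually (gt_mem_nhds hα.1)).and hBG).exists
      exact hnot (hconn.out ⟨z, hz2, rfl⟩ h₀mem ⟨le_of_lt hz1, hα.2.le⟩)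
  rcases eq_or_ne θ₀ θ with heq | hne
  · intro α hα
    rw [← heq, uIcc_self, mem_singleton_iff] at hα
    rw [hα, hθ₀, mul_exp_angleFrom, hu₀]
  · have hclosed : IsClosed {α : ℝ | E (ν * Circle.exp α) = ζ} :=
      isClosed_eq (hP.continuous_endpoint.comp (continuous_const.mul Circle.exp.continuous)) continuous_const
    have h1 := hclosed.closure_subset_iff.2 hmain
    rw [closure_Ioo (min_lt_max.2 hne).ne] at h1
    exact h1

end Boundary

/-! ### Minimal surfaces as real parts of null curves -/

/-- `F` is a holomorphic null curve in `ℂ³`, defined in the disk and with derivative `χ`, such that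
the minimal surface `Re F` has first fundamental form `e^{2σ} |dz|²`. -/
structure IsNullCurve (F χ : Fin 3 → ℂ → ℂ) (σ : ℂ → ℝ) : Prop where
  hasDerivAt : ∀ j, ∀ z ∈ ball (0 : ℂ) 1, HasDerivAt (F j) (χ j z) z
  null : ∀ z ∈ ball (0 : ℂ) 1, ∑ j, χ j z ^ 2 = 0
  norm_sq : ∀ z ∈ ball (0 : ℂ) 1, ∑ j, ‖χ j z‖ ^ 2 = 2 * Real.exp (2 * σ z)

/-- Allows Wirtinger derivatives to be read off from derivatives along real lines. -/
theorem eq_of_forall_mul_add_mul_conj {a b a' b' : ℂ} (h : ∀ v, a * v + b * conj v = a' * v + b' * conj v) :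
    a = a' ∧ b = b' := by
  have h1 := h 1
  have h2 := h I
  simp only [mul_one, map_one, conj_I] at h1 h2
  have hI : I * I = -1 := I_mul_I
  constructor
  · linear_combination h1 / 2 - I * h2 / 2 + (a - b - a' + b') / 2 * hI
  · linear_combination h1 / 2 + I * h2 / 2 - (a - b - a' + b') / 2 * hI

theorem hasDerivAt_line (z v : ℂ) : HasDerivAt (fun t : ℝ => z + t * v) v 0 := by
  simpa using ((hasDerivAt_id (0 : ℝ)).ofReal_comp.mul_const v).const_add z

theorem HasDerivAt.unique_line {f g : ℂ → ℂ} {z v a b : ℂ} (hfg : f =ᶠ[𝓝 z] g)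
    (hf : HasDerivAt (fun t : ℝ => f (z + t * v)) a 0) (hg : HasDerivAt (fun t : ℝ => g (z + t * v)) b 0) :
    a = b := by
  refine hf.unique (hg.congr_of_eventuallyEq ?_)
  have h1 : Tendsto (fun t : ℝ => z + t * v) (𝓝 0) (𝓝 z) := by
    simpa using (hasDerivAt_line z v).continuousAt.tendsto
  exact h1.eventually hfg

namespace IsNullCurve

variable {F χ : Fin 3 → ℂ → ℂ} {σ : ℂ → ℝ}

theorem differentiableAt (h : IsNullCurve F χ σ) {z : ℂ} (hz : z ∈ ball (0 : ℂ) 1) (j : Fin 3) :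
    DifferentiableAt ℂ (χ j) z := by
  have h1 : DifferentiableOn ℂ (F j) (ball 0 1) := fun w hw =>
    (h.hasDerivAt j w hw).differentiableAt.differentiableWithinAt
  refine ((h1.deriv isOpen_ball).congr fun w hw => ?_).differentiableAt (isOpen_ball.mem_nhds hz)
  exact (h.hasDerivAt j w hw).deriv.symm

theorem sum_mul_conj_eq (h : IsNullCurve F χ σ) {z : ℂ} (hz : z ∈ ball (0 : ℂ) 1) :
    ∑ j, χ j z * conj (χ j z) = ((2 * Real.exp (2 * σ z) : ℝ) : ℂ) := by
  rw [← h.norm_sq z hz]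
  push_cast
  exact Finset.sum_congr rfl fun j _ => by rw [mul_conj, normSq_eq_norm_sq]; push_cast; rfl

theorem contDiffOn_exponent (h : IsNullCurve F χ σ) : ContDiffOn ℝ ∞ σ (ball 0 1) := by
  have h1 : ∀ j, ContDiffOn ℝ ∞ (χ j) (ball 0 1) := fun j =>
    ((DifferentiableOn.contDiffOn (fun z hz => (h.differentiableAt hz j).differentiableWithinAt)
      isOpen_ball : ContDiffOn ℂ ∞ (χ j) (ball 0 1))).restrict_scalars ℝ
  have h2 : ContDiffOn ℝ ∞ (fun z => Real.log ((∑ j, ‖χ j z‖ ^ 2) / 2) / 2) (ball 0 1) := by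
    refine (ContDiffOn.log ((ContDiffOn.sum fun j _ => (h1 j).norm_sq ℝ).div_const 2) fun z hz => ?_).div_const 2
    rw [h.norm_sq z hz]
    positivity
  refine h2.congr fun z hz => ?_
  rw [h.norm_sq z hz, mul_div_cancel_left₀ _ two_ne_zero, Real.log_exp]
  ring

theorem sum_deriv_mul (h : IsNullCurve F χ σ) {z : ℂ} (hz : z ∈ ball (0 : ℂ) 1) :
    ∑ j, deriv (χ j) z * χ j z = 0 := by
  have h1 : HasDerivAt (fun z => ∑ j, χ j z ^ 2) (∑ j, 2 * χ j z * deriv (χ j) z) z := by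
    refine HasDerivAt.fun_sum fun j _ => ?_
    exact ((h.differentiableAt hz j).hasDerivAt.pow 2).congr_deriv (by simp)
  have h2 : HasDerivAt (fun z => ∑ j, χ j z ^ 2) 0 z := by
    refine (hasDerivAt_const z (0 : ℂ)).congr_of_eventuallyEq ?_
    filter_upwards [isOpen_ball.mem_nhds hz] with w hw using h.null w hw
  have h3 := h1.unique h2
  rw [Fin.sum_univ_three] at h3 ⊢
  linear_combination h3 / 2

theorem hasDerivAt_along (h : IsNullCurve F χ σ) {z : ℂ} (hz : z ∈ ball (0 : ℂ) 1) (j : Fin 3) (v : ℂ) :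
    HasDerivAt (fun t : ℝ => χ j (z + t * v)) (deriv (χ j) z * v) 0 := by
  have h1 : HasDerivAt (χ j) (deriv (χ j) z) (z + (0 : ℝ) * v) := by
    simpa using (h.differentiableAt hz j).hasDerivAt
  exact h1.comp (0 : ℝ) (hasDerivAt_line z v)

theorem hasDerivAt_exp_along {σ : ℂ → ℝ} {z : ℂ} (hσ : DifferentiableAt ℝ σ z) (v : ℂ) :
    HasDerivAt (fun t : ℝ => ((2 * Real.exp (2 * σ (z + t * v)) : ℝ) : ℂ))
      ((2 * Real.exp (2 * σ z) : ℝ) * (2 * gradZ σ z * v + conj (2 * gradZ σ z * v))) 0 := by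
  have h1 : DifferentiableAt ℝ σ (z + (0 : ℝ) * v) := by simpa using hσ
  have h2 := HasDerivWithinAt.comp_gradZ (γ := fun t : ℝ => z + t * v) (s := univ) h1
    (hasDerivAt_line z v).hasDerivWithinAt
  rw [hasDerivWithinAt_univ] at h2
  have h3 := (((h2.const_mul 2).exp).const_mul 2).ofReal_comp
  refine h3.congr_deriv ?_
  rw [← re_add_im (gradZ σ z), ← re_add_im v]
  apply Complex.ext <;> simp <;> ring

/-- Differentiate `∑ |χ_j|² = 2 e^{2σ}` in the direction `v` and compare the coefficients of `v`. -/
theorem sum_deriv_mul_conj (h : IsNullCurve F χ σ) {z : ℂ} (hz : z ∈ ball (0 : ℂ) 1) :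
    ∑ j, deriv (χ j) z * conj (χ j z) = 2 * gradZ σ z * (2 * Real.exp (2 * σ z) : ℝ) := by
  have hσ := (contDiffAt_two h.contDiffOn_exponent hz).differentiableAt (by norm_num)
  refine (eq_of_forall_mul_add_mul_conj (b := conj (∑ j, deriv (χ j) z * conj (χ j z)))
    (b' := conj (2 * gradZ σ z * (2 * Real.exp (2 * σ z) : ℝ))) fun v => ?_).1
  have h1 : HasDerivAt (fun t : ℝ => ∑ j, χ j (z + t * v) * conj (χ j (z + t * v)))
      (∑ j, (deriv (χ j) z * v * conj (χ j z) + χ j z * conj (deriv (χ j) z * v))) 0 := by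
    refine HasDerivAt.fun_sum fun j _ => ?_
    have h2 := h.hasDerivAt_along hz j v
    exact (h2.mul h2.star).congr_deriv (by simp)
  have h3 := HasDerivAt.unique_line (f := fun z => ∑ j, χ j z * conj (χ j z))
    (g := fun z => ((2 * Real.exp (2 * σ z) : ℝ) : ℂ)) (by
      filter_upwards [isOpen_ball.mem_nhds hz] with w hw using h.sum_mul_conj_eq hw) h1
    (hasDerivAt_exp_along hσ v)
  simp only [Fin.sum_univ_three, map_add, map_mul, conj_conj, conj_ofReal, map_ofNat] at h3 ⊢
  linear_combination h3

/-- Differentiate `sum_deriv_mul_conj` in turn and compare the coefficients of `v̄`. -/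
theorem sum_deriv_mul_conj_deriv (h : IsNullCurve F χ σ) {z : ℂ} (hz : z ∈ ball (0 : ℂ) 1) :
    ∑ j, deriv (χ j) z * conj (deriv (χ j) z) =
      (2 * Real.exp (2 * σ z) : ℝ) * (2 * dzdzbar σ z + 4 * (gradZ σ z * conj (gradZ σ z))) := by
  have hσ2 := contDiffAt_two h.contDiffOn_exponent hz
  have hσ := hσ2.differentiableAt (by norm_num)
  refine (eq_of_forall_mul_add_mul_conj (a := ∑ j, deriv (deriv (χ j)) z * conj (χ j z))
    (a' := (2 * Real.exp (2 * σ z) : ℝ) * (2 * dz (gradZ σ) z + 4 * gradZ σ z ^ 2)) fun v => ?_).2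
  have h1 : HasDerivAt (fun t : ℝ => ∑ j, deriv (χ j) (z + t * v) * conj (χ j (z + t * v)))
      (∑ j, (deriv (deriv (χ j)) z * v * conj (χ j z) + deriv (χ j) z * conj (deriv (χ j) z * v))) 0 := by
    refine HasDerivAt.fun_sum fun j _ => ?_
    have h2 := h.hasDerivAt_along hz j v
    have h3 : DifferentiableOn ℂ (χ j) (ball 0 1) := fun w hw => (h.differentiableAt hw j).differentiableWithinAt
    have h4 : HasDerivAt (deriv (χ j)) (deriv (deriv (χ j)) z) (z + (0 : ℝ) * v) := by
      simpa using ((h3.deriv isOpen_ball).differentiableAt (isOpen_ball.mem_nhds hz)).hasDerivAt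
    have h5 := h4.comp (0 : ℝ) (hasDerivAt_line z v)
    exact (h5.mul h2.star).congr_deriv (by simp)
  have hdz : DifferentiableAt ℝ (gradZ σ) (z + (0 : ℝ) * v) := by
    simpa using (hasFDerivAt_gradZ hσ2).differentiableAt
  have h6 := HasDerivWithinAt.comp_dz (γ := fun t : ℝ => z + t * v) (s := univ) hdz
    (hasDerivAt_line z v).hasDerivWithinAt
  rw [hasDerivWithinAt_univ] at h6
  have h7 := (h6.const_mul 2).mul (hasDerivAt_exp_along hσ v)
  have h3 := HasDerivAt.unique_line (f := fun z => ∑ j, deriv (χ j) z * conj (χ j z))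
    (g := fun z => 2 * gradZ σ z * (2 * Real.exp (2 * σ z) : ℝ)) (by
      filter_upwards [isOpen_ball.mem_nhds hz] with w hw using h.sum_deriv_mul_conj hw) h1 h7
  simp only [ofReal_zero, zero_mul, add_zero, dzbar_gradZ_eq hσ2] at h3
  simp only [Fin.sum_univ_three, map_mul, map_ofNat] at h3 ⊢
  linear_combination h3

end IsNullCurve

/-! ### Geodesics on minimal surfaces satisfying the curvature criterion -/

/-- The two orthogonality relations kill the cross term, and `b` being null gives `‖Im b‖² = ‖b‖² /
2`; only `‖Im a‖²` is lost. -/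
theorem sum_sq_re_add_le {a b : Fin 3 → ℂ} (x : ℝ) (hab : ∑ j, a j * b j = 0)
    (hab' : ∑ j, a j * conj (b j) = 0) (hb : ∑ j, b j ^ 2 = 0) :
    ∑ j, ((a j).re + x * (b j).im) ^ 2 ≤ ∑ j, ‖a j‖ ^ 2 + x ^ 2 * (∑ j, ‖b j‖ ^ 2 / 2) := by
  have h1 := congrArg im hab
  have h2 := congrArg im hab'
  have h3 := congrArg re hb
  simp only [Fin.sum_univ_three, pow_two, add_im, mul_im, conj_re, conj_im, add_re, mul_re, zero_re,
    zero_im] at h1 h2 h3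
  simp only [Fin.sum_univ_three, ← normSq_eq_norm_sq, normSq_apply]
  have h4 : (a 0).re * (b 0).im + (a 1).re * (b 1).im + (a 2).re * (b 2).im = 0 := by linarith
  have h5 : (b 0).im ^ 2 + (b 1).im ^ 2 + (b 2).im ^ 2 = ((b 0).re ^ 2 + (b 1).re ^ 2 + (b 2).re ^ 2
      + (b 0).im ^ 2 + (b 1).im ^ 2 + (b 2).im ^ 2) / 2 := by linarith
  have h6 := sq_nonneg (a 0).im
  have h7 := sq_nonneg (a 1).im
  have h8 := sq_nonneg (a 2).im
  have e : (((a 0).re + x * (b 0).im) ^ 2 + ((a 1).re + x * (b 1).im) ^ 2 + ((a 2).re + x * (b 2).im) ^ 2)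
      = (a 0).re ^ 2 + (a 1).re ^ 2 + (a 2).re ^ 2 + 2 * x * ((a 0).re * (b 0).im + (a 1).re * (b 1).im + (a 2).re * (b 2).im)
        + x ^ 2 * ((b 0).im ^ 2 + (b 1).im ^ 2 + (b 2).im ^ 2) := by ring
  rw [e, h4, h5]
  nlinarith

/-- The point of Euclidean space whose coordinates are the real parts of those of `x`. -/
noncomputable def rePoint (x : Fin 3 → ℂ) : EuclideanSpace ℝ (Fin 3) := WithLp.toLp 2 fun j => (x j).re

theorem norm_sq_rePoint (x : Fin 3 → ℂ) : ‖rePoint x‖ ^ 2 = ∑ j, (x j).re ^ 2 := by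
  rw [EuclideanSpace.real_norm_sq_eq]
  rfl

theorem norm_sq_rePoint_of_null {x : Fin 3 → ℂ} (hx : ∑ j, x j ^ 2 = 0) :
    ‖rePoint x‖ ^ 2 = (∑ j, ‖x j‖ ^ 2) / 2 := by
  have h3 := congrArg re hx
  rw [norm_sq_rePoint]
  simp only [Fin.sum_univ_three, pow_two, add_re, mul_re, zero_re] at h3
  simp only [Fin.sum_univ_three, ← normSq_eq_norm_sq, normSq_apply]
  linarith

theorem HasDerivWithinAt.rePoint {x : ℝ → Fin 3 → ℂ} {x' : Fin 3 → ℂ} {s : Set ℝ} {t : ℝ}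
    (h : ∀ j, HasDerivWithinAt (fun t => x t j) (x' j) s t) :
    HasDerivWithinAt (fun t => rePoint (x t)) (rePoint x') s t := by
  have h1 : HasDerivWithinAt (fun t => fun j => (x t j).re) (fun j => (x' j).re) s t :=
    hasDerivWithinAt_pi.2 fun j => reCLM.hasFDerivAt.comp_hasDerivWithinAt t (h j)
  exact (PiLp.continuousLinearEquiv 2 ℝ (fun _ : Fin 3 => ℝ)).symm.hasFDerivAt.comp_hasDerivWithinAt t h1

namespace IsNullCurve

variable {F χ : Fin 3 → ℂ → ℂ} {σ ρ : ℂ → ℝ}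

/-- `χ' - 2 σ_z χ` is the part of `χ'` Hermitian-orthogonal to `χ`. It carries the second
fundamental form, so the curvature determines its size. -/
theorem sum_norm_sq_deriv_sub (h : IsNullCurve F χ σ) {z : ℂ} (hz : z ∈ ball (0 : ℂ) 1) :
    ∑ j, ‖deriv (χ j) z - 2 * gradZ σ z * χ j z‖ ^ 2 = 2 * dzdzbar σ z * (2 * Real.exp (2 * σ z)) := by
  have h1 := h.sum_mul_conj_eq hz
  have h2 := h.sum_deriv_mul_conj hz
  have h3 := h.sum_deriv_mul_conj_deriv hz
  have h2' := congrArg conj h2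
  have e : ∀ w : ℂ, ((‖w‖ ^ 2 : ℝ) : ℂ) = w * conj w := fun w => by
    rw [mul_conj, normSq_eq_norm_sq]
  apply ofReal_injective
  rw [ofReal_sum]
  simp only [e]
  simp only [Fin.sum_univ_three, map_sub, map_mul, map_add, conj_conj, map_ofNat, conj_ofReal] at h1 h2 h2' h3 ⊢
  push_cast at h1 h2 h2' h3 ⊢
  linear_combination h3 - 2 * conj (gradZ σ z) * h2 - 2 * gradZ σ z * h2' +
    4 * gradZ σ z * conj (gradZ σ z) * h1

theorem sum_deriv_sub_mul (h : IsNullCurve F χ σ) {z : ℂ} (hz : z ∈ ball (0 : ℂ) 1) :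
    ∑ j, (deriv (χ j) z - 2 * gradZ σ z * χ j z) * χ j z = 0 := by
  have h1 := h.sum_deriv_mul hz
  have h2 := h.null z hz
  simp only [Fin.sum_univ_three] at h1 h2 ⊢
  linear_combination h1 - 2 * gradZ σ z * h2

theorem sum_deriv_sub_mul_conj (h : IsNullCurve F χ σ) {z : ℂ} (hz : z ∈ ball (0 : ℂ) 1) :
    ∑ j, (deriv (χ j) z - 2 * gradZ σ z * χ j z) * conj (χ j z) = 0 := by
  have h1 := h.sum_deriv_mul_conj hz
  have h2 := h.sum_mul_conj_eq hz
  simp only [Fin.sum_univ_three] at h1 h2 ⊢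
  linear_combination h1 - 2 * gradZ σ z * h2

/-- With `μ = (ρ_z - σ_z) v`, removing the tangential acceleration leaves the surface-normal term
`Re((χ' - 2 σ_z χ) v²)` and the geodesic curvature term `2 Im μ · Im(χ v)`, which are orthogonal. -/
theorem norm_sq_bend_le (h : IsNullCurve F χ σ) {z v : ℂ} (hz : z ∈ ball (0 : ℂ) 1)
    (hv : Real.exp (ρ z) * ‖v‖ = 1) :
    ‖rePoint (fun j => deriv (χ j) z * v ^ 2 - 2 * gradZ ρ z * χ j z * v ^ 2) +
        (2 * ((gradZ ρ z - gradZ σ z) * v).re) • rePoint (fun j => χ j z * v)‖ ^ 2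
      * Real.exp ((ρ z - σ z) / 2) ^ 4 / 4 ≤
      ((gradZ ρ z - gradZ σ z) * v).im ^ 2 + dzdzbar σ z * ‖v‖ ^ 2 := by
  set μ := (gradZ ρ z - gradZ σ z) * v with hμ
  have e1 : rePoint (fun j => deriv (χ j) z * v ^ 2 - 2 * gradZ ρ z * χ j z * v ^ 2) +
      (2 * μ.re) • rePoint (fun j => χ j z * v) =
      WithLp.toLp 2 fun j => ((deriv (χ j) z - 2 * gradZ σ z * χ j z) * v ^ 2).re
        + 2 * μ.im * (χ j z * v).im := by
    ext j
    change (deriv (χ j) z * v ^ 2 - 2 * gradZ ρ z * χ j z * v ^ 2).re + (2 * μ.re) * (χ j z * v).re = 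
      ((deriv (χ j) z - 2 * gradZ σ z * χ j z) * v ^ 2).re + 2 * μ.im * (χ j z * v).im
    have e2 : deriv (χ j) z * v ^ 2 - 2 * gradZ ρ z * χ j z * v ^ 2 =
      (deriv (χ j) z - 2 * gradZ σ z * χ j z) * v ^ 2 - 2 * (μ * (χ j z * v)) := by rw [hμ]; ring
    rw [e2, sub_re, show (2 * (μ * (χ j z * v))).re = 2 * (μ * (χ j z * v)).re by simp, mul_re μ]
    ring
  rw [e1, EuclideanSpace.real_norm_sq_eq]
  have h1 := h.sum_deriv_sub_mul hz
  have h2 := h.sum_deriv_sub_mul_conj hz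
  have h3 := h.null z hz
  have h4 := h.sum_norm_sq_deriv_sub hz
  have h5 := h.norm_sq z hz
  have key := sum_sq_re_add_le (a := fun j => (deriv (χ j) z - 2 * gradZ σ z * χ j z) * v ^ 2)
    (b := fun j => χ j z * v) (2 * μ.im)
    (by simp only [Fin.sum_univ_three] at h1 ⊢; linear_combination v ^ 3 * h1)
    (by simp only [Fin.sum_univ_three, map_mul] at h2 ⊢; linear_combination v ^ 2 * conj v * h2)
    (by simp only [Fin.sum_univ_three] at h3 ⊢; linear_combination v ^ 2 * h3)
  have e3 : ∑ j, ‖(deriv (χ j) z - 2 * gradZ σ z * χ j z) * v ^ 2‖ ^ 2 =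
      4 * dzdzbar σ z * Real.exp (2 * σ z) * ‖v‖ ^ 4 := by
    simp only [Fin.sum_univ_three, norm_mul, norm_pow, mul_pow] at h4 ⊢
    linear_combination ‖v‖ ^ 4 * h4
  have e4 : ∑ j, ‖χ j z * v‖ ^ 2 / 2 = Real.exp (2 * σ z) * ‖v‖ ^ 2 := by
    simp only [Fin.sum_univ_three, norm_mul, mul_pow] at h5 ⊢
    linear_combination ‖v‖ ^ 2 / 2 * h5
  rw [e3, e4] at key
  have e5 : Real.exp ((ρ z - σ z) / 2) ^ 4 * Real.exp (2 * σ z) = Real.exp (ρ z) ^ 2 := by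
    rw [← Real.exp_nat_mul, ← Real.exp_nat_mul, ← Real.exp_add]
    congr 1
    push_cast
    ring
  have hv2 : Real.exp (ρ z) ^ 2 * ‖v‖ ^ 2 = 1 := by rw [← mul_pow, hv, one_pow]
  have hpos : 0 < Real.exp ((ρ z - σ z) / 2) ^ 4 / 4 := by positivity
  have h6 := mul_le_mul_of_nonneg_right key hpos.le
  rw [mul_div_assoc]
  refine h6.trans_eq ?_
  linear_combination (dzdzbar σ z * ‖v‖ ^ 4 + μ.im ^ 2 * ‖v‖ ^ 2) * e5 +
    (dzdzbar σ z * ‖v‖ ^ 2 + μ.im ^ 2) * hv2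

/-- With `μ = (ρ_z - σ_z) v`, the difference `(Re μ)² - (Im μ)² = Re μ²` merges with the second
derivatives into half of `-Re` of the Schwarzian difference times `v²`. The mixed terms add up to
`(ρ_{z z̄} - 2 σ_{z z̄}) |v|²`, and `4 σ_{z z̄} = -e^{2σ} K ≤ e^{2σ} |K|` lets the criterion give
exactly `-c`. -/
theorem neg_le_of_criterion (h : IsNullCurve F χ σ) {c : ℝ}
    {z v : ℂ} (hz : z ∈ ball (0 : ℂ) 1)
    (hcrit : ‖conformalSchwarzian σ z - conformalSchwarzian ρ z‖
          + Real.exp (2 * σ z) * |gaussCurvature σ z| ≤ 2 * c * Real.exp (2 * ρ z) + 2 * dzdzbar ρ z)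
    (hv : Real.exp (ρ z) * ‖v‖ = 1) :
    -c ≤ ((gradZ ρ z - gradZ σ z) * v).re ^ 2 +
      (((dz (gradZ ρ) z - dz (gradZ σ) z - 2 * gradZ ρ z * (gradZ ρ z - gradZ σ z)) * v ^ 2).re +
        (dzdzbar ρ z - dzdzbar σ z) * ‖v‖ ^ 2) -
      ‖rePoint (fun j => deriv (χ j) z * v ^ 2 - 2 * gradZ ρ z * χ j z * v ^ 2) +
        (2 * ((gradZ ρ z - gradZ σ z) * v).re) • rePoint (fun j => χ j z * v)‖ ^ 2
      * Real.exp ((ρ z - σ z) / 2) ^ 4 / 4 := by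
  have h1 := h.norm_sq_bend_le hz hv
  have h2 := gaussCurvature_eq (contDiffAt_two h.contDiffOn_exponent hz)
  have h3 : 4 * dzdzbar σ z ≤ Real.exp (2 * σ z) * |gaussCurvature σ z| := by
    have : Real.exp (2 * σ z) * |gaussCurvature σ z| = |Real.exp (2 * σ z) * gaussCurvature σ z| := by
      rw [abs_mul, abs_of_pos (Real.exp_pos _)]
    rw [this, h2, abs_neg]
    exact le_abs_self _
  have hv2 : Real.exp (2 * ρ z) * ‖v‖ ^ 2 = 1 := by
    have : Real.exp (2 * ρ z) = Real.exp (ρ z) ^ 2 := by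
      rw [← Real.exp_nat_mul]; congr 1
    rw [this, ← mul_pow, hv, one_pow]
  have h4 : ((conformalSchwarzian σ z - conformalSchwarzian ρ z) * v ^ 2).re ≤
      ‖conformalSchwarzian σ z - conformalSchwarzian ρ z‖ * ‖v‖ ^ 2 := by
    refine (re_le_norm _).trans_eq ?_
    rw [norm_mul, norm_pow]
  have h5 : ‖conformalSchwarzian σ z - conformalSchwarzian ρ z‖ * ‖v‖ ^ 2 ≤
      (2 * c * Real.exp (2 * ρ z) + 2 * dzdzbar ρ z - 4 * dzdzbar σ z) * ‖v‖ ^ 2 :=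
    mul_le_mul_of_nonneg_right (by linarith) (sq_nonneg _)
  have e : ((gradZ ρ z - gradZ σ z) * v).re ^ 2 +
      ((dz (gradZ ρ) z - dz (gradZ σ) z - 2 * gradZ ρ z * (gradZ ρ z - gradZ σ z)) * v ^ 2).re -
      ((gradZ ρ z - gradZ σ z) * v).im ^ 2 =
      -((conformalSchwarzian σ z - conformalSchwarzian ρ z) * v ^ 2).re / 2 := by
    have e1 : ∀ w : ℂ, w.re ^ 2 - w.im ^ 2 = (w ^ 2).re := fun w => by rw [pow_two w, mul_re]; ring
    have e2 : ∀ w : ℂ, -w.re / 2 = (-w / 2).re := fun w => by simp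
    have e3 : ∀ x y w : ℝ, x + y - w = (x - w) + y := fun x y w => by ring
    rw [e3, e1, e2, ← add_re]
    congr 1
    change _ = -((2 * (dz (gradZ σ) z - gradZ σ z ^ 2) - 2 * (dz (gradZ ρ) z - gradZ ρ z ^ 2)) * v ^ 2) / 2
    ring
  have h6 : (2 * c * Real.exp (2 * ρ z) + 2 * dzdzbar ρ z - 4 * dzdzbar σ z) * ‖v‖ ^ 2 =
      2 * c + (2 * dzdzbar ρ z - 4 * dzdzbar σ z) * ‖v‖ ^ 2 := by linear_combination 2 * c * hv2
  rw [h6] at h5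
  linarith

/-- The factor is `V = e^{(ρ - σ)/2}` because a unit-speed geodesic of `e^{2ρ} |dz|²` has speed
`e^{σ - ρ} = V⁻²` on the surface. -/
theorem isControlledCurve (h : IsNullCurve F χ σ) {c : ℝ} (hρ : ContDiffOn ℝ ∞ ρ (ball 0 1))
    (hcrit : ∀ z ∈ ball (0 : ℂ) 1, ‖conformalSchwarzian σ z - conformalSchwarzian ρ z‖
          + Real.exp (2 * σ z) * |gaussCurvature σ z| ≤ 2 * c * Real.exp (2 * ρ z) + 2 * dzdzbar ρ z)
    {y : ℂ × ℂ} {s : ℝ} {α : ℝ → ℂ × ℂ} (hα : SolvesOn (geodesicField ρ) phaseSpace y s α)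
    (hy : Real.exp (ρ y.1) * ‖y.2‖ = 1) :
    IsControlledCurve c s (fun t => rePoint fun j => F j (α t).1)
      (fun t => rePoint fun j => χ j (α t).1 * (α t).2)
      (fun t => rePoint fun j => deriv (χ j) (α t).1 * (α t).2 ^ 2
        - 2 * gradZ ρ (α t).1 * χ j (α t).1 * (α t).2 ^ 2)
      (fun t => Real.exp ((ρ (α t).1 - σ (α t).1) / 2))
      (fun t => Real.exp ((ρ (α t).1 - σ (α t).1) / 2) * ((gradZ ρ (α t).1 - gradZ σ (α t).1) * (α t).2).re)
      (fun t => Real.exp ((ρ (α t).1 - σ (α t).1) / 2) * (((gradZ ρ (α t).1 - gradZ σ (α t).1) * (α t).2).re ^ 2 +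
      (((dz (gradZ ρ) (α t).1 - dz (gradZ σ) (α t).1
        - 2 * gradZ ρ (α t).1 * (gradZ ρ (α t).1 - gradZ σ (α t).1)) * (α t).2 ^ 2).re +
        (dzdzbar ρ (α t).1 - dzdzbar σ (α t).1) * ‖(α t).2‖ ^ 2))) := by
  have hmem : ∀ t ∈ Icc 0 s, (α t).1 ∈ ball (0 : ℂ) 1 := fun t ht => (hα.mem t ht).1
  have hspeed : ∀ t ∈ Icc 0 s, Real.exp (ρ (α t).1) * ‖(α t).2‖ = 1 := fun t ht => by
    rw [hα.speed hρ t ht, hy]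
  have hσ := h.contDiffOn_exponent
  have hV : ∀ t ∈ Icc 0 s, HasDerivWithinAt (fun t => Real.exp ((ρ (α t).1 - σ (α t).1) / 2))
      (Real.exp ((ρ (α t).1 - σ (α t).1) / 2) * ((gradZ ρ (α t).1 - gradZ σ (α t).1) * (α t).2).re)
      (Icc 0 s) t := by
    intro t ht
    have h1 := hα.hasDerivWithinAt_fst ht
    have h2 := h1.comp_gradZ ((contDiffAt_two hρ (hmem t ht)).differentiableAt (by norm_num))
    have h3 := h1.comp_gradZ ((contDiffAt_two hσ (hmem t ht)).differentiableAt (by norm_num))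
    refine ((h2.sub h3).div_const 2).exp.congr_deriv ?_
    rw [sub_mul, sub_re]
    simp only [Pi.sub_apply]
    ring
  refine ⟨fun t ht => ?_, fun t ht => ?_, hV, fun t ht => ?_, fun t ht => Real.exp_pos _, fun t ht => ?_,
    fun t ht => ?_⟩
  · exact HasDerivWithinAt.rePoint fun j =>
      (h.hasDerivAt j _ (hmem t ht)).comp_hasDerivWithinAt t (hα.hasDerivWithinAt_fst ht)
  · refine HasDerivWithinAt.rePoint fun j => ?_
    have h1 := (h.differentiableAt (hmem t ht) j).hasDerivAt.comp_hasDerivWithinAt t (hα.hasDerivWithinAt_fst ht)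
    refine (h1.mul (hα.hasDerivWithinAt_snd ht)).congr_deriv ?_
    simp only [Function.comp_apply]
    ring
  · have h1 := hα.hasDerivWithinAt_fst ht
    have hρ2 := contDiffAt_two hρ (hmem t ht)
    have hσ2 := contDiffAt_two hσ (hmem t ht)
    have h2 := h1.comp_dz (hasFDerivAt_gradZ hρ2).differentiableAt
    have h3 := h1.comp_dz (hasFDerivAt_gradZ hσ2).differentiableAt
    have h4 := reCLM.hasFDerivAt.comp_hasDerivWithinAt t ((h2.sub h3).mul (hα.hasDerivWithinAt_snd ht))
    refine ((hV t ht).mul h4).congr_deriv ?_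
    rw [dzbar_gradZ_eq hρ2, dzbar_gradZ_eq hσ2]
    simp only [Function.comp_apply, reCLM_apply, Pi.sub_apply, Pi.mul_apply, ← normSq_eq_norm_sq]
    generalize (α t).2 = v
    generalize gradZ ρ (α t).1 = p
    generalize gradZ σ (α t).1 = q
    generalize dz (gradZ ρ) (α t).1 = p'
    generalize dz (gradZ σ) (α t).1 = q'
    simp only [normSq_apply, pow_two, add_re, add_im, sub_re, sub_im, mul_re, mul_im, neg_re, neg_im,
      ofReal_re, ofReal_im, conj_re, conj_im, re_ofNat, im_ofNat]
    ring
  · have h1 := h.norm_sq _ (hmem t ht)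
    have h2 := h.null _ (hmem t ht)
    rw [← sq_eq_sq₀ (norm_nonneg _) (by positivity), norm_sq_rePoint_of_null (by
      simp only [Fin.sum_univ_three] at h2 ⊢; linear_combination (α t).2 ^ 2 * h2)]
    have e1 : (∑ j, ‖χ j (α t).1 * (α t).2‖ ^ 2) / 2 = Real.exp (2 * σ (α t).1) * ‖(α t).2‖ ^ 2 := by
      simp only [Fin.sum_univ_three, norm_mul, mul_pow] at h1 ⊢
      linear_combination ‖(α t).2‖ ^ 2 / 2 * h1
    have e2 : ‖(α t).2‖ = Real.exp (-ρ (α t).1) := by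
      rw [Real.exp_neg]
      exact eq_inv_of_mul_eq_one_right (hspeed t ht)
    rw [e1, e2, ← Real.exp_nat_mul, ← Real.exp_nat_mul, ← Real.exp_neg, ← Real.exp_nat_mul, ← Real.exp_add]
    congr 1
    push_cast
    ring
  · have h1 := h.neg_le_of_criterion (hmem t ht) (hcrit _ (hmem t ht)) (hspeed t ht)
    have e1 : ∀ x y : ℝ, x ≠ 0 → x * y / x = y := fun x y hx => by field_simp
    rw [e1 _ _ (Real.exp_ne_zero _), e1 _ _ (Real.exp_ne_zero _)]
    exact h1

end IsNullCurve

/-! ### The null curve of a harmonic mapping -/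

/-- The square of `h' q` agrees off isolated points with the analytic `h' g'`, so `h' q` has
nonnegative order everywhere; its meromorphic normal form is analytic. -/
theorem DilatationIsSquare.exists_sqrt {f h g q : ℂ → ℂ} {a : ℂ} (hf : IsCanonicalDecomposition f h g a)
    (hq : DilatationIsSquare h g q) :
    ∃ κ : ℂ → ℂ, DifferentiableOn ℂ κ (ball 0 1) ∧
      (∀ z ∈ ball (0 : ℂ) 1, κ z ^ 2 = deriv h z * deriv g z) ∧
      ∀ z ∈ ball (0 : ℂ) 1, ∀ᶠ w in 𝓝[≠] z, κ w = deriv h w * q w := by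
  have hh : DifferentiableOn ℂ (deriv h) (ball 0 1) := hf.analytic_h.deriv isOpen_ball
  have hg : DifferentiableOn ℂ (deriv g) (ball 0 1) := hf.analytic_g.deriv isOpen_ball
  have hha : AnalyticOnNhd ℂ (deriv h) (ball 0 1) := hh.analyticOnNhd isOpen_ball
  have hga : AnalyticOnNhd ℂ (deriv g) (ball 0 1) := hg.analyticOnNhd isOpen_ball
  have hne : ∀ z ∈ ball (0 : ℂ) 1, ∀ᶠ w in 𝓝[≠] z, deriv h w ≠ 0 := by
    intro z hz
    by_contra hcon
    obtain ⟨w, hw, hw0⟩ := hq.nontrivial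
    refine hw0 (hha.eqOn_zero_of_preconnected_of_frequently_eq_zero
      (convex_ball _ _).isPreconnected hz ?_ hw)
    exact fun h0 => hcon h0
  have hmer : MeromorphicOn (fun w => deriv h w * q w) (ball 0 1) := fun z hz =>
    (hha z hz).meromorphicAt.mul (hq.meromorphic z hz)
  have heq : ∀ z ∈ ball (0 : ℂ) 1, ∀ᶠ w in 𝓝[≠] z,
      toMeromorphicNFOn (fun w => deriv h w * q w) (ball 0 1) w = deriv h w * q w := fun z hz =>
    hmer.toMeromorphicNFOn_eq_self_on_nhdsNE hz
  set κ := toMeromorphicNFOn (fun w => deriv h w * q w) (ball 0 1) with hκ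
  have hsq : ∀ z ∈ ball (0 : ℂ) 1, ∀ᶠ w in 𝓝[≠] z, (κ ^ 2) w = (deriv h * deriv g) w := by
    intro z hz
    filter_upwards [heq z hz, hne z hz, (isOpen_ball.mem_nhds hz : ball (0 : ℂ) 1 ∈ 𝓝 z) |>
      mem_nhdsWithin_of_mem_nhds] with w h1 h2 h3
    have h4 := hq.eq_sq w h3 h2
    rw [div_eq_iff h2] at h4
    rw [Pi.pow_apply, Pi.mul_apply, h1, h4]
    ring
  have han : AnalyticOnNhd ℂ κ (ball 0 1) := by
    intro z hz
    have hnf : MeromorphicNFAt κ z := meromorphicNFOn_toMeromorphicNFOn _ _ hz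
    refine hnf.meromorphicOrderAt_nonneg_iff_analyticAt.1 ?_
    have h1 : 0 ≤ meromorphicOrderAt (κ ^ 2) z := by
      rw [meromorphicOrderAt_congr (hsq z hz)]
      exact ((hha z hz).mul (hga z hz)).meromorphicOrderAt_nonneg
    rw [meromorphicOrderAt_pow hnf.meromorphicAt] at h1
    by_contra! hcon
    lift meromorphicOrderAt κ z to ℤ using hcon.ne_top with n hn
    have h2 : n < 0 := by exact_mod_cast hcon
    have h3 : (0 : ℤ) ≤ 2 * n := by
      rw [← WithTop.coe_le_coe]
      simpa using h1
    omega
  refine ⟨κ, han.differentiableOn, fun z hz => ?_, heq⟩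
  have h1 : Tendsto (κ ^ 2) (𝓝[≠] z) (𝓝 (κ z ^ 2)) :=
    ((han z hz).continuousAt.pow 2).tendsto.mono_left nhdsWithin_le_nhds
  have h2 : Tendsto (deriv h * deriv g) (𝓝[≠] z) (𝓝 (deriv h z * deriv g z)) :=
    ((hha z hz).continuousAt.mul (hga z hz).continuousAt).tendsto.mono_left nhdsWithin_le_nhds
  exact tendsto_nhds_unique (h1.congr' (hsq z hz)) h2

/-- The integrands differ only at isolated points, which form a null set of parameters on the
segment. -/
theorem intervalIntegral_eq_sub_of_eventually_eq {φ κ k : ℂ → ℂ} {a z : ℂ} (ha : a ∈ ball (0 : ℂ) 1)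
    (hz : z ∈ ball (0 : ℂ) 1) (hk : ∀ w ∈ ball (0 : ℂ) 1, HasDerivAt k (κ w) w)
    (hκ : ContinuousOn κ (ball 0 1)) (hφ : ∀ w ∈ ball (0 : ℂ) 1, ∀ᶠ x in 𝓝[≠] w, κ x = φ x) :
    ∫ t in (0 : ℝ)..1, φ (a + t * (z - a)) * (z - a) = k z - k a := by
  rcases eq_or_ne z a with rfl | hza
  · simp
  have hmem : ∀ t ∈ Icc (0 : ℝ) 1, a + t * (z - a) ∈ ball (0 : ℂ) 1 := fun t ht => segment_mem_ball ha hz ht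
  have hd : ∀ t : ℝ, HasDerivAt (fun t : ℝ => a + t * (z - a)) (z - a) t := fun t => by
    simpa using ((hasDerivAt_id t).ofReal_comp.mul_const (z - a)).const_add a
  have hnull : MeasureTheory.volume {t : ℝ | t ∈ Icc (0 : ℝ) 1 ∧ κ (a + t * (z - a)) ≠ φ (a + t * (z - a))} = 0 := by
    refine MeasureTheory.measure_null_of_locally_null _ fun t ht => ⟨{t}, ?_, by simp⟩
    have h1 : Tendsto (fun t : ℝ => a + t * (z - a)) (𝓝[≠] t) (𝓝[≠] (a + t * (z - a))) :=
      (hd t).tendsto_nhdsNE (sub_ne_zero.2 hza)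
    have h2 := h1.eventually (hφ _ (hmem t ht.1))
    rw [eventually_nhdsWithin_iff] at h2
    filter_upwards [nhdsWithin_le_nhds h2, self_mem_nhdsWithin] with s hs hs'
    by_contra hst
    exact hs'.2 (hs hst)
  have h1 : ∫ t in (0 : ℝ)..1, φ (a + t * (z - a)) * (z - a) = ∫ t in (0 : ℝ)..1, κ (a + t * (z - a)) * (z - a) := by
    refine intervalIntegral.integral_congr_ae ?_
    rw [← MeasureTheory.compl_mem_ae_iff] at hnull
    filter_upwards [hnull] with t ht ht'
    rw [uIoc_of_le zero_le_one] at ht'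
    by_contra hcon
    exact ht ⟨Ioc_subset_Icc_self ht', fun h => hcon (by rw [h])⟩
  rw [h1, intervalIntegral.integral_eq_sub_of_hasDerivAt (f := fun t : ℝ => k (a + t * (z - a)))]
  · simp
  · intro t ht
    rw [uIcc_of_le zero_le_one] at ht
    exact (hk _ (hmem t ht)).comp t (hd t)
  · refine ContinuousOn.intervalIntegrable ?_
    rw [uIcc_of_le zero_le_one]
    exact (hκ.comp (fun t _ => (hd t).continuousAt.continuousWithinAt) hmem).mul continuousOn_const

/-- The curve is `(h + g, -i (h - g), -2 i k)` with `k' = κ` and `κ² = h' g'`. Nullity is `(h' +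
g')² - (h' - g')² = 4 h' g'`, and the parallelogram law turns the squared norm into `2 (|h'| +
|g'|)²`. -/
theorem exists_isNullCurve {f h g q : ℂ → ℂ} {a : ℂ} (hf : IsCanonicalDecomposition f h g a)
    (hq : DilatationIsSquare h g q) (hreg : ∀ z ∈ ball (0 : ℂ) 1, ‖deriv h z‖ + ‖deriv g z‖ ≠ 0) :
    ∃ F χ : Fin 3 → ℂ → ℂ, IsNullCurve F χ (liftExponent h g) ∧
      ∀ z ∈ ball (0 : ℂ) 1, harmonicLift f h q a z = rePoint fun j => F j z := by
  obtain ⟨κ, hκ, hκsq, hκq⟩ := hq.exists_sqrt hf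
  obtain ⟨k, hka, hk⟩ := hκ.isExactOn_ball.with_val_at a 0
  have hh : ∀ z ∈ ball (0 : ℂ) 1, HasDerivAt h (deriv h z) z := fun z hz =>
    (hf.analytic_h.differentiableAt (isOpen_ball.mem_nhds hz)).hasDerivAt
  have hg : ∀ z ∈ ball (0 : ℂ) 1, HasDerivAt g (deriv g z) z := fun z hz =>
    (hf.analytic_g.differentiableAt (isOpen_ball.mem_nhds hz)).hasDerivAt
  refine ⟨![fun z => h z + g z, fun z => -I * (h z - g z), fun z => -2 * I * k z],
    ![fun z => deriv h z + deriv g z, fun z => -I * (deriv h z - deriv g z), fun z => -2 * I * κ z],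
    ⟨fun j z hz => ?_, fun z hz => ?_, fun z hz => ?_⟩, fun z hz => ?_⟩
  · fin_cases j
    · exact (hh z hz).add (hg z hz)
    · exact ((hh z hz).sub (hg z hz)).const_mul (-I)
    · exact (hk z hz).const_mul (-2 * I)
  · have h1 := hκsq z hz
    simp only [Fin.sum_univ_three, Matrix.cons_val]
    linear_combination ((deriv h z - deriv g z) ^ 2 + 4 * κ z ^ 2) * I_sq - 4 * h1
  · have h1 := congrArg norm (hκsq z hz)
    have hpos : 0 < ‖deriv h z‖ + ‖deriv g z‖ := lt_of_le_of_ne (by positivity) (hreg z hz).symm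
    rw [norm_pow, norm_mul] at h1
    have h2 := parallelogram_law_with_norm ℝ (deriv h z) (deriv g z)
    have h3 : Real.exp (2 * liftExponent h g z) = (‖deriv h z‖ + ‖deriv g z‖) ^ 2 := by
      rw [liftExponent, ← Nat.cast_ofNat (R := ℝ) (n := 2), Real.exp_nat_mul, Real.exp_log hpos]
    simp only [Fin.sum_univ_three, Matrix.cons_val, norm_mul, norm_neg, norm_I, Complex.norm_ofNat]
    rw [h3]
    linear_combination h2 + 4 * h1
  · have h1 := intervalIntegral_eq_sub_of_eventually_eq (φ := fun w => deriv h w * q w) hf.base_mem hz hk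
      hκ.continuousOn hκq
    rw [hka, sub_zero] at h1
    ext j
    fin_cases j
    · change (f z).re = (h z + g z).re
      rw [hf.decomp z hz]; simp
    · change (f z).im = (-I * (h z - g z)).re
      rw [hf.decomp z hz]; simp; ring
    · change liftHeight h q a z = (-2 * I * k z).re
      rw [liftHeight, h1]; simp

/-! ### Growth along geodesic rays -/

theorem exists_lt_of_ofReal_lt {t : ℝ} {x : ℝ≥0∞} (h : ENNReal.ofReal t < x) :
    ∃ s, t < s ∧ 0 < s ∧ ENNReal.ofReal s < x := by
  obtain ⟨y, hty, hyx⟩ := exists_between h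
  have h0 : 0 < y := (zero_le (a := ENNReal.ofReal t)).trans_lt hty
  refine ⟨y.toReal, ?_, ENNReal.toReal_pos h0.ne' hyx.ne_top, by rwa [ENNReal.ofReal_toReal hyx.ne_top]⟩
  by_contra! hcon
  refine absurd hty (not_lt.2 ?_)
  rw [← ENNReal.ofReal_toReal hyx.ne_top]
  exact ENNReal.ofReal_le_ofReal hcon

/-- The strict bound `len u < δ` leaves slack inside a half-period `δ` of the sine, uniformly for
directions near `u`. For `δ = ∞` the solution `1 + t` serves. -/
theorem exists_comparison {len : Circle → ℝ≥0∞} (hlen : Continuous len) {δ : ℝ≥0∞} (hδ : 0 < δ) {u : Circle}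
    (h : δ ≠ ⊤ → len u < δ) :
    ∃ y y1 : ℝ → ℝ, (∀ t, HasDerivAt y (y1 t) t) ∧
      (∀ t, HasDerivAt y1 (-(Real.pi ^ 2 * (δ⁻¹).toReal ^ 2) * y t) t) ∧
      ∃ m > 0, ∃ N ∈ 𝓝 u, ∀ v ∈ N, ∀ t, 0 ≤ t → ENNReal.ofReal t < len v → m * (1 + t) ≤ y t := by
  rcases eq_or_ne δ ⊤ with rfl | hδt
  · refine ⟨fun t => 1 + t, fun _ => 1, fun t => (hasDerivAt_id t).const_add 1, fun t => ?_, 1, one_pos, univ,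
      univ_mem, fun v _ t _ _ => by linarith⟩
    simpa using hasDerivAt_const t (1 : ℝ)
  · obtain ⟨d, hd⟩ : ∃ d : ℝ, δ = ENNReal.ofReal d := ⟨δ.toReal, (ENNReal.ofReal_toReal hδt).symm⟩
    have hd0 : 0 < d := by rw [hd] at hδ; exact ENNReal.ofReal_pos.1 hδ
    obtain ⟨x, hux, hxd⟩ := exists_between (h hδt)
    set l := x.toReal with hl
    have hlx : ENNReal.ofReal l = x := ENNReal.ofReal_toReal hxd.ne_top
    have hld : l < d := by
      rw [hd, ← hlx] at hxd
      exact (ENNReal.ofReal_lt_ofReal_iff hd0).1 hxd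
    have hl0 : 0 ≤ l := ENNReal.toReal_nonneg
    set k := Real.pi / d with hk
    -- Half the slack: `k (t + s)` stays in `[k s, π - k s]` for `0 ≤ t ≤ l`, so the sine stays
    -- above `sin (k s)`.
    set s := (d - l) / 2 with hs
    have hs0 : 0 < s := by rw [hs]; linarith
    have hk0 : 0 < k := by positivity
    have hkd : k * d = Real.pi := by rw [hk]; field_simp
    have hc : Real.pi ^ 2 * (δ⁻¹).toReal ^ 2 = k ^ 2 := by
      rw [hd, ENNReal.toReal_inv, ENNReal.toReal_ofReal hd0.le, hk]; ring
    have hks : 0 < k * s := by positivity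
    have hks2 : k * s ≤ Real.pi / 2 := by
      have : k * s ≤ k * d / 2 := by rw [hs]; nlinarith
      rwa [hkd] at this
    have hsin : 0 < Real.sin (k * s) := Real.sin_pos_of_pos_of_lt_pi hks (by linarith [Real.pi_pos])
    have hlin : ∀ t, HasDerivAt (fun t => k * (t + s)) k t := fun t => by
      simpa using ((hasDerivAt_id t).add_const s).const_mul k
    refine ⟨fun t => Real.sin (k * (t + s)), fun t => k * Real.cos (k * (t + s)), fun t => ?_, fun t => ?_,
      Real.sin (k * s) / (1 + l), by positivity, {v | len v < x},
      hlen.continuousAt.eventually (gt_mem_nhds hux), fun v hv t ht htv => ?_⟩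
    · exact (hlin t).sin.congr_deriv (by ring)
    · rw [hc]
      exact ((hlin t).cos.const_mul k).congr_deriv (by ring)
    · have htl : t ≤ l := by
        have h1 : ENNReal.ofReal t < ENNReal.ofReal l := by rw [hlx]; exact htv.trans hv
        by_contra! hcon
        exact absurd h1 (not_lt.2 (ENNReal.ofReal_le_ofReal hcon.le))
      have h2 : Real.sin (k * s) / (1 + l) * (1 + t) ≤ Real.sin (k * s) := by
        rw [div_mul_eq_mul_div, div_le_iff₀ (by positivity)]
        nlinarith
      refine h2.trans ?_
      change _ ≤ Real.sin (k * (t + s))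
      rcases le_total (k * (t + s)) (Real.pi / 2) with h3 | h3
      · exact Real.sin_le_sin_of_le_of_le_pi_div_two (by linarith) h3 (by nlinarith)
      · rw [← Real.sin_pi_sub (k * (t + s))]
        refine Real.sin_le_sin_of_le_of_le_pi_div_two (by linarith) (by linarith) ?_
        have : k * s = k * d - k * (l + s) := by rw [hs]; ring
        rw [this, hkd]
        nlinarith

section Rays

variable {F χ : Fin 3 → ℂ → ℂ} {σ ρ : ℂ → ℝ} {c : ℝ} {z₀ : ℂ} {len : Circle → ℝ≥0∞} {E : Circle → Circle}

/-- The minimal surface `Re F` in geodesic polar coordinates of the metric `e^{2ρ} |dz|²`. -/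
noncomputable def polarSurface (F : Fin 3 → ℂ → ℂ) (ρ : ℂ → ℝ) (z₀ : ℂ) (q : Circle × ℝ) :
    EuclideanSpace ℝ (Fin 3) := rePoint fun j => F j (expMap ρ z₀ (q.2 * q.1))

/-- The factor `e^{(ρ - σ) / 2}` in geodesic polar coordinates. -/
noncomputable def polarFactor (σ ρ : ℂ → ℝ) (z₀ : ℂ) (q : Circle × ℝ) : ℝ :=
  Real.exp ((ρ (expMap ρ z₀ (q.2 * q.1)) - σ (expMap ρ z₀ (q.2 * q.1))) / 2)

/-- The criterion of the theorem, in terms of `c = π² / δ²`. -/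
def SatisfiesCriterion (σ ρ : ℂ → ℝ) (c : ℝ) : Prop :=
  ∀ z ∈ ball (0 : ℂ) 1, ‖conformalSchwarzian σ z - conformalSchwarzian ρ z‖
    + Real.exp (2 * σ z) * |gaussCurvature σ z| ≤ 2 * c * Real.exp (2 * ρ z) + 2 * dzdzbar ρ z

theorem IsNullCurve.isControlledCurve_ray (h : IsNullCurve F χ σ) (hρ : ContDiffOn ℝ ∞ ρ (ball 0 1))
    (hcrit : SatisfiesCriterion σ ρ c) (hP : IsPolarSystem ρ z₀ len E) (u : Circle) :
    ∃ (φ1 φ2 : ℝ → EuclideanSpace ℝ (Fin 3)) (V1 V2 : ℝ → ℝ),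
      (∀ t, φ1 t = rePoint fun j => χ j (expMap ρ z₀ (t * u)) * rayVelocity ρ z₀ u t) ∧
      (∀ t, V1 t = polarFactor σ ρ z₀ (u, t) *
        ((gradZ ρ (expMap ρ z₀ (t * u)) - gradZ σ (expMap ρ z₀ (t * u))) * rayVelocity ρ z₀ u t).re) ∧
      ∀ s, 0 < s → ENNReal.ofReal s < len u →
        IsControlledCurve c s (fun t => polarSurface F ρ z₀ (u, t)) φ1 φ2
          (fun t => polarFactor σ ρ z₀ (u, t)) V1 V2 := by
  refine ⟨_, fun t => rePoint fun j => deriv (χ j) (expMap ρ z₀ (t * u)) * rayVelocity ρ z₀ u t ^ 2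
      - 2 * gradZ ρ (expMap ρ z₀ (t * u)) * χ j (expMap ρ z₀ (t * u)) * rayVelocity ρ z₀ u t ^ 2, _,
    fun t => polarFactor σ ρ z₀ (u, t) *
      (((gradZ ρ (expMap ρ z₀ (t * u)) - gradZ σ (expMap ρ z₀ (t * u))) * rayVelocity ρ z₀ u t).re ^ 2 +
      (((dz (gradZ ρ) (expMap ρ z₀ (t * u)) - dz (gradZ σ) (expMap ρ z₀ (t * u))
        - 2 * gradZ ρ (expMap ρ z₀ (t * u)) * (gradZ ρ (expMap ρ z₀ (t * u)) - gradZ σ (expMap ρ z₀ (t * u))))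
          * rayVelocity ρ z₀ u t ^ 2).re +
        (dzdzbar ρ (expMap ρ z₀ (t * u)) - dzdzbar σ (expMap ρ z₀ (t * u))) * ‖rayVelocity ρ z₀ u t‖ ^ 2)),
    fun t => rfl, fun t => rfl, fun s hs hsu => ?_⟩
  refine h.isControlledCurve hρ hcrit (solvesOn_ray hρ hs ((hP.mem_iff u s hs.le).2 hsu)) ?_
  rw [norm_mul, Circle.norm_coe, mul_one, norm_real, Real.norm_eq_abs, Real.abs_exp, ← Real.exp_add]
  simp

/-- The centre `p = φ₀ - ε τ(u)` lies slightly behind the starting point, opposite to the initial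
velocity `τ(u)`. For all directions near `u`, the logarithmic derivative of `‖φ - p‖` at `0` is then
at least `1 / (2ε)`, which outweighs the other terms of the initial condition. -/
theorem IsNullCurve.exists_growth (h : IsNullCurve F χ σ) (hρ : ContDiffOn ℝ ∞ ρ (ball 0 1))
    (hcrit : SatisfiesCriterion σ ρ c) (hP : IsPolarSystem ρ z₀ len E) {u : Circle} {y y1 : ℝ → ℝ}
    (hy : ∀ t, HasDerivAt y (y1 t) t) (hy1 : ∀ t, HasDerivAt y1 (-c * y t) t) {m : ℝ} (hm : 0 < m)
    {N : Set Circle} (hN : N ∈ 𝓝 u)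
    (hmN : ∀ v ∈ N, ∀ t, 0 ≤ t → ENNReal.ofReal t < len v → m * (1 + t) ≤ y t) :
    ∃ (p : EuclideanSpace ℝ (Fin 3)) (N' : Set Circle) (c₀ : ℝ), N' ∈ 𝓝 u ∧ 0 < c₀ ∧
      ∀ v ∈ N', ∀ t, 0 ≤ t → ENNReal.ofReal t < len v →
        c₀ * (1 + t) ≤ polarFactor σ ρ z₀ (v, t) * ‖polarSurface F ρ z₀ (v, t) - p‖ := by
  set τ : Circle → EuclideanSpace ℝ (Fin 3) := fun v => rePoint fun j => χ j z₀ * (Real.exp (-ρ z₀) * v) with hτ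
  set V₀ : ℝ := Real.exp ((ρ z₀ - σ z₀) / 2) with hV₀
  have hV₀pos : 0 < V₀ := Real.exp_pos _
  have hstart : ∀ v : Circle, expMap ρ z₀ ((0 : ℝ) * v) = z₀ := fun v => by
    rw [ofReal_zero, zero_mul, expMap_zero hρ hP.base_mem]
  have hstartv : ∀ v : Circle, rayVelocity ρ z₀ v 0 = Real.exp (-ρ z₀) * v := fun v => by
    rw [rayVelocity, if_pos rfl]
  have hτc : Continuous τ := by
    refine (PiLp.continuous_toLp 2 _).comp (continuous_pi fun j => continuous_re.comp ?_)
    exact continuous_const.mul (continuous_const.mul Circle.isInducing_coe.continuous)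
  have hτpos : ∀ v, 0 < ‖τ v‖ := by
    intro v
    obtain ⟨φ1, φ2, V1, V2, h1, -, h3⟩ := h.isControlledCurve_ray hρ hcrit hP v
    obtain ⟨s, -, hs, hsv⟩ := exists_lt_of_ofReal_lt (t := 0) (by simpa using hP.len_pos v)
    have h4 := (h3 s hs hsv).speed 0 ⟨le_rfl, hs.le⟩
    rw [h1] at h4
    simp only [hstart, hstartv] at h4
    rw [hτ]
    simp only
    rw [h4]
    exact inv_pos.2 (pow_pos (Real.exp_pos _) 2)
  set M := ‖gradZ ρ z₀ - gradZ σ z₀‖ * Real.exp (-ρ z₀) with hM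
  have hM0 : 0 ≤ M := by positivity
  -- `M` bounds the initial `|V'/V|` in every direction, so `1 / (2ε)` exceeds `M + |y'(0)/y(0)|`.
  set ε := 1 / (2 * (M + |y1 0 / y 0| + 1)) with hε
  have hεpos : 0 < ε := by positivity
  set φ₀ : EuclideanSpace ℝ (Fin 3) := rePoint fun j => F j z₀ with hφ₀
  have hy0 : 0 < y 0 := by
    have h1 := hmN u (mem_of_mem_nhds hN) 0 le_rfl (by simpa using hP.len_pos u)
    linarith
  refine ⟨φ₀ - ε • τ u, N ∩ {v | ‖τ u‖ ^ 2 / 2 < ⟪τ v, τ u⟫_ℝ}, V₀ * ‖ε • τ u‖ / y 0 * m,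
    inter_mem hN ?_, ?_, ?_⟩
  · refine (hτc.inner continuous_const).continuousAt.eventually (lt_mem_nhds ?_)
    change ‖τ u‖ ^ 2 / 2 < ⟪τ u, τ u⟫_ℝ
    rw [real_inner_self_eq_norm_sq]
    have := pow_pos (hτpos u) 2
    linarith
  · rw [norm_smul]
    have := hτpos u
    have : 0 < ‖ε‖ := norm_pos_iff.2 hεpos.ne'
    positivity
  · rintro v ⟨hvN, hv⟩ t ht htv
    obtain ⟨φ1, φ2, V1, V2, h1, h2, h3⟩ := h.isControlledCurve_ray hρ hcrit hP v
    obtain ⟨s, hts, hs, hsv⟩ := exists_lt_of_ofReal_lt htv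
    have hctrl := h3 s hs hsv
    have e0 : polarSurface F ρ z₀ (v, 0) = φ₀ := by
      simp only [polarSurface, hstart, hφ₀]
    have e1 : φ1 0 = τ v := by rw [h1]; simp only [hstart, hstartv, hτ]
    have e2 : polarFactor σ ρ z₀ (v, 0) = V₀ := by simp only [polarFactor, hstart, hV₀]
    have e3 : V1 0 / V₀ = ((gradZ ρ z₀ - gradZ σ z₀) * (Real.exp (-ρ z₀) * v)).re := by
      rw [h2, e2, hstart, hstartv]; field_simp
    have e4 : -M ≤ V1 0 / V₀ := by
      rw [e3]
      have h5 := abs_re_le_norm ((gradZ ρ z₀ - gradZ σ z₀) * (Real.exp (-ρ z₀) * v))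
      rw [norm_mul, norm_mul, Circle.norm_coe, mul_one, norm_real, Real.norm_eq_abs, Real.abs_exp] at h5
      exact (abs_le.1 h5).1
    have hne : ε • τ u ≠ 0 := smul_ne_zero hεpos.ne' (norm_pos_iff.1 (hτpos u))
    have hsub : φ₀ - (φ₀ - ε • τ u) = ε • τ u := by abel
    have hres := hctrl.le hs.le (p := φ₀ - ε • τ u) (fun t _ => (hy t).hasDerivWithinAt)
      (fun t _ => (hy1 t).hasDerivWithinAt) (fun t ht => ?_) ?_ ?_ t ⟨ht, hts.le⟩
    · simp only [e0, e2, hsub] at hres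
      refine le_trans ?_ hres
      rw [mul_assoc]
      exact mul_le_mul_of_nonneg_left (hmN v hvN t ht htv) (by positivity)
    · have h5 := hmN v hvN t ht.1 ((ENNReal.ofReal_le_ofReal ht.2).trans_lt hsv)
      have := mul_pos hm (show 0 < 1 + t by linarith [ht.1])
      linarith
    · rw [e0]
      intro h5
      exact hne (by rw [← hsub, ← h5, sub_self])
    · rw [e0, e1, e2, hsub, inner_smul_right, norm_smul, mul_pow, Real.norm_eq_abs, sq_abs]
      have h6 : 1 / (2 * ε) ≤ ε * ⟪τ v, τ u⟫_ℝ / (ε ^ 2 * ‖τ u‖ ^ 2) := by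
        have := hτpos u
        rw [div_le_div_iff₀ (by positivity) (by positivity)]
        have h7 : ‖τ u‖ ^ 2 / 2 < ⟪τ v, τ u⟫_ℝ := hv
        nlinarith [pow_pos hεpos 2]
      have h8 : 1 / (2 * ε) = M + |y1 0 / y 0| + 1 := by rw [hε]; field_simp
      linarith [le_abs_self (y1 0 / y 0)]

end Rays

/-! ### Limits of the surface and of its null curve at the ends of the rays -/

theorem continuousAt_invertAt {H : Type*} [NormedAddCommGroup H] [InnerProductSpace ℝ H] {p x : H} (h : x ≠ p) :
    ContinuousAt (invertAt p) x := by
  have h1 : ‖x - p‖ ^ 2 ≠ 0 := pow_ne_zero 2 (norm_ne_zero_iff.2 (sub_ne_zero.2 h))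
  have h2 : ContinuousAt (fun x : H => x - p) x := by fun_prop
  exact ((h2.norm.pow 2).inv₀ h1).smul h2

/-- A map has a limit on the sphere when its inversion has a limit. -/
theorem exists_tendsto_onePoint_of_invertAt {H κ : Type*} [NormedAddCommGroup H] [InnerProductSpace ℝ H]
    [ProperSpace H] {p y : H} {l : Filter κ} {f : κ → H} (hf : ∀ᶠ i in l, f i ≠ p)
    (h : Tendsto (fun i => invertAt p (f i)) l (𝓝 y)) :
    ∃ Y : OnePoint H, Tendsto (fun i => (f i : OnePoint H)) l (𝓝 Y) := by
  rcases eq_or_ne y 0 with rfl | hy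
  · refine ⟨OnePoint.infty, OnePoint.tendsto_coe_infty.comp ?_⟩
    rw [coclosedCompact_eq_cocompact, ← Metric.cobounded_eq_cocompact, ← tendsto_norm_atTop_iff_cobounded]
    have h1 : Tendsto (fun i => ‖invertAt p (f i)‖) l (𝓝[>] 0) := by
      refine tendsto_nhdsWithin_iff.2 ⟨by simpa using h.norm, hf.mono fun i hi => ?_⟩
      rw [norm_invertAt, mem_Ioi]
      exact inv_pos.2 (norm_pos_iff.2 (sub_ne_zero.2 hi))
    have h2 := h1.inv_tendsto_nhdsGT_zero
    refine tendsto_atTop_mono (fun i => ?_) (tendsto_atTop_add_const_right _ (-‖p‖) h2)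
    rw [Pi.inv_apply, norm_invertAt, inv_inv]
    linarith [norm_sub_le (f i) p]
  · refine ⟨((p + invertAt 0 y : H) : OnePoint H), (OnePoint.continuous_coe.tendsto _).comp ?_⟩
    refine (tendsto_const_nhds.add ((continuousAt_invertAt hy).tendsto.comp h)).congr fun i => ?_
    exact invertAt_invertAt p (f i)

section Rays

variable {F χ : Fin 3 → ℂ → ℂ} {σ ρ : ℂ → ℝ} {c : ℝ} {z₀ : ℂ} {len : Circle → ℝ≥0∞} {E : Circle → Circle}

theorem IsPolarSystem.continuousAt_comp_expMap (hρ : ContDiffOn ℝ ∞ ρ (ball 0 1))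
    (hcurv : ∀ z ∈ ball (0 : ℂ) 1, 0 ≤ dzdzbar ρ z) (hP : IsPolarSystem ρ z₀ len E) {Y : Type*}
    [TopologicalSpace Y] {f : ℂ → Y} (hf : ContinuousOn f (ball 0 1)) {u : Circle} {t : ℝ} (ht : 0 ≤ t)
    (htu : ENNReal.ofReal t < len u) : ContinuousAt (fun v : Circle => f (expMap ρ z₀ (t * v))) u := by
  have hmem := (hP.mem_iff u t ht).2 htu
  have h1 : ContinuousAt (fun v : Circle => (t * v : ℂ)) u :=
    (continuous_const.mul Circle.isInducing_coe.continuous).continuousAt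
  have h2 := (continuousOn_expMap hρ hcurv z₀).continuousAt ((isOpen_expDomain hρ hcurv z₀).mem_nhds hmem)
  have h3 := hf.continuousAt (isOpen_ball.mem_nhds (expMap_mem hmem))
  exact ContinuousAt.comp (f := fun v : Circle => expMap ρ z₀ (t * v)) h3
    (ContinuousAt.comp (f := fun v : Circle => (t * v : ℂ)) h2 h1)

theorem IsNullCurve.continuousOn_rePoint (h : IsNullCurve F χ σ) :
    ContinuousOn (fun z => rePoint fun j => F j z) (ball 0 1) :=
  (PiLp.continuous_toLp 2 _).comp_continuousOn (continuousOn_pi.2 fun j =>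
    continuous_re.comp_continuousOn fun z hz => (h.hasDerivAt j z hz).continuousAt.continuousWithinAt)

/-- The surface grows at least linearly, in the conformal sense that `V ‖φ - p‖ ≥ c₀ (1 + t)`, along
the rays with directions in `N`. -/
def HasGrowth (F : Fin 3 → ℂ → ℂ) (σ ρ : ℂ → ℝ) (z₀ : ℂ) (len : Circle → ℝ≥0∞)
    (p : EuclideanSpace ℝ (Fin 3)) (N : Set Circle) (c₀ : ℝ) : Prop :=
  ∀ v ∈ N, ∀ t, 0 ≤ t → ENNReal.ofReal t < len v →
    c₀ * (1 + t) ≤ polarFactor σ ρ z₀ (v, t) * ‖polarSurface F ρ z₀ (v, t) - p‖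

theorem HasGrowth.ne {p : EuclideanSpace ℝ (Fin 3)} {N : Set Circle} {c₀ : ℝ}
    (hg : HasGrowth F σ ρ z₀ len p N c₀) (hc₀ : 0 < c₀) {v : Circle} (hv : v ∈ N) {t : ℝ} (ht : 0 ≤ t)
    (htv : ENNReal.ofReal t < len v) : polarSurface F ρ z₀ (v, t) ≠ p := by
  intro h
  have h1 := hg v hv t ht htv
  rw [h, sub_self, norm_zero, mul_zero] at h1
  have := mul_pos hc₀ (show 0 < 1 + t by linarith)
  linarith

/-- The inverted curve has speed at most `(c₀ (1 + t))⁻²`, which integrates to the stated bound. -/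
theorem HasGrowth.dist_invertAt_le {p : EuclideanSpace ℝ (Fin 3)} {N : Set Circle} {c₀ : ℝ}
    (hg : HasGrowth F σ ρ z₀ len p N c₀) (hc₀ : 0 < c₀)
    (h : IsNullCurve F χ σ) (hρ : ContDiffOn ℝ ∞ ρ (ball 0 1))
    (hcrit : SatisfiesCriterion σ ρ c) (hP : IsPolarSystem ρ z₀ len E) {v : Circle} (hv : v ∈ N) {t t' : ℝ}
    (ht : 0 ≤ t) (htt' : t ≤ t') (htv : ENNReal.ofReal t' < len v) :
    dist (invertAt p (polarSurface F ρ z₀ (v, t))) (invertAt p (polarSurface F ρ z₀ (v, t'))) ≤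
      (c₀ ^ 2)⁻¹ * ((1 + t)⁻¹ - (1 + t')⁻¹) := by
  obtain ⟨φ1, φ2, V1, V2, -, -, h3⟩ := h.isControlledCurve_ray hρ hcrit hP v
  obtain ⟨s, hts, hs, hsv⟩ := exists_lt_of_ofReal_lt htv
  have hlt : ∀ r ∈ Icc 0 s, ENNReal.ofReal r < len v := fun r hr =>
    (ENNReal.ofReal_le_ofReal hr.2).trans_lt hsv
  have hctrl := h3 s hs hsv
  have hd : ∀ r ∈ Icc 0 s, ∃ d, HasDerivWithinAt (fun r => invertAt p (polarSurface F ρ z₀ (v, r))) d (Icc 0 s) r ∧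
      ‖d‖ ≤ (c₀ ^ 2)⁻¹ / (1 + r) ^ 2 := by
    intro r hr
    obtain ⟨d, hd, hdn⟩ := exists_hasDerivWithinAt_invertAt (hctrl.deriv r hr) (hg.ne hc₀ hv hr.1 (hlt r hr))
    refine ⟨d, hd, ?_⟩
    rw [hdn, hctrl.speed r hr]
    have h5 := hg v hv r hr.1 (hlt r hr)
    have h6 : 0 < c₀ * (1 + r) := mul_pos hc₀ (by linarith [hr.1])
    have h7 := pow_le_pow_left₀ h6.le h5 2
    have h8 := hr.1
    rw [inv_eq_one_div, inv_eq_one_div, div_div, div_div, ← mul_pow, ← mul_pow]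
    exact one_div_le_one_div_of_le (by positivity) h7
  choose! d hd hdn using hd
  have hsub : Icc 0 t' ⊆ Icc 0 s := Icc_subset_Icc_right hts.le
  exact dist_le_of_norm_deriv_le ht (fun r hr => (hd r (hsub hr)).mono hsub)
    (fun r hr => hdn r (hsub ⟨ht.trans hr.1, hr.2⟩)) ⟨le_rfl, htt'⟩

theorem HasGrowth.exists_tendsto {p : EuclideanSpace ℝ (Fin 3)} {N : Set Circle} {c₀ : ℝ}
    (hg : HasGrowth F σ ρ z₀ len p N c₀) (hc₀ : 0 < c₀)
    (h : IsNullCurve F χ σ) (hρ : ContDiffOn ℝ ∞ ρ (ball 0 1))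
    (hcurv : ∀ z ∈ ball (0 : ℂ) 1, 0 ≤ dzdzbar ρ z)
    (hcrit : SatisfiesCriterion σ ρ c) (hP : IsPolarSystem ρ z₀ len E) {u : Circle} (hN : N ∈ 𝓝 u) :
    ∃ Y : OnePoint (EuclideanSpace ℝ (Fin 3)),
      Tendsto (fun q => (polarSurface F ρ z₀ q : OnePoint (EuclideanSpace ℝ (Fin 3)))) (rayEnd len u) (𝓝 Y) := by
  obtain ⟨y, hy⟩ := exists_tendsto_rayEnd hP.continuous_len (hP.len_pos u)
    (Q := fun q => invertAt p (polarSurface F ρ z₀ q)) hN le_rfl (by simpa using hP.len_pos u)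
    (C := (c₀ ^ 2)⁻¹) (by positivity)
    (fun v hv t t' ht htt' htv => hg.dist_invertAt_le hc₀ h hρ hcrit hP hv ht htt' htv)
    (fun t ht htu => ContinuousAt.comp (f := fun v : Circle => polarSurface F ρ z₀ (v, t))
      (continuousAt_invertAt (hg.ne hc₀ (mem_of_mem_nhds hN) ht htu))
      (hP.continuousAt_comp_expMap hρ hcurv h.continuousOn_rePoint ht htu))
  refine exists_tendsto_onePoint_of_invertAt ?_ hy
  filter_upwards [mem_rayEnd_of_lt hN (t₀ := 0) (by simpa using hP.len_pos u),
    mem_inf_of_right (mem_principal_self (polarDomain len))] with q hq hq'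
  exact hg.ne hc₀ hq.1 hq'.1 hq'.2

/-- Near a finite limit `‖φ - p‖` is bounded, so the growth estimate bounds `V` below linearly and
`2 V⁻²`, which dominates the speed of each `F j`, is integrable. The conjugate surface thus
converges too, and holomorphic function theory becomes available. -/
theorem HasGrowth.exists_tendsto_nullCurve {p : EuclideanSpace ℝ (Fin 3)} {N : Set Circle} {c₀ : ℝ}
    (hg : HasGrowth F σ ρ z₀ len p N c₀) (hc₀ : 0 < c₀)
    (h : IsNullCurve F χ σ) (hρ : ContDiffOn ℝ ∞ ρ (ball 0 1))
    (hcurv : ∀ z ∈ ball (0 : ℂ) 1, 0 ≤ dzdzbar ρ z)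
    (hP : IsPolarSystem ρ z₀ len E) {u : Circle} (hN : N ∈ 𝓝 u)
    {x : EuclideanSpace ℝ (Fin 3)} (hx : Tendsto (polarSurface F ρ z₀) (rayEnd len u) (𝓝 x)) :
    ∀ᶠ v in 𝓝 u, ∀ j, ∃ y : ℂ, Tendsto (fun q : Circle × ℝ => F j (expMap ρ z₀ (q.2 * q.1))) (rayEnd len v) (𝓝 y) := by
  set B := ‖x - p‖ + 1 with hB
  have hBpos : 0 < B := by positivity
  have hA : {q | ‖polarSurface F ρ z₀ q - p‖ < B} ∈ rayEnd len u :=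
    (hx.sub_const p).norm.eventually (gt_mem_nhds (lt_add_one _))
  obtain ⟨N', hN', t₀, ht₀, hlt₀, hNA⟩ := exists_of_mem_rayEnd hP.continuous_len (hP.len_pos u) hA
  filter_upwards [eventually_mem_nhds_iff.2 (inter_mem hN hN')] with w hw j
  refine exists_tendsto_rayEnd hP.continuous_len (hP.len_pos w) hw ht₀ (hlt₀ w (mem_of_mem_nhds hw).2)
    (C := 2 * (c₀ / B)⁻¹ ^ 2) (by positivity) (fun v hv t t' ht htt' htv => ?_) (fun t ht htw => 
      hP.continuousAt_comp_expMap hρ hcurv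
        (fun z hz => (h.hasDerivAt j z hz).continuousAt.continuousWithinAt) ht htw)
  rcases (ht₀.trans (ht.trans htt')).eq_or_lt with rfl | ht'0
  · have : t = 0 := le_antisymm htt' (ht₀.trans ht)
    subst this
    simp
  have hdom := (hP.mem_iff v t' ht'0.le).2 htv
  have hgeo := isGeodesicOn_ray hρ v.norm_coe ht'0 hdom
  refine dist_le_of_norm_deriv_le (Q := fun r : ℝ => F j (expMap ρ z₀ (r * v))) ht₀
    (d := fun r => χ j (expMap ρ z₀ (r * v)) * rayVelocity ρ z₀ v r)
    (fun r hr => (h.hasDerivAt j _ (hgeo.mem_disk r hr)).comp_hasDerivWithinAt r (hgeo.velocity r hr))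
    (fun r hr => ?_) ⟨ht, htt'⟩
  have hr0 : 0 ≤ r := ht₀.trans hr.1
  have hrv : ENNReal.ofReal r < len v := (ENNReal.ofReal_le_ofReal hr.2).trans_lt htv
  have hz := hgeo.mem_disk r ⟨hr0, hr.2⟩
  have hsp := hgeo.unit_speed r ⟨hr0, hr.2⟩
  have h1 := hg v hv.1 r hr0 hrv
  have h2 : ‖polarSurface F ρ z₀ (v, r) - p‖ < B := hNA v hv.2 r hr.1 hrv
  set V := polarFactor σ ρ z₀ (v, r) with hV
  have hVpos : 0 < V := Real.exp_pos _
  have h3 : c₀ / B * (1 + r) ≤ V := by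
    rw [div_mul_eq_mul_div, div_le_iff₀ hBpos]
    exact h1.trans (mul_le_mul_of_nonneg_left h2.le hVpos.le)
  have h4 : ‖χ j (expMap ρ z₀ (r * v)) * rayVelocity ρ z₀ v r‖ ≤ 2 * (V ^ 2)⁻¹ := by
    have h5 : ‖χ j (expMap ρ z₀ (r * v))‖ ^ 2 ≤ 2 * Real.exp (2 * σ (expMap ρ z₀ (r * v))) := by
      rw [← h.norm_sq _ hz]
      exact Finset.single_le_sum (f := fun j => ‖χ j (expMap ρ z₀ (r * v))‖ ^ 2)
        (fun i _ => sq_nonneg _) (Finset.mem_univ j)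
    have h6 : ‖rayVelocity ρ z₀ v r‖ = Real.exp (-ρ (expMap ρ z₀ (r * v))) := by
      rw [Real.exp_neg]
      exact eq_inv_of_mul_eq_one_right hsp
    have h7 : (V ^ 2)⁻¹ = Real.exp (σ (expMap ρ z₀ (r * v))) * Real.exp (-ρ (expMap ρ z₀ (r * v))) := by
      rw [hV, polarFactor, ← Real.exp_nat_mul, ← Real.exp_neg, ← Real.exp_add]
      congr 1
      push_cast
      ring
    have h8 : ‖χ j (expMap ρ z₀ (r * v))‖ ≤ 2 * Real.exp (σ (expMap ρ z₀ (r * v))) := by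
      refine abs_le_of_sq_le_sq' ?_ (by positivity) |>.2
      refine h5.trans ?_
      rw [← Nat.cast_ofNat (R := ℝ) (n := 2), Real.exp_nat_mul, mul_pow]
      push_cast
      nlinarith [pow_pos (Real.exp_pos (σ (expMap ρ z₀ (r * v)))) 2]
    rw [norm_mul, h6, h7, ← mul_assoc]
    exact mul_le_mul_of_nonneg_right h8 (Real.exp_pos _).le
  refine h4.trans ?_
  rw [mul_div_assoc]
  refine mul_le_mul_of_nonneg_left ?_ zero_le_two
  rw [inv_pow, inv_eq_one_div, inv_eq_one_div, div_div, ← mul_pow]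
  exact one_div_le_one_div_of_le (by positivity) (pow_le_pow_left₀ (by positivity) h3 2)

end Rays

/-! ### A Lindelöf theorem for sectors bounded by geodesic rays -/

/-- Maximum principle, with a boundary condition only involving the values inside the domain. -/
theorem norm_le_of_forall_eventually_norm_le {Ω : Set ℂ} {f : ℂ → ℂ} {C : ℝ} (hΩ : IsOpen Ω)
    (hb : Bornology.IsBounded Ω) (hf : DifferentiableOn ℂ f Ω)
    (h : ∀ ξ ∈ frontier Ω, ∀ᶠ z in 𝓝[Ω] ξ, ‖f z‖ ≤ C) {z : ℂ} (hz : z ∈ Ω) : ‖f z‖ ≤ C := by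
  by_contra! hcon
  -- The set where the bound fails has its closure inside `Ω`, so the usual maximum principle
  -- applies to it.
  set U := Ω ∩ (fun z => ‖f z‖) ⁻¹' Ioi C with hU
  have hcont : ContinuousOn (fun z => ‖f z‖) Ω := hf.continuousOn.norm
  have hUo : IsOpen U := hcont.isOpen_inter_preimage hΩ isOpen_Ioi
  have hcl : closure U ⊆ Ω := by
    intro ξ hξ
    by_contra hξΩ
    have h1 : ξ ∈ frontier Ω := by
      rw [hΩ.frontier_eq]
      exact ⟨closure_mono inter_subset_left hξ, hξΩ⟩
    have h2 := h ξ h1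
    have : (𝓝[U] ξ).NeBot := mem_closure_iff_nhdsWithin_neBot.1 hξ
    obtain ⟨w, hw1, hw2⟩ := ((h2.filter_mono (nhdsWithin_mono _ inter_subset_left)).and
      (self_mem_nhdsWithin (a := ξ) (s := U))).exists
    exact absurd hw2.2 (not_lt.2 hw1)
  have hfr : ∀ ξ ∈ frontier U, ‖f ξ‖ ≤ C := by
    intro ξ hξ
    rw [hUo.frontier_eq] at hξ
    by_contra! hc
    exact hξ.2 ⟨hcl hξ.1, hc⟩
  have hd : DiffContOnCl ℂ f U := ⟨hf.mono inter_subset_left, hf.continuousOn.mono hcl⟩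
  have h3 := Complex.norm_le_of_forall_mem_frontier_norm_le (hb.subset inter_subset_left) hd hfr
    (subset_closure (⟨hz, hcon⟩ : z ∈ U))
  exact absurd hcon (not_lt.2 h3)

/-- The function is the principal root of `1 - z ζ̄`, a barrier at `ζ`. The last bound holds because
`Re w² > 0`. -/
theorem exists_sqrt_at (ζ : Circle) :
    ∃ w : ℂ → ℂ, DifferentiableOn ℂ w (ball 0 1) ∧
      ∀ z ∈ ball (0 : ℂ) 1, 0 < (w z).re ∧ ‖w z‖ ^ 2 = ‖z - ζ‖ ∧ ‖z - ζ‖ ≤ 2 * (w z).re ^ 2 := by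
  have hre : ∀ z ∈ ball (0 : ℂ) 1, 0 < (1 - z * conj (ζ : ℂ)).re := by
    intro z hz
    have h1 : (z * conj (ζ : ℂ)).re ≤ ‖z‖ := by
      refine (re_le_norm _).trans_eq ?_
      rw [norm_mul, norm_conj, Circle.norm_coe, mul_one]
    rw [mem_ball_zero_iff] at hz
    rw [sub_re, one_re]
    linarith
  have hslit : ∀ z ∈ ball (0 : ℂ) 1, 1 - z * conj (ζ : ℂ) ∈ slitPlane := fun z hz => Or.inl (hre z hz)
  refine ⟨fun z => Complex.exp (Complex.log (1 - z * conj (ζ : ℂ)) / 2), fun z hz => ?_, fun z hz => ?_⟩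
  · have h1 : DifferentiableAt ℂ (fun z => 1 - z * conj (ζ : ℂ)) z := by fun_prop
    exact ((h1.clog (hslit z hz)).div_const 2).cexp.differentiableWithinAt
  · set x := 1 - z * conj (ζ : ℂ) with hx
    set w := Complex.exp (Complex.log x / 2) with hw
    have hx0 : x ≠ 0 := slitPlane_ne_zero (hslit z hz)
    have hsq : w ^ 2 = x := by
      rw [hw, ← Complex.exp_nat_mul]
      push_cast
      rw [mul_div_cancel₀ _ two_ne_zero, exp_log hx0]
    have hnorm : ‖x‖ = ‖z - ζ‖ := by
      have h1 : x = -(z - ζ) * conj (ζ : ℂ) := by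
        have : (ζ : ℂ) * conj (ζ : ℂ) = 1 := by
          rw [mul_conj, Circle.normSq_coe, ofReal_one]
        rw [hx]
        linear_combination -this
      rw [h1, norm_mul, norm_neg, norm_conj, Circle.norm_coe, mul_one]
    have h2 : 0 < w.re := by
      rw [hw, exp_re]
      refine mul_pos (Real.exp_pos _) (Real.cos_pos_of_mem_Ioo ?_)
      have h3 : (Complex.log x / 2).im = x.arg / 2 := by
        rw [show (2 : ℂ) = ((2 : ℝ) : ℂ) by norm_num, div_ofReal_im, log_im]
      rw [h3]
      have h4 := neg_pi_lt_arg x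
      have h5 := arg_le_pi x
      have h6 : x.arg ≠ Real.pi := slitPlane_arg_ne_pi (hslit z hz)
      have h7 := lt_of_le_of_ne h5 h6
      exact ⟨by linarith, by linarith⟩
    refine ⟨h2, ?_, ?_⟩
    · rw [← norm_pow, hsq, hnorm]
    · have h3 : 0 < (w ^ 2).re := by rw [hsq]; exact hre z hz
      rw [pow_two, mul_re] at h3
      rw [← hnorm, ← hsq, norm_pow, ← normSq_eq_norm_sq, normSq_apply]
      linarith

section Sector

variable {ρ : ℂ → ℝ} {z₀ : ℂ} {len : Circle → ℝ≥0∞} {E : Circle → Circle} {S : ℂ → ℂ}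

theorem IsExpInverse.endpoint_eq (hρ : ContDiffOn ℝ ∞ ρ (ball 0 1))
    (hcurv : ∀ z ∈ ball (0 : ℂ) 1, 0 ≤ dzdzbar ρ z)
    (hP : IsPolarSystem ρ z₀ len E) (hS : IsExpInverse ρ z₀ S) {ζ u : Circle} {G : Ultrafilter ℂ}
    (hG : (G : Filter ℂ) ≤ 𝓝[ball 0 1] (ζ : ℂ)) (hu : Tendsto (fun z => direction (S z)) G (𝓝 u)) :
    E u = ζ := by
  obtain ⟨u₀, hu₀⟩ := hP.surjective_endpoint ζ
  obtain ⟨ν, θ₀, θ, -, -, -, h1, h2⟩ := hS.exists_arc hρ hcurv hP hG hu hu₀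
  rw [← h1]
  exact h2 θ right_mem_uIcc

/-- The union of the geodesic rays with directions in `K`. -/
def raySector (S : ℂ → ℂ) (K : Set Circle) : Set ℂ := {z | z ∈ ball (0 : ℂ) 1 ∧ direction (S z) ∈ K}

theorem IsExpInverse.exists_tendsto_direction {K : Set Circle} (hK : IsClosed K)
    {G : Ultrafilter ℂ} (hG : ∀ᶠ z in (G : Filter ℂ), direction (S z) ∈ K) :
    ∃ u ∈ K, Tendsto (fun z => direction (S z)) G (𝓝 u) := by
  obtain ⟨u, hu, hlim⟩ := hK.isCompact.ultrafilter_le_nhds (G.map fun z => direction (S z))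
    (le_principal_iff.2 hG)
  exact ⟨u, hu, hlim⟩

/-- Along any ultrafilter tending to `ζ` in the sector, the directions converge in the compact `K`,
and `IsExpInverse.tendsto_rayEnd` reduces the behaviour of `f` to its ray limits. -/
theorem IsExpInverse.eventually_mem_of_tendsto_rayEnd (hρ : ContDiffOn ℝ ∞ ρ (ball 0 1))
    (hcurv : ∀ z ∈ ball (0 : ℂ) 1, 0 ≤ dzdzbar ρ z)
    (hP : IsPolarSystem ρ z₀ len E) (hS : IsExpInverse ρ z₀ S) {K : Set Circle} (hK : IsClosed K)
    {f : ℂ → ℂ} {b : Circle → ℂ}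
    (hb : ∀ u ∈ K, Tendsto (fun q : Circle × ℝ => f (expMap ρ z₀ (q.2 * q.1))) (rayEnd len u) (𝓝 (b u)))
    {O : Set ℂ} (hO : IsOpen O) (hbO : ∀ u ∈ K, b u ∈ O) (ζ : Circle) :
    ∀ᶠ z in 𝓝[raySector S K] (ζ : ℂ), f z ∈ O := by
  refine mem_iff_ultrafilter.2 fun G hG => ?_
  have h1 : ∀ᶠ z in (G : Filter ℂ), z ∈ raySector S K := hG self_mem_nhdsWithin
  obtain ⟨u, hu, hlim⟩ := IsExpInverse.exists_tendsto_direction (S := S) hK (h1.mono fun z hz => hz.2)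
  have hGb : (G : Filter ℂ) ≤ 𝓝[ball 0 1] (ζ : ℂ) := hG.trans (nhdsWithin_mono _ fun z hz => hz.1)
  have h2 := (hb u hu).comp (hS.tendsto_rayEnd hρ hcurv hP hGb hlim)
  filter_upwards [h2.eventually (hO.mem_nhds (hbO u hu)), h1] with z hz hz1
  rwa [Function.comp_apply, hS.expMap_polar hz1.1] at hz

/-- Phragmén–Lindelöf for `f e^{-L w - η / w}`, with `w = √(1 - z ζ̄)`, in the part of the sector
within `r` of `ζ`. On the edge rays `f` is small; on `|z - ζ| = r` the factor `e^{-L w}` is small;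
at `ζ` the factor `e^{-η / w}` kills the bounded `f`. Letting `η → 0` leaves `|f| ≤ 2 ε e^{L √|z -
ζ|}`, and then `z → ζ` along the ray of angle `α`. -/
theorem IsExpInverse.eq_zero_of_sector (hρ : ContDiffOn ℝ ∞ ρ (ball 0 1))
    (hcurv : ∀ z ∈ ball (0 : ℂ) 1, 0 ≤ dzdzbar ρ z)
    (hP : IsPolarSystem ρ z₀ len E) (hS : IsExpInverse ρ z₀ S) {ν ζ : Circle} {θ₁ θ₂ : ℝ}
    (h₁ : -Real.pi < θ₁) (h₂ : θ₂ < Real.pi)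
    (hE : ∀ α ∈ Icc θ₁ θ₂, E (ν * Circle.exp α) = ζ) {f : ℂ → ℂ} (hf : DifferentiableOn ℂ f (ball 0 1))
    {b : Circle → ℂ} (hb : ∀ α ∈ Icc θ₁ θ₂, Tendsto (fun q : Circle × ℝ => f (expMap ρ z₀ (q.2 * q.1)))
      (rayEnd len (ν * Circle.exp α)) (𝓝 (b (ν * Circle.exp α))))
    (hb₁ : b (ν * Circle.exp θ₁) = 0) (hb₂ : b (ν * Circle.exp θ₂) = 0) {α : ℝ} (hα : α ∈ Ioo θ₁ θ₂) :
    b (ν * Circle.exp α) = 0 := by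
  set e : ℝ → Circle := fun α => ν * Circle.exp α with he
  have hec : Continuous e := continuous_const.mul Circle.exp.continuous
  set K := e '' Icc θ₁ θ₂ with hK
  have hKcomp : IsCompact K := isCompact_Icc.image hec
  have hbK : ∀ u ∈ K, Tendsto (fun q : Circle × ℝ => f (expMap ρ z₀ (q.2 * q.1))) (rayEnd len u) (𝓝 (b u)) := by
    rintro _ ⟨α, hα, rfl⟩
    exact hb α hα
  have hEK : ∀ u ∈ K, E u = ζ := by
    rintro _ ⟨α, hα, rfl⟩
    exact hE α hα
  have hbc : ContinuousOn b K := continuousOn_of_tendsto_rayEnd hP.continuous_len hP.len_pos hbK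
  obtain ⟨M, hM⟩ := (hKcomp.image_of_continuousOn hbc).isBounded.exists_norm_le
  have hM' : ∀ u ∈ K, b u ∈ ball (0 : ℂ) (|M| + 1) := fun u hu => by
    rw [mem_ball_zero_iff]
    have := hM _ (mem_image_of_mem b hu)
    linarith [le_abs_self M]
  have hMpos : 0 < |M| + 1 := by positivity
  obtain ⟨r₀, hr₀, hbd⟩ := Metric.mem_nhdsWithin_iff.1
    (hS.eventually_mem_of_tendsto_rayEnd hρ hcurv hP hKcomp.isClosed hbK isOpen_ball hM' ζ)
  have hz₀ζ : 0 < dist z₀ (ζ : ℂ) := dist_pos.2 fun h => Circle.coe_notMem_ball ζ (h ▸ hP.base_mem)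
  obtain ⟨w, hwd, hw⟩ := exists_sqrt_at ζ
  have hsmall : ∀ ε > 0, ‖b (e α)‖ ≤ 2 * ε := by
    intro ε hε
    have hray : ∀ β ∈ Icc θ₁ θ₂, b (e β) = 0 → ∃ r > 0, ∀ z ∈ ball (0 : ℂ) 1, dist z (ζ : ℂ) < r →
        direction (S z) = e β → ‖f z‖ < ε := by
      intro β hβ hb0
      have h1 := hS.eventually_mem_of_tendsto_rayEnd hρ hcurv hP (K := {e β}) isClosed_singleton
        (f := f) (b := b) (fun u hu => by rw [mem_singleton_iff.1 hu]; exact hb β hβ) (isOpen_ball (x := 0) (ε := ε))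
        (fun u hu => by rw [mem_singleton_iff.1 hu, hb0]; exact mem_ball_self hε) ζ
      obtain ⟨r, hr, hsub⟩ := Metric.mem_nhdsWithin_iff.1 h1
      refine ⟨r, hr, fun z hz hzr hdir => ?_⟩
      simpa using hsub ⟨hzr, hz, hdir⟩
    have hle : θ₁ ≤ θ₂ := (hα.1.trans hα.2).le
    obtain ⟨r₁, hr₁, hf₁⟩ := hray θ₁ ⟨le_rfl, hle⟩ hb₁
    obtain ⟨r₂, hr₂, hf₂⟩ := hray θ₂ ⟨hle, le_rfl⟩ hb₂
    -- `r < |z₀ - ζ|` keeps the base point, where the angle is undefined, out of the region.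
    obtain ⟨r, hr, hrmin⟩ := exists_between (lt_min (lt_min hr₀ hr₁) (lt_min hr₂ hz₀ζ))
    have hrr₀ : r < r₀ := hrmin.trans_le ((min_le_left _ _).trans (min_le_left _ _))
    have hrr₁ : r < r₁ := hrmin.trans_le ((min_le_left _ _).trans (min_le_right _ _))
    have hrr₂ : r < r₂ := hrmin.trans_le ((min_le_right _ _).trans (min_le_left _ _))
    have hrz₀ : r < dist z₀ (ζ : ℂ) := hrmin.trans_le ((min_le_right _ _).trans (min_le_right _ _))
    have hS0 : ∀ z ∈ ball (0 : ℂ) 1, dist z (ζ : ℂ) ≤ r → S z ≠ 0 := by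
      intro z hz hzr h0
      have h1 := hS.right_inv z hz
      rw [h0, expMap_zero hρ hP.base_mem] at h1
      rw [← h1] at hzr
      exact absurd hrz₀ (not_lt.2 hzr)
    have hbd' : ∀ z ∈ ball (0 : ℂ) 1, dist z (ζ : ℂ) ≤ r → direction (S z) ∈ K → ‖f z‖ ≤ |M| + 1 := by
      intro z hz hzr hdir
      have := hbd ⟨hzr.trans_lt hrr₀, hz, hdir⟩
      simpa using (mem_ball_zero_iff.1 this).le
    set Ω : Set ℂ := {z | z ∈ ball (0 : ℂ) 1 ∧ dist z (ζ : ℂ) < r ∧ angleFrom ν (S z) ∈ Ioo θ₁ θ₂} with hΩ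
    have hΩdir : ∀ z ∈ Ω, direction (S z) ∈ K := fun z hz =>
      ⟨angleFrom ν (S z), Ioo_subset_Icc_self hz.2.2, (direction_eq ν (hS0 z hz.1 hz.2.1.le)).symm⟩
    have hΩo : IsOpen Ω := by
      rw [isOpen_iff_mem_nhds]
      intro z hz
      have h0 := hS0 z hz.1 hz.2.1.le
      have hdir : direction (S z) ≠ ν * Circle.exp Real.pi := by
        rw [direction_eq ν h0]
        intro h
        have h4 : Circle.exp (angleFrom ν (S z)) = Circle.exp Real.pi := mul_left_cancel (G := Circle) (a := ν) h
        have h3 := congrArg (fun u : Circle => Complex.arg u) h4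
        rw [Circle.arg_exp (h₁.trans hz.2.2.1) (hz.2.2.2.trans h₂).le,
          Circle.arg_exp (by linarith [Real.pi_pos]) le_rfl] at h3
        exact absurd h3 (hz.2.2.2.trans h₂).ne
      have hc : ContinuousAt (fun z => angleFrom ν (S z)) z :=
        ContinuousAt.comp (f := S) (continuousAt_angleFrom h0 hdir)
          (hS.continuousOn.continuousAt (isOpen_ball.mem_nhds hz.1))
      filter_upwards [isOpen_ball.mem_nhds hz.1, isOpen_ball.mem_nhds (mem_ball.2 hz.2.1),
        hc.eventually (isOpen_Ioo.mem_nhds hz.2.2)] with y hy1 hy2 hy3 using ⟨hy1, hy2, hy3⟩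
    have hΩb : Ω ⊆ ball 0 1 := fun z hz => hz.1
    have hre_inv : ∀ z ∈ ball (0 : ℂ) 1, 0 < ((w z)⁻¹).re := fun z hz => by
      rw [inv_re]
      exact div_pos (hw z hz).1 (normSq_pos.2 fun h0 => by
        have := (hw z hz).1
        rw [h0] at this
        simp at this)
    -- On `|z - ζ| = r` one has `Re w ≥ √(r/2)`, so this `L` brings the bound on `f` down to `ε`
    -- there.
    obtain ⟨L, hL0, hL⟩ : ∃ L > 0, (|M| + 1) * Real.exp (-(L * Real.sqrt (r / 2))) ≤ ε := by
      have h1 : Tendsto (fun L : ℝ => (|M| + 1) * Real.exp (-(L * Real.sqrt (r / 2)))) atTop (𝓝 ((|M| + 1) * 0)) :=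
        (Real.tendsto_exp_neg_atTop_nhds_zero.comp
          (tendsto_id.atTop_mul_const (Real.sqrt_pos.2 (half_pos hr)))).const_mul _
      rw [mul_zero] at h1
      obtain ⟨L, hL1, hL2⟩ := ((h1.eventually (gt_mem_nhds hε)).and (eventually_gt_atTop 0)).exists
      exact ⟨L, hL2, hL1.le⟩
    have hexp : ∀ (η : ℝ) (z : ℂ), ‖Complex.exp (-(L * w z) - η * (w z)⁻¹)‖ =
        Real.exp (-(L * (w z).re) - η * ((w z)⁻¹).re) := fun η z => by
      rw [Complex.norm_exp, sub_re, neg_re, re_ofReal_mul, re_ofReal_mul]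
    have key : ∀ η > 0, ∀ z ∈ Ω, ‖f z * Complex.exp (-(L * w z) - (η : ℝ) * (w z)⁻¹)‖ ≤ 2 * ε := by
      intro η hη z hz
      have hd : DifferentiableOn ℂ (fun z => f z * Complex.exp (-(L * w z) - (η : ℝ) * (w z)⁻¹)) (ball 0 1) := by
        refine hf.mul (((hwd.const_mul _).neg.sub ((hwd.inv fun z hz => ?_).const_mul _)).cexp)
        intro h0
        have := (hw z hz).1
        rw [h0] at this
        simp at this
      refine norm_le_of_forall_eventually_norm_le hΩo (isBounded_ball.subset hΩb) (hd.mono hΩb)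
        (fun ξ hξ => ?_) hz
      refine mem_iff_ultrafilter.2 fun G hG => ?_
      have hGΩ : ∀ᶠ z in (G : Filter ℂ), z ∈ Ω := hG self_mem_nhdsWithin
      have hGξ : Tendsto (fun z => z) (G : Filter ℂ) (𝓝 ξ) := hG.trans nhdsWithin_le_nhds
      obtain ⟨u, huK, hu⟩ := IsExpInverse.exists_tendsto_direction (S := S) hKcomp.isClosed (hGΩ.mono hΩdir)
      rw [hΩo.frontier_eq] at hξ
      have hξ1 : ‖ξ‖ ≤ 1 := by
        have := closure_ball_subset_closedBall (closure_mono hΩb hξ.1)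
        simpa using this
      have hξr : dist ξ (ζ : ℂ) ≤ r := by
        have h1 : Ω ⊆ closedBall (ζ : ℂ) r := fun z hz => hz.2.1.le
        exact closure_minimal h1 isClosed_closedBall hξ.1
      -- A frontier point on the unit circle is `ζ` itself, since every direction of the closed
      -- sector ends there. Any other lies in the disk, on an edge ray or on `|z - ζ| = r`.
      rcases hξ1.eq_or_lt with hξ1 | hξ1
      · obtain ⟨ζ', rfl⟩ : ∃ ζ' : Circle, (ζ' : ℂ) = ξ := ⟨⟨ξ, mem_sphere_zero_iff_norm.2 hξ1⟩, rfl⟩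
        have h1 := hS.endpoint_eq hρ hcurv hP (hG.trans (nhdsWithin_mono _ hΩb)) hu
        rw [hEK u huK] at h1
        subst h1
        have h2 : Tendsto (fun z => (2 * ‖w z‖)⁻¹) (G : Filter ℂ) atTop := by
          refine Tendsto.inv_tendsto_nhdsGT_zero (tendsto_nhdsWithin_iff.2 ⟨?_, ?_⟩)
          · have h3 : Tendsto (fun z => 2 * Real.sqrt ‖z - (ζ : ℂ)‖) (G : Filter ℂ) (𝓝 (2 * Real.sqrt ‖(ζ : ℂ) - ζ‖)) :=
              ((Real.continuous_sqrt.tendsto _).comp (hGξ.sub_const _).norm).const_mul 2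
            rw [sub_self, norm_zero, Real.sqrt_zero, mul_zero] at h3
            refine h3.congr' (hGΩ.mono fun z hz => ?_)
            rw [← (hw z hz.1).2.1, Real.sqrt_sq (norm_nonneg _)]
          · refine hGΩ.mono fun z hz => ?_
            have := (hw z hz.1).1
            have h4 : 0 < ‖w z‖ := this.trans_le (re_le_norm _)
            exact mul_pos two_pos h4
        have h3 : Tendsto (fun z => (|M| + 1) * Real.exp (-(η * (2 * ‖w z‖)⁻¹))) (G : Filter ℂ) (𝓝 ((|M| + 1) * 0)) :=
          (Real.tendsto_exp_neg_atTop_nhds_zero.comp (h2.const_mul_atTop hη)).const_mul _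
        rw [mul_zero] at h3
        filter_upwards [h3.eventually (gt_mem_nhds hε), hGΩ] with z hz1 hzΩ
        have h4 := hbd' z hzΩ.1 hzΩ.2.1.le (hΩdir z hzΩ)
        obtain ⟨h5, h6, h7⟩ := hw z hzΩ.1
        have h8 : 0 < ‖w z‖ := h5.trans_le (re_le_norm _)
        have h9 : (2 * ‖w z‖)⁻¹ ≤ ((w z)⁻¹).re := by
          rw [inv_re, normSq_eq_norm_sq, inv_eq_one_div, div_le_div_iff₀ (by positivity) (by positivity)]
          have h10 : ‖w z‖ ≤ 2 * (w z).re := by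
            rw [← h6] at h7
            refine abs_le_of_sq_le_sq' ?_ (by positivity) |>.2
            nlinarith
          nlinarith
        rw [norm_mul, hexp]
        refine (mul_le_mul h4 (Real.exp_le_exp.2 (?_ : _ ≤ -(η * (2 * ‖w z‖)⁻¹))) (Real.exp_pos _).le hMpos.le).trans
          (hz1.le.trans (by linarith))
        have h11 := mul_le_mul_of_nonneg_left h9 hη.le
        have h12 := mul_pos hL0 h5
        linarith
      · have hξb : ξ ∈ ball (0 : ℂ) 1 := by simpa using hξ1
        have hcont := (hd.continuousOn.continuousAt (isOpen_ball.mem_nhds hξb)).norm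
        suffices hξε : ‖f ξ * Complex.exp (-(L * w ξ) - (η : ℝ) * (w ξ)⁻¹)‖ ≤ ε by
          have h1 := (hcont.tendsto.comp hGξ).eventually
            (gt_mem_nhds (lt_of_le_of_lt hξε (by linarith : ε < 2 * ε)))
          filter_upwards [h1] with z hz using le_of_lt hz
        have h0 := hS0 ξ hξb hξr
        have hdir : Tendsto (fun z => direction (S z)) (G : Filter ℂ) (𝓝 (direction (S ξ))) :=
          (tendsto_direction h0).comp ((hS.continuousOn.continuousAt (isOpen_ball.mem_nhds hξb)).tendsto.comp hGξ)
        have hdu : direction (S ξ) = u := tendsto_nhds_unique hdir hu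
        obtain ⟨hw1, hw2, hw3⟩ := hw ξ hξb
        have hi := hre_inv ξ hξb
        rw [norm_mul, hexp]
        rcases hξr.eq_or_lt with hξr' | hξr'
        · refine (mul_le_mul (hbd' ξ hξb hξr (hdu ▸ huK)) (Real.exp_le_exp.2 (?_ : _ ≤ -(L * Real.sqrt (r / 2))))
            (Real.exp_pos _).le hMpos.le).trans hL
          have h3 : Real.sqrt (r / 2) ≤ (w ξ).re := by
            rw [Real.sqrt_le_left hw1.le, ← hξr', dist_eq_norm]
            linarith
          have h4 := mul_le_mul_of_nonneg_left h3 hL0.le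
          have h5 := mul_pos hη hi
          linarith
        · have hle1 : Real.exp (-(L * (w ξ).re) - η * ((w ξ)⁻¹).re) ≤ 1 := by
            rw [Real.exp_le_one_iff]
            have h4 := mul_pos hL0 hw1
            have h5 := mul_pos hη hi
            linarith
          have hfξ : ‖f ξ‖ ≤ ε := by
            obtain ⟨β, hβ, hβu⟩ := huK
            rcases hβ.1.eq_or_lt with rfl | hβ1
            · exact (hf₁ ξ hξb (hξr'.trans hrr₁) (by rw [hdu, hβu])).le
            rcases hβ.2.eq_or_lt with rfl | hβ2
            · exact (hf₂ ξ hξb (hξr'.trans hrr₂) (by rw [hdu, hβu])).le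
            · refine absurd ?_ hξ.2
              refine ⟨hξb, hξr', ?_⟩
              rw [← angleFrom_direction ν h0, hdu, ← hβu,
                angleFrom_mul_exp ν ⟨h₁.trans hβ1, hβ2.trans h₂⟩]
              exact ⟨hβ1, hβ2⟩
          exact (mul_le_mul hfξ hle1 (Real.exp_pos _).le hε.le).trans_eq (mul_one _)
    have hΩf : ∀ z ∈ Ω, ‖f z‖ ≤ 2 * ε * Real.exp (L * Real.sqrt (dist z (ζ : ℂ))) := by
      intro z hz
      obtain ⟨hw1, hw2, hw3⟩ := hw z hz.1
      have h1 : ‖f z‖ * Real.exp (-(L * (w z).re)) ≤ 2 * ε := by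
        have h2 : Tendsto (fun η : ℝ => ‖f z‖ * Real.exp (-(L * (w z).re) - η * ((w z)⁻¹).re)) (𝓝[>] 0)
            (𝓝 (‖f z‖ * Real.exp (-(L * (w z).re) - 0 * ((w z)⁻¹).re))) :=
          (Continuous.tendsto (by fun_prop) 0).mono_left nhdsWithin_le_nhds
        rw [zero_mul, sub_zero] at h2
        refine le_of_tendsto h2 ?_
        filter_upwards [self_mem_nhdsWithin] with η hη
        have h3 := key η hη z hz
        rwa [norm_mul, hexp] at h3
      have h4 : (w z).re ≤ Real.sqrt (dist z (ζ : ℂ)) := by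
        rw [dist_eq_norm, ← hw2, Real.sqrt_sq (norm_nonneg _)]
        exact re_le_norm _
      rw [Real.exp_neg, ← div_eq_mul_inv, div_le_iff₀ (Real.exp_pos _)] at h1
      refine h1.trans (mul_le_mul_of_nonneg_left (Real.exp_le_exp.2 ?_) (by positivity))
      exact mul_le_mul_of_nonneg_left h4 hL0.le
    have hα' : α ∈ Icc θ₁ θ₂ := Ioo_subset_Icc_self hα
    have hT := tendsto_prodMk_rayEnd (hP.len_pos (e α))
    have hlim1 := ((hb α hα').comp hT).norm
    have hlim2 := hP.tendsto (e α)
    rw [hE α hα'] at hlim2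
    have hlim3 : Tendsto (fun t : ℝ => 2 * ε * Real.exp (L * Real.sqrt (dist (expMap ρ z₀ (t * e α)) (ζ : ℂ))))
        (comap ENNReal.ofReal (𝓝[<] len (e α))) (𝓝 (2 * ε * Real.exp (L * Real.sqrt (dist (ζ : ℂ) ζ)))) := by
      have hc : Continuous fun z : ℂ => 2 * ε * Real.exp (L * Real.sqrt (dist z (ζ : ℂ))) := by fun_prop
      exact (hc.tendsto _).comp hlim2
    rw [dist_self, Real.sqrt_zero, mul_zero, Real.exp_zero, mul_one] at hlim3
    have := comap_ofReal_nhdsLT_neBot (hP.len_pos (e α))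
    refine le_of_tendsto_of_tendsto hlim1 hlim3 ?_
    filter_upwards [hlim2.eventually (ball_mem_nhds _ hr), (tendsto_rayEnd_iff.1 hT).2.2,
      (tendsto_rayEnd_iff.1 hT).2.1.eventually (lt_mem_nhds (hP.len_pos (e α)))] with t ht1 ht2 ht3
    have ht0 : 0 < t := ENNReal.ofReal_pos.1 ht3
    have hdom := (hP.mem_iff (e α) t ht0.le).2 ht2.2
    refine hΩf _ ⟨expMap_mem hdom, ht1, ?_⟩
    rw [hS.left_inv _ hdom, angleFrom_real_mul ν ht0, angleFrom_mul_exp ν ⟨h₁.trans hα.1, hα.2.trans h₂⟩]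
    exact hα
  have h3 : ‖b (e α)‖ ≤ 0 := le_of_forall_pos_le_add fun ε hε => by
    have := hsmall (ε / 2) (half_pos hε)
    linarith
  exact norm_le_zero_iff.1 h3

end Sector

/-! ### Boundary values -/

section Sector

variable {ρ : ℂ → ℝ} {z₀ : ℂ} {len : Circle → ℝ≥0∞} {E : Circle → Circle} {S : ℂ → ℂ}

/-- Applied to `(f - b₁) (f - b₂)`, with `b₁`, `b₂` the edge limits, the vanishing lemma shows that
every ray limit in the sector is `b₁` or `b₂`; continuity in the direction then forbids `b₁ ≠ b₂`.
-/
theorem IsExpInverse.limit_eq_of_sector (hρ : ContDiffOn ℝ ∞ ρ (ball 0 1))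
    (hcurv : ∀ z ∈ ball (0 : ℂ) 1, 0 ≤ dzdzbar ρ z)
    (hP : IsPolarSystem ρ z₀ len E) (hS : IsExpInverse ρ z₀ S) {ν ζ : Circle} {θ₁ θ₂ : ℝ}
    (h₁ : -Real.pi < θ₁) (h₂ : θ₂ < Real.pi) (hle : θ₁ ≤ θ₂)
    (hE : ∀ α ∈ Icc θ₁ θ₂, E (ν * Circle.exp α) = ζ) {f : ℂ → ℂ} (hf : DifferentiableOn ℂ f (ball 0 1))
    {b : Circle → ℂ} (hb : ∀ α ∈ Icc θ₁ θ₂, Tendsto (fun q : Circle × ℝ => f (expMap ρ z₀ (q.2 * q.1)))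
      (rayEnd len (ν * Circle.exp α)) (𝓝 (b (ν * Circle.exp α)))) :
    b (ν * Circle.exp θ₁) = b (ν * Circle.exp θ₂) := by
  set e : ℝ → Circle := fun α => ν * Circle.exp α with he
  have hec : Continuous e := continuous_const.mul Circle.exp.continuous
  have hbc : ContinuousOn (fun α => b (e α)) (Icc θ₁ θ₂) := by
    have h1 : ContinuousOn b (e '' Icc θ₁ θ₂) := by
      refine continuousOn_of_tendsto_rayEnd hP.continuous_len hP.len_pos
        (Q := fun q : Circle × ℝ => f (expMap ρ z₀ (q.2 * q.1))) ?_
      rintro _ ⟨α, hα, rfl⟩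
      exact hb α hα
    exact h1.comp hec.continuousOn (mapsTo_image e _)
  have hval : ∀ α ∈ Ioo θ₁ θ₂, b (e α) = b (e θ₁) ∨ b (e α) = b (e θ₂) := by
    intro α hα
    have h3 := hS.eq_zero_of_sector hρ hcurv hP h₁ h₂ hE
      (f := fun z => (f z - b (e θ₁)) * (f z - b (e θ₂))) ((hf.sub_const _).mul (hf.sub_const _))
      (b := fun u => (b u - b (e θ₁)) * (b u - b (e θ₂)))
      (fun α hα => ((hb α hα).sub_const _).mul ((hb α hα).sub_const _)) (by simp [he]) (by simp [he]) hα
    rcases mul_eq_zero.1 h3 with h | h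
    · exact Or.inl (sub_eq_zero.1 h)
    · exact Or.inr (sub_eq_zero.1 h)
  by_contra hne
  have hpos : 0 < ‖b (e θ₂) - b (e θ₁)‖ := norm_pos_iff.2 (sub_ne_zero.2 (Ne.symm hne))
  have hc : ContinuousOn (fun α => ‖b (e α) - b (e θ₁)‖) (Icc θ₁ θ₂) := (hbc.sub continuousOn_const).norm
  obtain ⟨α, hα, hα'⟩ := intermediate_value_Ioo hle hc
    (show ‖b (e θ₂) - b (e θ₁)‖ / 2 ∈ Ioo _ _ from ⟨by simpa using hpos, by linarith⟩)
  simp only at hα'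
  rcases hval α hα with h | h
  · rw [h, sub_self, norm_zero] at hα'
    linarith
  · rw [h] at hα'
    linarith

variable {F χ : Fin 3 → ℂ → ℂ} {σ : ℂ → ℝ}

theorem continuous_rePoint : Continuous rePoint :=
  (PiLp.continuous_toLp 2 _).comp (continuous_pi fun j => continuous_re.comp (continuous_apply j))

/-- Near a direction with finite limit the null curve converges along all rays, and the sector
theorem for each `F j` makes `Φ` locally constant on the arc. A finite value is thus taken on a
clopen set; if there is none, `Φ` is `∞` throughout. -/
theorem IsExpInverse.surface_limit_eq (hρ : ContDiffOn ℝ ∞ ρ (ball 0 1))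
    (hcurv : ∀ z ∈ ball (0 : ℂ) 1, 0 ≤ dzdzbar ρ z)
    (hP : IsPolarSystem ρ z₀ len E) (hS : IsExpInverse ρ z₀ S) (h : IsNullCurve F χ σ)
    (hgrowth : ∀ u, ∃ p, ∃ N ∈ 𝓝 u, ∃ c₀ > 0, HasGrowth F σ ρ z₀ len p N c₀)
    {Φ : Circle → OnePoint (EuclideanSpace ℝ (Fin 3))}
    (hΦ : ∀ u, Tendsto (fun q => (polarSurface F ρ z₀ q : OnePoint (EuclideanSpace ℝ (Fin 3))))
      (rayEnd len u) (𝓝 (Φ u)))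
    {ν ζ : Circle} {θ₁ θ₂ : ℝ} (h₁ : -Real.pi < θ₁) (h₂ : θ₂ < Real.pi)
    (hE : ∀ α ∈ Icc θ₁ θ₂, E (ν * Circle.exp α) = ζ) {α β : ℝ} (hα : α ∈ Icc θ₁ θ₂) (hβ : β ∈ Icc θ₁ θ₂) :
    Φ (ν * Circle.exp α) = Φ (ν * Circle.exp β) := by
  set e : ℝ → Circle := fun α => ν * Circle.exp α with he
  have hec : Continuous e := continuous_const.mul Circle.exp.continuous
  have hΦc : Continuous Φ := continuousOn_univ.1
    (continuousOn_of_tendsto_rayEnd hP.continuous_len hP.len_pos fun u _ => hΦ u)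
  have hloc : ∀ α₀ ∈ Icc θ₁ θ₂, Φ (e α₀) ≠ OnePoint.infty →
      ∀ᶠ α in 𝓝 α₀, α ∈ Icc θ₁ θ₂ → Φ (e α) = Φ (e α₀) := by
    intro α₀ hα₀ hfin
    obtain ⟨x, hx⟩ := OnePoint.ne_infty_iff_exists.1 hfin
    obtain ⟨p, N, hN, c₀, hc₀, hg⟩ := hgrowth (e α₀)
    have hxlim : Tendsto (polarSurface F ρ z₀) (rayEnd len (e α₀)) (𝓝 x) := by
      have := hΦ (e α₀)
      rw [← hx] at this
      exact OnePoint.isOpenEmbedding_coe.isInducing.tendsto_nhds_iff.2 this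
    have h3 := hec.continuousAt.eventually (hg.exists_tendsto_nullCurve hc₀ h hρ hcurv hP hN hxlim)
    obtain ⟨r, hr, hball⟩ := Metric.eventually_nhds_iff_ball.1 h3
    filter_upwards [ball_mem_nhds α₀ hr] with α hα hαI
    -- Limits are selected where they exist; the default `0` elsewhere is never used.
    have hex : ∀ u : Circle, ∃ b : Fin 3 → ℂ, ∀ j, (∃ y : ℂ, Tendsto
        (fun q : Circle × ℝ => F j (expMap ρ z₀ (q.2 * q.1))) (rayEnd len u) (𝓝 y)) → Tendsto
        (fun q : Circle × ℝ => F j (expMap ρ z₀ (q.2 * q.1))) (rayEnd len u) (𝓝 (b j)) := by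
      intro u
      have : ∀ j, ∃ b : ℂ, (∃ y : ℂ, Tendsto
        (fun q : Circle × ℝ => F j (expMap ρ z₀ (q.2 * q.1))) (rayEnd len u) (𝓝 y)) → Tendsto
        (fun q : Circle × ℝ => F j (expMap ρ z₀ (q.2 * q.1))) (rayEnd len u) (𝓝 b) := fun j => by
        by_cases hy : ∃ y : ℂ, Tendsto
          (fun q : Circle × ℝ => F j (expMap ρ z₀ (q.2 * q.1))) (rayEnd len u) (𝓝 y)
        · exact ⟨hy.choose, fun _ => hy.choose_spec⟩
        · exact ⟨0, fun h => absurd h hy⟩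
      choose b hb using this
      exact ⟨b, hb⟩
    choose b hb using hex
    have hΦb : ∀ γ ∈ ball α₀ r, Φ (e γ) = ((rePoint (b (e γ)) : EuclideanSpace ℝ (Fin 3)) : OnePoint _) := by
      intro γ hγ
      have := rayEnd_neBot (hP.len_pos (e γ))
      refine tendsto_nhds_unique (hΦ (e γ)) ((OnePoint.continuous_coe.tendsto _).comp ?_)
      exact (continuous_rePoint.tendsto _).comp
        (tendsto_pi_nhds.2 fun j => hb (e γ) j (hball γ hγ j))
    have hsub : Icc (min α₀ α) (max α₀ α) ⊆ Icc θ₁ θ₂ := by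
      change uIcc α₀ α ⊆ _
      exact ordConnected_Icc.uIcc_subset hα₀ hαI
    have hsubb : Icc (min α₀ α) (max α₀ α) ⊆ ball α₀ r := by
      have h4 : (ball α₀ r).OrdConnected := by rw [Real.ball_eq_Ioo]; exact ordConnected_Ioo
      exact h4.uIcc_subset (mem_ball_self hr) hα
    have hend : b (e (min α₀ α)) = b (e (max α₀ α)) := by
      ext j
      have hm : min α₀ α ∈ Icc θ₁ θ₂ := hsub ⟨le_rfl, min_le_max⟩
      have hM : max α₀ α ∈ Icc θ₁ θ₂ := hsub ⟨min_le_max, le_rfl⟩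
      exact hS.limit_eq_of_sector hρ hcurv hP (h₁.trans_le hm.1) (hM.2.trans_lt h₂) min_le_max
        (fun γ hγ => hE γ (hsub hγ))
        (fun z hz => (h.hasDerivAt j z hz).differentiableAt.differentiableWithinAt)
        (b := fun u => b u j) fun γ hγ => hb (e γ) j (hball γ (hsubb hγ) j)
    rw [hΦb α hα, hΦb α₀ (mem_ball_self hr)]
    rcases le_total α₀ α with h4 | h4
    · rw [min_eq_left h4, max_eq_right h4] at hend
      rw [hend]
    · rw [min_eq_right h4, max_eq_left h4] at hend
      rw [hend]
  by_cases hall : ∀ α ∈ Icc θ₁ θ₂, Φ (e α) = OnePoint.infty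
  · rw [hall α hα, hall β hβ]
  push Not at hall
  obtain ⟨α₀, hα₀, hfin⟩ := hall
  have : PreconnectedSpace (Icc θ₁ θ₂) := Subtype.preconnectedSpace isPreconnected_Icc
  have hclopen : IsClopen {α : Icc θ₁ θ₂ | Φ (e α) = Φ (e α₀)} := by
    refine ⟨isClosed_eq (hΦc.comp (hec.comp continuous_subtype_val)) continuous_const, ?_⟩
    rw [isOpen_iff_mem_nhds]
    intro γ hγ
    have h4 := hloc γ γ.2 (by rw [show Φ (e γ) = Φ (e α₀) from hγ]; exact hfin)
    have h5 := (continuous_subtype_val.tendsto γ).eventually h4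
    filter_upwards [h5] with x hx
    exact (hx x.2).trans hγ
  have huniv := hclopen.eq_univ ⟨⟨α₀, hα₀⟩, rfl⟩
  have h6 : ∀ x ∈ Icc θ₁ θ₂, Φ (e x) = Φ (e α₀) := fun x hx => by
    have : (⟨x, hx⟩ : Icc θ₁ θ₂) ∈ {α : Icc θ₁ θ₂ | Φ (e α) = Φ (e α₀)} := huniv ▸ mem_univ _
    exact this
  rw [h6 α hα, h6 β hβ]

/-- Along an ultrafilter tending to `ζ` the directions converge to some `u` and the surface to `Φ
u`. An arc of directions ending at `ζ` joins `u` to the fixed `u₀`, so the limit does not depend on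
the ultrafilter. -/
theorem IsExpInverse.exists_tendsto_boundary (hρ : ContDiffOn ℝ ∞ ρ (ball 0 1))
    (hcurv : ∀ z ∈ ball (0 : ℂ) 1, 0 ≤ dzdzbar ρ z)
    (hP : IsPolarSystem ρ z₀ len E) (hS : IsExpInverse ρ z₀ S) (h : IsNullCurve F χ σ)
    (hgrowth : ∀ u, ∃ p, ∃ N ∈ 𝓝 u, ∃ c₀ > 0, HasGrowth F σ ρ z₀ len p N c₀)
    {Φ : Circle → OnePoint (EuclideanSpace ℝ (Fin 3))}
    (hΦ : ∀ u, Tendsto (fun q => (polarSurface F ρ z₀ q : OnePoint (EuclideanSpace ℝ (Fin 3))))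
      (rayEnd len u) (𝓝 (Φ u))) (ζ : Circle) :
    ∃ Y, Tendsto (fun z => ((rePoint fun j => F j z : EuclideanSpace ℝ (Fin 3)) : OnePoint (EuclideanSpace ℝ (Fin 3))))
      (𝓝[ball 0 1] (ζ : ℂ)) (𝓝 Y) := by
  obtain ⟨u₀, hu₀⟩ := hP.surjective_endpoint ζ
  refine ⟨Φ u₀, (tendsto_iff_ultrafilter _ _ _).2 fun G hG => ?_⟩
  have hball : ∀ᶠ z in (G : Filter ℂ), z ∈ ball (0 : ℂ) 1 := hG self_mem_nhdsWithin
  obtain ⟨u, -, hu⟩ := IsExpInverse.exists_tendsto_direction (S := S) isClosed_univ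
    (G := G) (Eventually.of_forall fun z => mem_univ _)
  obtain ⟨ν, θ₀, θ, hθ₀, hθ, rfl, rfl, harc⟩ := hS.exists_arc hρ hcurv hP hG hu hu₀
  have heq := hS.surface_limit_eq hρ hcurv hP h hgrowth hΦ (θ₁ := min θ₀ θ) (θ₂ := max θ₀ θ)
    (lt_min hθ₀.1 hθ.1) (max_lt hθ₀.2 hθ.2) harc (left_mem_uIcc (a := θ₀) (b := θ)) right_mem_uIcc
  rw [heq]
  refine ((hΦ _).comp (hS.tendsto_rayEnd hρ hcurv hP hG hu)).congr' ?_
  filter_upwards [hball] with z hz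
  simp only [Function.comp_apply, polarSurface, hS.expMap_polar hz]

end Sector

/-! ### Extension to the closed disk and conclusion -/

theorem exists_continuousOn_extension {Y : Type*} [TopologicalSpace Y] [T3Space Y] {f : ℂ → Y}
    (hf : ContinuousOn f (ball 0 1)) (hlim : ∀ ζ : Circle, ∃ y, Tendsto f (𝓝[ball 0 1] (ζ : ℂ)) (𝓝 y)) :
    ∃ G : ℂ → Y, ContinuousOn G (closedBall 0 1) ∧ ∀ z ∈ ball (0 : ℂ) 1, G z = f z := by
  have hcl : closure (ball (0 : ℂ) 1) = closedBall 0 1 := closure_ball 0 one_ne_zero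
  refine ⟨extendFrom (ball 0 1) f, continuousOn_extendFrom hcl.ge fun z hz => ?_, fun z hz =>
    extendFrom_eq (subset_closure hz) (hf z hz)⟩
  rcases (mem_closedBall_zero_iff.1 hz).eq_or_lt with h | h
  · exact hlim ⟨z, mem_sphere_zero_iff_norm.2 h⟩
  · exact ⟨f z, hf z (mem_ball_zero_iff.2 h)⟩

theorem theorem5p3
    -- the harmonic mapping `f = h + conj g`, whose dilatation is `q ^ 2`
    (f h g q : ℂ → ℂ) (a : ℂ)
    (hf : IsCanonicalDecomposition f h g a)
    (hq : DilatationIsSquare h g q)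
    (hreg : ∀ z ∈ ball (0 : ℂ) 1, ‖deriv h z‖ + ‖deriv g z‖ ≠ 0)
    -- the conformal metric `e ^ (2 ρ) |dz|²`, of non-positive curvature
    (ρ : ℂ → ℝ) (hρ : ContDiffOn ℝ ∞ ρ (ball 0 1))
    (hcurv : ∀ z ∈ ball (0 : ℂ) 1, gaussCurvature ρ z ≤ 0)
    (δ : ℝ≥0∞) (hδ : 0 < δ)
    (hjoin : JoinedByGeodesicsShorterThan ρ δ)
    -- the criterion; `1 / δ²` is `0` when `δ = ∞`
    (hcrit : ∀ z ∈ ball (0 : ℂ) 1,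
      ‖conformalSchwarzian (liftExponent h g) z - conformalSchwarzian ρ z‖
          + Real.exp (2 * liftExponent h g z) * |gaussCurvature (liftExponent h g) z|
        ≤ 2 * Real.pi ^ 2 * Real.exp (2 * ρ z) * (δ⁻¹).toReal ^ 2 + 2 * dzdzbar ρ z)
    (hcomplete : IsCompleteMetric ρ → ULP ρ)
    (hincomplete : ¬ IsCompleteMetric ρ → ULPStar ρ) :
    -- `OnePoint` of Euclidean 3-space is the sphere with the topology of the spherical metric
    ∃ F : ℂ → OnePoint (EuclideanSpace ℝ (Fin 3)),
      ContinuousOn F (closedBall 0 1) ∧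
      ∀ z ∈ ball (0 : ℂ) 1, F z = (harmonicLift f h q a z : OnePoint (EuclideanSpace ℝ (Fin 3))) := by
  have hdz : ∀ z ∈ ball (0 : ℂ) 1, 0 ≤ dzdzbar ρ z := fun z hz => by
    have h1 := gaussCurvature_eq (contDiffAt_two hρ hz)
    have h2 := mul_nonpos_of_nonneg_of_nonpos (Real.exp_pos (2 * ρ z)).le (hcurv z hz)
    linarith
  have hall : ∀ z ∈ ball (0 : ℂ) 1, ∃ len E, IsPolarSystem ρ z len E := fun z hz =>
    exists_isPolarSystem hρ hdz hcomplete hincomplete hz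
  obtain ⟨len, E, hP⟩ := hall 0 (mem_ball_self one_pos)
  obtain ⟨S, hSc, hSr, hSl⟩ := hP.exists_inverse hρ hdz
  have hS : IsExpInverse ρ 0 S := ⟨hSc, fun z hz => (hSr z hz).1, fun z hz => (hSr z hz).2, hSl⟩
  obtain ⟨F, χ, hF, hlift⟩ := exists_isNullCurve hf hq hreg
  have hcrit' : SatisfiesCriterion (liftExponent h g) ρ (Real.pi ^ 2 * (δ⁻¹).toReal ^ 2) := fun z hz =>
    (hcrit z hz).trans_eq (by ring)
  have hgrowth : ∀ u, ∃ p, ∃ N ∈ 𝓝 u, ∃ c₀ > 0, HasGrowth F (liftExponent h g) ρ 0 len p N c₀ := by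
    intro u
    obtain ⟨y, y1, hy, hy1, m, hm, N, hN, hmN⟩ := exists_comparison hP.continuous_len hδ (u := u)
      fun hδt => hP.len_lt hρ hdz hjoin hδt hall u
    obtain ⟨p, N', c₀, hN', hc₀, hgr⟩ := hF.exists_growth hρ hcrit' hP hy hy1 hm hN hmN
    exact ⟨p, N', hN', c₀, hc₀, hgr⟩
  have hlim : ∀ u, ∃ Y, Tendsto (fun q => (polarSurface F ρ 0 q : OnePoint (EuclideanSpace ℝ (Fin 3))))
      (rayEnd len u) (𝓝 Y) := by
    intro u
    obtain ⟨p, N, hN, c₀, hc₀, hg⟩ := hgrowth u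
    exact hg.exists_tendsto hc₀ hF hρ hdz hcrit' hP hN
  choose Φ hΦ using hlim
  obtain ⟨G, hG, hGeq⟩ := exists_continuousOn_extension
    (f := fun z => ((rePoint fun j => F j z : EuclideanSpace ℝ (Fin 3)) : OnePoint (EuclideanSpace ℝ (Fin 3))))
    (OnePoint.continuous_coe.comp_continuousOn hF.continuousOn_rePoint)
    (hS.exists_tendsto_boundary hρ hdz hP hF hgrowth hΦ)
  exact ⟨G, hG, fun z hz => by rw [hGeq z hz, hlift z hz]⟩
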